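/- **Conventions.** $\mathbb N=\{1,2,\dots\}$, $a\wedge b=\min\{a,b\}$, $\phi(t)=\log(1+e^{-t})$, and $\mathrm{sgn}(t)=1$ if $t\ge 0$, $\mathrm{sgn}(t)=-1$ if $t<0$. For sequences indexed by $n$, $u_n\lesssim v_n$ means that there are $n_0\in\mathbb N$ and a constant $C\in(0,\infty)$ independent of $n$ with $u_n\le C v_n$ for all $n\ge n_0$; $u_n\asymp v_n$ means $u_n\lesssim v_n$ and $v_n\lesssim u_n$. **Networks.** For $(G,N,S,B,F)$, let $\mathcal F_d(G,N,S,B,F)$ be the set of functions $f:\mathbb R^d\to\mathbb R$, $f(x)=W_L\sigma_{v_L}W_{L-1}\sigma_{v_{L-1}}\cdots W_1\sigma_{v_1}W_0x$, where $W_k\in\mathbb R^{m_{k+1}\times m_k}$, $v_k\in\mathbb R^{m_k}$, $m_0=d$, $m_{L+1}=1$, and $\sigma_v(z)=\max\{z-v,0\}$ componentwise, such that the number $L\ge 0$ of hidden layers is at most $G$, all hidden widths $m_1,\dots,m_L$ are at most $N$, the total number of nonzero entries of all $W_k$ and $v_k$ is at most $S$, all these entries are at most $B$ in absolute value, and $\sup_{x\in[0,1]^d}|f(x)|\le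 F$. **Function classes.** For $\beta,r\in(0,\infty)$ put $k=\lceil\beta\rceil-1$, $\lambda=\beta-\lceil\beta\rceil+1$, and let $\mathcal B^\beta_r([0,1]^s)$ be the set of $g:[0,1]^s\to\mathbb R$ with continuous partial derivatives up to order $k$ and $$\max_{|m|\le k}\sup_{x}|D^mg(x)|+\max_{|m|=k}\sup_{x\ne z}\frac{|D^mg(x)-D^mg(z)|}{\|x-z\|_2^{\lambda}}\le r .$$ For $d_\star,d_*\in\mathbb N$ let $\mathcal G_d$ be the set of functions $f:[0,1]^d\to\mathbb R$ that are either of the form $f(x)=\max_{i\in I}x_i$ with $I\subset\{1,\dots,d\}$, $1\le\#I\le d_\star$, or of the form $f(x)=g(x_{i_1},\dots,x_{i_{d_*}})$ with $1\le i_1<\dots<i_{d_*}\le d$ and $g\in\mathcal B^\beta_r([0,1]^{d_*})$. For $q\in\mathbb N\cup\{0\}$ and $K\in\mathbb N$, let $\mathcal G_d^{\mathrm{CHOM}}(q,K,d_\star,d_*,\beta,r)$ be the set of compositions $h_q\circ\cdots\circ h_1\circ h_0$, where $h_0$ has domain $[0,1]^d$, $h_i$ has domain $[0,1]^K$ for $0<i\le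 q$, $h_i$ takes values in $[0,1]^K$ for $0\le i<q$, $h_q$ is real-valued, and $h_q$ as well as every coordinate function of $h_0,\dots,h_{q-1}$ belongs to $\mathcal G_d$ or $\mathcal G_K$, according to its domain. **Risks.** For a Borel probability measure $P$ on $[0,1]^d\times\{-1,1\}$ and a Borel function $f$ on $[0,1]^d$ put $\mathcal R^\phi_P(f)=\int\phi(yf(x))\,dP(x,y)\in[0,\infty]$, $\mathcal R_P(f)=P(\{(x,y):y\ne\mathrm{sgn}(f(x))\})$, $\mathcal E^\phi_P(f)=\mathcal R^\phi_P(f)-\inf_g\mathcal R^\phi_P(g)$ and $\mathcal E_P(f)=\mathcal R_P(f)-\inf_g\mathcal R_P(g)$, the infima being over all Borel functions $g:[0,1]^d\to\mathbb R$. Let $P_X$ be the marginal of $P$ on $[0,1]^d$ and $P(\cdot|x)$ the regular conditional distribution of the label. Let $\mathcal H$ be the set of all $P$ for which there is $\hat\eta\in\mathcal G_d^{\mathrm{CHOM}}(q,K,d_\star,d_*,\beta,r)$ with $P(\{1\}|x)=\hat\eta(x)$ for $P_X$-almost every $x$. **Theorem 2.3.** Let $q\in\mathbb N\cup\{0\}$,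 $d_\star,d_*\in\mathbb N$, $\beta,r\in(0,\infty)$, and write $\beta_q=\beta(1\wedge\beta)^q$. There is a constant $c\in(0,\infty)$ depending only on $(d_\star,d_*,\beta,r,q)$ such that the following holds for all $d,K\in\mathbb N$ with $d_*\le d$ if $q=0$ and $d_*\le\min\{d,K\}$ if $q>0$, and for all $\nu\in[0,\infty)$. Let $G,N,S,B,F$ depend on $n$ in such a way that, for all large $n$, $c\log n\le G$, $1\le B$ and $\frac{\beta_q}{d_*+\beta_q}\log n\le F$, and $$G\lesssim\log n,\quad N\asymp\Big(\tfrac{(\log n)^5}{n}\Big)^{\frac{-d_*}{d_*+\beta_q}},\quad S\asymp\Big(\tfrac{(\log n)^5}{n}\Big)^{\frac{-d_*}{d_*+\beta_q}}\log n,\quad B\lesssim n^\nu,\quad F\lesssim\log n .$$ For each $n$ let $\hat f_n$ be a (measurable) statistic of a sample $(X_1,Y_1),\dots,(X_n,Y_n)$ in $[0,1]^d\times\{-1,1\}$ with $$\hat f_n\in\operatorname*{arg\,min}_{f\in\mathcal F_d(G,N,S,B,F)}\frac1n\sum_{i=1}^n\phi(Y_if(X_i)).$$ Then, with the expectation taken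 for an i.i.d. sample with distribution $P$, $$\sup_{P\in\mathcal H}\mathbf E_{P^{\otimes n}}\big[\mathcal E^\phi_P(\hat f_n)\big]\lesssim\Big(\tfrac{(\log n)^5}{n}\Big)^{\frac{\beta_q}{d_*+\beta_q}}\quad\text{and}\quad\sup_{P\in\mathcal H}\mathbf E_{P^{\otimes n}}\big[\mathcal E_P(\hat f_n)\big]\lesssim\Big(\tfrac{(\log n)^5}{n}\Big)^{\frac{\beta_q}{2d_*+2\beta_q}} .$$ -/

import Mathlib

open MeasureTheory Filter
open scoped ENNReal NNReal

noncomputable section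

namespace LogisticDNN

/-! ### Input space, labels, asymptotic comparison -/

/-- The input space `[0,1]^d`, with its product (Borel) sigma-algebra. -/
abbrev Cube (d : ℕ) : Type := Fin d → unitInterval

/-- A point of `[0,1]^d` regarded as a vector of `ℝ^d`. -/
def toVec {d : ℕ} (x : Cube d) : Fin d → ℝ := fun i => (x i : ℝ)

/-- The label space `{-1, 1}`. -/
abbrev Label : Type := ↥({-1, 1} : Set ℝ)

instance : Nonempty Label := ⟨⟨1, by simp⟩⟩

/-- `u ≲ v`: from some index on, `u n ≤ c * v n` with a positive constant `c` independent of `n`.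
Used for real and for `[0,∞]`-valued sequences. -/
def Lesssim {α : Type} [LE α] [SMul ℝ≥0 α] (u v : ℕ → α) : Prop :=
  ∃ n₀ : ℕ, ∃ c : ℝ≥0, 0 < c ∧ ∀ n, n₀ ≤ n → u n ≤ c • v n

/-- `u ≍ v`: both `u ≲ v` and `v ≲ u`. -/
def Asymp {α : Type} [LE α] [SMul ℝ≥0 α] (u v : ℕ → α) : Prop :=
  Lesssim u v ∧ Lesssim v u

/-! ### ReLU networks -/

/-- Parameters of a ReLU network with `m` inputs and one output:
`out W` is the network `x ↦ W x` without hidden layer, and `hidden W v T` is the network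
`x ↦ T (σ (W x - v))`, whose first hidden layer has `m'` units. Hence
`hidden W₀ v₁ (hidden W₁ v₂ (⋯ (out W_L)))` carries the weights `W₀, …, W_L` and the
biases `v₁, …, v_L` of `x ↦ W_L σ_{v_L} W_{L-1} ⋯ W₁ σ_{v₁} W₀ x`. -/
inductive Net : ℕ → Type
  | out {m : ℕ} (W : Matrix (Fin 1) (Fin m) ℝ) : Net m
  | hidden {m m' : ℕ} (W : Matrix (Fin m') (Fin m) ℝ) (v : Fin m' → ℝ) (T : Net m') : Net m

namespace Net

/-- The function `ℝ^m → ℝ` computed by a network. -/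
def eval : {m : ℕ} → Net m → (Fin m → ℝ) → ℝ
  | _, out W, x => W.mulVec x 0
  | _, hidden W v T, x => T.eval fun i => max (W.mulVec x i - v i) 0

/-- The number `L` of hidden layers. -/
def depth : {m : ℕ} → Net m → ℕ
  | _, out _ => 0
  | _, hidden _ _ T => T.depth + 1

/-- Every hidden layer has at least one and at most `N` units. -/
def WidthLE (N : ℝ) : {m : ℕ} → Net m → Prop
  | _, out _ => True
  | _, hidden (m' := m') _ _ T => 1 ≤ m' ∧ (m' : ℝ) ≤ N ∧ T.WidthLE N

/-- The number of nonzero entries of all weight matrices and bias vectors. -/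
def nonzeros : {m : ℕ} → Net m → ℕ
  | _, out W => Set.ncard {p : Fin 1 × Fin _ | W p.1 p.2 ≠ 0}
  | _, hidden W v T =>
      Set.ncard {p : Fin _ × Fin _ | W p.1 p.2 ≠ 0} + Set.ncard {i | v i ≠ 0} + T.nonzeros

/-- All entries of the weight matrices and bias vectors are at most `B` in absolute value. -/
def ParamsLE (B : ℝ) : {m : ℕ} → Net m → Prop
  | _, out W => ∀ i j, |W i j| ≤ B
  | _, hidden W v T => (∀ i j, |W i j| ≤ B) ∧ (∀ i, |v i| ≤ B) ∧ T.ParamsLE B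

end Net

/-- The space of fully connected ReLU networks on `ℝ^d` with depth at most `G`, width at most `N`,
at most `S` nonzero parameters, parameters bounded by `B`, and values on `[0,1]^d`
bounded by `F`. -/
def FNN (d : ℕ) (G N S B F : ℝ) : Set ((Fin d → ℝ) → ℝ) :=
  {f | (∃ T : Net d, T.eval = f ∧ (T.depth : ℝ) ≤ G ∧ T.WidthLE N ∧ (T.nonzeros : ℝ) ≤ S ∧
        T.ParamsLE B) ∧
      ∀ x : Cube d, |f (toVec x)| ≤ F}

/-! ### Hölder balls and the compositional class -/

/-- Partial derivative of `g` on the closed cube `[0,1]^d` in the coordinate directions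
`I 0, …, I (j-1)`; as `I` runs over all tuples of length `j`, these are all
the partial derivatives of order `j`. -/
def partialD {d : ℕ} (g : (Fin d → ℝ) → ℝ) {j : ℕ} (I : Fin j → Fin d) (x : Fin d → ℝ) : ℝ :=
  iteratedFDerivWithin ℝ j g (Set.Icc 0 1) x fun i => Pi.single (I i) 1

/-- The closed ball of radius `r` of the Hölder space of order `β` on `[0,1]^d`. With
`k = ⌈β⌉ - 1` and `l = β - ⌈β⌉ + 1 ∈ (0,1]`, the function `g` is `C^k` on the closed cube, and
the sum of the largest sup norm of a partial derivative of order at most `k` and of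
the largest `l`-Hölder seminorm (Euclidean distance) of a partial derivative of order `k` is at
most `r`. Only the values of `g` on the cube matter. -/
def HolderBall (d : ℕ) (β r : ℝ) : Set ((Fin d → ℝ) → ℝ) :=
  {g | ContDiffOn ℝ ((⌈β⌉₊ - 1 : ℕ) : WithTop ℕ∞) g (Set.Icc 0 1) ∧
    ∃ a b : ℝ, 0 ≤ a ∧ 0 ≤ b ∧ a + b ≤ r ∧
      (∀ j : ℕ, j ≤ ⌈β⌉₊ - 1 → ∀ I : Fin j → Fin d, ∀ x ∈ Set.Icc (0 : Fin d → ℝ) 1,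
        |partialD g I x| ≤ a) ∧
      (∀ I : Fin (⌈β⌉₊ - 1) → Fin d, ∀ x ∈ Set.Icc (0 : Fin d → ℝ) 1,
        ∀ z ∈ Set.Icc (0 : Fin d → ℝ) 1,
        |partialD g I x - partialD g I z| ≤
          b * dist (WithLp.toLp 2 x) (WithLp.toLp 2 z) ^ (β - (⌈β⌉₊ : ℝ) + 1))}

/-- Functions on `[0,1]^d` which compute the maximum of at least one and at most `dmax`
coordinates. -/
def GM (d dmax : ℕ) : Set (Cube d → ℝ) :=
  {f | ∃ (I : Finset (Fin d)) (hI : I.Nonempty), I.card ≤ dmax ∧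
    ∀ x, f x = I.sup' hI fun i => (x i : ℝ)}

/-- Functions on `[0,1]^d` of the form `x ↦ g (x_{i₁}, …, x_{i_s})` with `i₁ < ⋯ < i_s`, `s = dhol`
and `g` in the Hölder ball of order `β` and radius `r` on `[0,1]^s`. -/
def GH (d dhol : ℕ) (β r : ℝ) : Set (Cube d → ℝ) :=
  {f | ∃ e : Fin dhol ↪o Fin d, ∃ g ∈ HolderBall dhol β r, ∀ x, f x = g fun i => (x (e i) : ℝ)}

/-- Compositions `h_q ∘ ⋯ ∘ h_0 : [0,1]^d → ℝ`, where the intermediate spaces are `[0,1]^K` and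
each component function of each `h_i` is in `GH` or `GM`. -/
def CHOM (K dmax dhol : ℕ) (β r : ℝ) : (q : ℕ) → (d : ℕ) → Set (Cube d → ℝ)
  | 0, d => GH d dhol β r ∪ GM d dmax
  | q + 1, d =>
      {f | ∃ h : Cube d → Cube K,
        (∀ j : Fin K, (fun x => (h x j : ℝ)) ∈ GH d dhol β r ∪ GM d dmax) ∧
        ∃ g ∈ CHOM K dmax dhol β r q K, f = g ∘ h}

/-- The Borel probability measures `P` on `[0,1]^d × {-1,1}` whose conditional probability function
`x ↦ P({1} | x)` coincides `P_X`-almost surely with a member of `CHOM`. -/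
def DataClass (q K dmax dhol : ℕ) (β r : ℝ) (d : ℕ) : Set (ProbabilityMeasure (Cube d × Label)) :=
  {P | ∃ η ∈ CHOM K dmax dhol β r q d,
    ∀ᵐ x ∂(P : Measure (Cube d × Label)).fst,
      ((P : Measure (Cube d × Label)).condKernel x {y | (y : ℝ) = 1}).toReal = η x}

/-! ### Risks and empirical risk minimisers -/

/-- The logistic loss. -/
def logisticLoss (t : ℝ) : ℝ := Real.log (1 + Real.exp (-t))

/-- The sign function with `sgn 0 = 1`. -/
def sgn (t : ℝ) : ℝ := if 0 ≤ t then 1 else -1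

/-- The logistic risk, in `[0,∞]`. -/
def logisticRisk {d : ℕ} (P : Measure (Cube d × Label)) (f : Cube d → ℝ) : ℝ≥0∞ :=
  ∫⁻ p, ENNReal.ofReal (logisticLoss ((p.2 : ℝ) * f p.1)) ∂P

/-- The excess logistic risk, in `[0,∞]` (the subtracted infimum is finite and
at most the risk of `f` for measurable `f`). -/
def excessLogisticRisk {d : ℕ} (P : Measure (Cube d × Label)) (f : Cube d → ℝ) : ℝ≥0∞ :=
  logisticRisk P f - ⨅ (g : Cube d → ℝ) (_ : Measurable g), logisticRisk P g

/-- The misclassification error. -/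
def misclassError {d : ℕ} (P : Measure (Cube d × Label)) (f : Cube d → ℝ) : ℝ≥0∞ :=
  P {p | (p.2 : ℝ) ≠ sgn (f p.1)}

/-- The excess misclassification error. -/
def excessMisclassError {d : ℕ} (P : Measure (Cube d × Label)) (f : Cube d → ℝ) : ℝ≥0∞ :=
  misclassError P f - ⨅ (g : Cube d → ℝ) (_ : Measurable g), misclassError P g

/-- The empirical logistic risk on a sample of size `n`. -/
def empRisk {d n : ℕ} (z : Fin n → Cube d × Label) (f : (Fin d → ℝ) → ℝ) : ℝ :=
  (1 / (n : ℝ)) * ∑ i, logisticLoss (((z i).2 : ℝ) * f (toVec (z i).1))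

/-- `fhat` is a statistic which, for each sample of size `n`, minimises the empirical logistic risk
over `𝓕`. Measurability is that of each evaluation `z ↦ fhat z x` with `x ∈ [0,1]^d`;
for continuous members of `𝓕` this gives joint measurability in `(z, x)`. -/
structure IsERM {d n : ℕ} (𝓕 : Set ((Fin d → ℝ) → ℝ))
    (fhat : (Fin n → Cube d × Label) → (Fin d → ℝ) → ℝ) : Prop where
  measurable : ∀ x : Cube d, Measurable fun z => fhat z (toVec x)
  mem : ∀ z, fhat z ∈ 𝓕
  minimal : ∀ z, ∀ f ∈ 𝓕, empRisk z (fhat z) ≤ empRisk z f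

/-- The expectation under `P^{⊗n}`. -/
def sampleExpectation {d : ℕ} (n : ℕ) (P : Measure (Cube d × Label))
    (θ : (Fin n → Cube d × Label) → ℝ≥0∞) : ℝ≥0∞ :=
  ∫⁻ z, θ z ∂(Measure.pi fun _ : Fin n => P)

/-- The effective smoothness `β (1 ∧ β)^q`. -/
def effSmooth (β : ℝ) (q : ℕ) : ℝ := β * min 1 β ^ q

/-- `(log n)^5 / n`. -/
def logRate (n : ℕ) : ℝ := Real.log n ^ 5 / n

end LogisticDNN

end

/-!
# Convergence rates for logistic classification with ReLU networks

Write `η` for the conditional probability of the label `1`, `s` and `b` for the input dimension of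
the Hölder components and the effective smoothness, `ρ = (log n) ^ 5 / n`, and `R = ρ ^ (-s/(s+b))`,
so that `R ρ = ρ ^ (b/(s+b))` is the claimed rate. The pointwise excess logistic risk of a
prediction `t` is the Kullback–Leibler divergence `bernKL η t` between Bernoulli laws, and its mean
`meanKL` bounds the excess logistic risk (`excessLogisticRisk_le`) and, through
the Hellinger distance, the excess misclassification error (`excessMisclassError_le`).

*Stochastic error.* The excess loss is minus a log-likelihood ratio and is at most `F + 1`, although
it may be unbounded below. A Bernstein-type inequality bounds `E exp (-l ℓ_f)` by `exp (-l meanKL f / 2)` for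
`l` of order `1 / F` (`exp_moment_le`). A union bound over a finite net of the class then gives
`E meanKL(fhat) ≲ inf meanKL + F log M / n` with `M` the size of the net (`erm_oracle`). No
margin condition is needed, and the optimal predictor `log (η / (1 - η))` may be unbounded. Rounding parameters
shows that `log M ≲ R (log n) ^ 4` (`FNN_cover`, `exists_cover_le`), so this term is of order `R ρ`.

*Approximation error.* On the grid of mesh `2 ^ (-p)`, with `2 ^ (p s)` comparable to `R`, Hölder
functions are approximated by sums of local Taylor polynomials times products of hat functions,
multiplication being obtained from the tent map approximation of the square (`local_approx`,
`holder_approx`). Maxima are computed exactly and compositions inherit the error through the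
modulus of continuity, which gives networks within `e = 2 ^ (-p b)`, up to constants, of `η`
(`chom_approx`). The logit, truncated where `η` or `1 - η` is below a level
comparable to `e`, is applied by splitting the logarithm into dyadic scales (`chom_logit_approx`).
The divergence from `η` of the resulting prediction is of order `e` and not merely its square
root, because the chi-square bound `e ^ 2 / q` is used only for `q` at least of order `e`
(`bernKL_truncLogit_le`). The truncation level also makes the predictions at most
`(b / (s + b)) log n` in absolute value: the negative term `-5 log (log n)` in `log R` absorbs
the constants (`exists_mem_FNN_meanKL_le`).
-/

open MeasureTheory Filter
open scoped ENNReal NNReal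

noncomputable section

namespace LogisticDNN

/-! ### Layered computations -/

/-- The number of nonzero entries contributed by a single parameter. -/
def nz (t : ℝ) : ℕ := by
  classical exact if t = 0 then 0 else 1

theorem nz_le_one (t : ℝ) : nz t ≤ 1 := by
  unfold nz; split_ifs <;> simp

@[simp] theorem nz_zero : nz 0 = 0 := by simp [nz]

/-- `Lay b w L t κ u`: the family `u` of real functions on `X`, indexed by `κ`, is obtained from
the family `b` by `L` successive ReLU layers, each with at least one and at most `w` units, with
all weights and biases in `[-1,1]` and at most `t` nonzero parameters altogether. Working with
families of functions on an arbitrary domain and with arbitrary finite index types makes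
compositions and parallel computations easy to describe. -/
inductive Lay {X ι : Type} (b : ι → X → ℝ) (w : ℕ) : ℕ → ℕ → (κ : Type) → (κ → X → ℝ) → Prop
  | base (s : ℕ) : Lay b w 0 s ι b
  | step {L s t : ℕ} {κ κ' : Type} [Fintype κ] [Fintype κ'] {u : κ → X → ℝ}
      (h : Lay b w L s κ u) (W : κ' → κ → ℝ) (v : κ' → ℝ)
      (hW : ∀ j i, |W j i| ≤ 1) (hv : ∀ j, |v j| ≤ 1)
      (h1 : 1 ≤ Fintype.card κ') (hw : Fintype.card κ' ≤ w)
      (ht : s + (∑ j, ∑ i, nz (W j i) + ∑ j, nz (v j)) ≤ t) :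
      Lay b w (L + 1) t κ' (fun j x => max (∑ i, W j i * u i x - v j) 0)

namespace Lay

variable {X ι : Type} {b : ι → X → ℝ}

theorem mono {w w' L s s' : ℕ} {κ : Type} {u : κ → X → ℝ} (h : Lay b w L s κ u)
    (hw : w ≤ w') (hs : s ≤ s') : Lay b w' L s' κ u := by
  induction h generalizing s' with
  | base s => exact .base _
  | step h W v hW hv h1 hw1 ht ih =>
    exact .step (ih le_rfl) W v hW hv h1 (hw1.trans hw) (ht.trans hs)

theorem dense_count {κ κ' : Type} [Fintype κ] [Fintype κ'] (W : κ' → κ → ℝ) (v : κ' → ℝ) :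
    ∑ j, ∑ i, nz (W j i) + ∑ j, nz (v j) ≤ Fintype.card κ' * (Fintype.card κ + 1) := by
  have h1 : ∑ j, ∑ i, nz (W j i) ≤ Fintype.card κ' * Fintype.card κ := by
    calc ∑ j, ∑ i, nz (W j i) ≤ ∑ _j : κ', ∑ _i : κ, 1 :=
          Finset.sum_le_sum fun j _ => Finset.sum_le_sum fun i _ => nz_le_one _
      _ = _ := by simp
  have h2 : ∑ j, nz (v j) ≤ Fintype.card κ' := by
    calc ∑ j, nz (v j) ≤ ∑ _j : κ', 1 := Finset.sum_le_sum fun j _ => nz_le_one _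
      _ = _ := by simp
  nlinarith

/-- One further layer, with every entry counted as if it were nonzero. -/
theorem step_dense {w L s : ℕ} {κ κ' : Type} [Fintype κ] [Fintype κ'] {u : κ → X → ℝ}
    (h : Lay b w L s κ u) (W : κ' → κ → ℝ) (v : κ' → ℝ) (u' : κ' → X → ℝ)
    (hW : ∀ j i, |W j i| ≤ 1) (hv : ∀ j, |v j| ≤ 1)
    (h1 : 1 ≤ Fintype.card κ') (hw : Fintype.card κ' ≤ w)
    (hu : ∀ j x, u' j x = max (∑ i, W j i * u i x - v j) 0) :
    Lay b w (L + 1) (s + Fintype.card κ' * (Fintype.card κ + 1)) κ' u' := by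
  have : u' = fun j x => max (∑ i, W j i * u i x - v j) 0 := by
    funext j x; exact hu j x
  rw [this]
  exact .step h W v hW hv h1 hw (Nat.add_le_add_left (dense_count W v) _)

theorem succ_inv {w L t : ℕ} {κ' : Type} {u' : κ' → X → ℝ} (h : Lay b w (L + 1) t κ' u') :
    ∃ (s : ℕ) (κ : Type) (_ : Fintype κ) (_ : Fintype κ') (u : κ → X → ℝ) (W : κ' → κ → ℝ)
      (v : κ' → ℝ), Lay b w L s κ u ∧ (∀ j i, |W j i| ≤ 1) ∧ (∀ j, |v j| ≤ 1) ∧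
      1 ≤ Fintype.card κ' ∧ Fintype.card κ' ≤ w ∧
      s + (∑ j, ∑ i, nz (W j i) + ∑ j, nz (v j)) ≤ t ∧
      u' = fun j x => max (∑ i, W j i * u i x - v j) 0 := by
  cases h with
  | step h W v hW hv h1 hw ht => exact ⟨_, _, _, _, _, W, v, h, hW, hv, h1, hw, ht, rfl⟩

theorem zero_inv {w t : ℕ} {κ : Type} {u : κ → X → ℝ} (h : Lay b w 0 t κ u) :
    ∃ e : κ = ι, u = fun j => b (cast e j) := by
  cases h with
  | base => exact ⟨rfl, rfl⟩

theorem nonneg {w L t : ℕ} {κ : Type} {u : κ → X → ℝ} (h : Lay b w L t κ u) (hL : 1 ≤ L)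
    (j : κ) (x : X) : 0 ≤ u j x := by
  cases h with
  | base => omega
  | step => exact le_max_right _ _

theorem comp {w L L' s s' : ℕ} {κ κ' : Type} {u : κ → X → ℝ} {v : κ' → X → ℝ}
    (h : Lay b w L s κ u) (h' : Lay u w L' s' κ' v) : Lay b w (L + L') (s + s') κ' v := by
  induction h' with
  | base s => exact h.mono le_rfl (Nat.le_add_right _ _)
  | step h W v hW hv h1 hw1 ht ih =>
    exact .step ih W v hW hv h1 hw1 (by omega)

theorem precomp {Y : Type} (φ : Y → X) {w L s : ℕ} {κ : Type} {u : κ → X → ℝ}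
    (h : Lay b w L s κ u) : Lay (fun i y => b i (φ y)) w L s κ (fun j y => u j (φ y)) := by
  induction h with
  | base s => exact .base s
  | step h W v hW hv h1 hw1 ht ih => exact .step ih W v hW hv h1 hw1 ht

/-- A computation whose base family and layers all have at most `w` members has at most
`w * (w + 1)` nonzero parameters per layer. -/
theorem dense [Fintype ι] {w L s : ℕ} {κ : Type} {u : κ → X → ℝ} (hι : Fintype.card ι ≤ w)
    (h : Lay b w L s κ u) : Lay b w L (L * (w * (w + 1))) κ u := by
  suffices H : Lay b w L (L * (w * (w + 1))) κ u ∧ ∀ _ : Fintype κ, Fintype.card κ ≤ w from H.1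
  induction h with
  | base s => exact ⟨.base _, fun _ => by convert hι⟩
  | @step L s t κ κ' i1 i2 u h W v hW hv h1 hw1 ht ih =>
    refine ⟨.step ih.1 W v hW hv h1 hw1 ?_, fun _ => by convert hw1⟩
    have := dense_count W v
    have h3 : Fintype.card κ' * (Fintype.card κ + 1) ≤ w * (w + 1) :=
      Nat.mul_le_mul hw1 (Nat.add_le_add_right (ih.2 _) _)
    nlinarith

/-- Parallel computation of finitely many families of the same depth. The first layer stacks the
weight matrices, since all the computations read the same base family; the later ones are block
diagonal. -/
theorem parallel {A : Type} [Fintype A] [Nonempty A] {w L : ℕ} {s : A → ℕ} {κ : A → Type}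
    {u : ∀ a, κ a → X → ℝ} (h : ∀ a, Lay b w (L + 1) (s a) (κ a) (u a)) :
    Lay b (Fintype.card A * w) (L + 1) (∑ a, s a) (Σ a, κ a) (fun p x => u p.1 p.2 x) := by
  classical
  have key : ∀ {κ' : A → Type} [∀ a, Fintype (κ' a)] , (∀ a, 1 ≤ Fintype.card (κ' a)) →
      (∀ a, Fintype.card (κ' a) ≤ w) → 1 ≤ Fintype.card (Σ a, κ' a) ∧
        Fintype.card (Σ a, κ' a) ≤ Fintype.card A * w := by
    intro κ' _ h1 h2
    rw [Fintype.card_sigma]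
    constructor
    · obtain ⟨a⟩ := ‹Nonempty A›
      exact (h1 a).trans (Finset.single_le_sum (f := fun a => Fintype.card (κ' a))
        (fun _ _ => Nat.zero_le _) (Finset.mem_univ a))
    · calc ∑ a, Fintype.card (κ' a) ≤ ∑ _a : A, w := Finset.sum_le_sum fun a _ => h2 a
        _ = _ := by simp
  induction L generalizing s κ u with
  | zero =>
    choose s0 κ0 i0 i1 u0 W v h0 hW hv h1 hw ht hu using fun a => (h a).succ_inv
    -- all blocks read the base family itself
    have hb : ∀ a, ∃ e : κ0 a = ι, u0 a = fun j => b (cast e j) := by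
      intro a
      exact (h0 a).zero_inv
    obtain ⟨a0⟩ := ‹Nonempty A›
    choose e he using hb
    have : ∃ fι : Fintype ι, True := ⟨(e a0) ▸ i0 a0, trivial⟩
    obtain ⟨fι, -⟩ := this
    have hre : ∀ a (g : κ0 a → ℝ), ∑ i, g i = ∑ i : ι, g (cast (e a).symm i) := by
      intro a g
      exact (Equiv.sum_comp (Equiv.cast (e a).symm) g).symm
    have hren : ∀ a (g : κ0 a → ℕ), ∑ i, g i = ∑ i : ι, g (cast (e a).symm i) := by
      intro a g
      exact (Equiv.sum_comp (Equiv.cast (e a).symm) g).symm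
    have hf : (fun (p : Σ a, κ a) x => u p.1 p.2 x) =
        fun p x => max (∑ i : ι, W p.1 p.2 (cast (e p.1).symm i) * b i x - v p.1 p.2) 0 := by
      funext p x
      rw [hu p.1]
      simp only [hre, he, cast_cast, cast_eq]
    rw [hf]
    refine .step (s := 0) (.base 0) (fun (p : Σ a, κ a) i => W p.1 p.2 (cast (e p.1).symm i))
      (fun p => v p.1 p.2) (fun p i => hW _ _ _) (fun p => hv _ _) (key h1 hw).1 (key h1 hw).2 ?_
    rw [Fintype.sum_sigma, Fintype.sum_sigma, ← Finset.sum_add_distrib, zero_add]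
    refine Finset.sum_le_sum fun a _ => le_trans ?_ (ht a)
    simp only [hren]
    omega
  | succ L ih =>
    choose s0 κ0 i0 i1 u0 W v h0 hW hv h1 hw ht hu using fun a => (h a).succ_inv
    have IH := ih h0
    let W' : (Σ a, κ a) → (Σ a, κ0 a) → ℝ := fun p r =>
      if hh : r.1 = p.1 then W p.1 p.2 (cast (by rw [hh]) r.2) else 0
    have hd : ∀ a (j : κ a) (i : κ0 a), W' ⟨a, j⟩ ⟨a, i⟩ = W a j i := by
      intro a j i; simp [W']
    have ho : ∀ a (j : κ a) a' (i : κ0 a'), a' ≠ a → W' ⟨a, j⟩ ⟨a', i⟩ = 0 := by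
      intro a j a' i hne; simp [W', hne]
    have hf : (fun (p : Σ a, κ a) x => u p.1 p.2 x) =
        fun p x => max (∑ r : (Σ a, κ0 a), W' p r * u0 r.1 r.2 x - v p.1 p.2) 0 := by
      funext ⟨a, j⟩ x
      rw [hu a, Fintype.sum_sigma, Finset.sum_eq_single a]
      · simp only [hd]
      · intro a' _ hne
        exact Finset.sum_eq_zero fun i _ => by rw [ho a j a' i hne, zero_mul]
      · simp
    rw [hf]
    refine .step IH W' (fun p => v p.1 p.2) ?_ (fun p => hv _ _) (key h1 hw).1 (key h1 hw).2 ?_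
    · rintro ⟨a, j⟩ ⟨a', i⟩
      by_cases hh : a' = a
      · subst hh; rw [hd]; exact hW _ _ _
      · rw [ho a j a' i hh]; simp
    · rw [Fintype.sum_sigma, Fintype.sum_sigma, ← Finset.sum_add_distrib,
        ← Finset.sum_add_distrib]
      refine Finset.sum_le_sum fun a _ => le_trans ?_ (ht a)
      have : ∀ j : κ a, ∑ r : (Σ a, κ0 a), nz (W' ⟨a, j⟩ r) = ∑ i, nz (W a j i) := by
        intro j
        rw [Fintype.sum_sigma, Finset.sum_eq_single a]
        · simp only [hd]
        · intro a' _ hne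
          exact Finset.sum_eq_zero fun i _ => by rw [ho a j a' i hne, nz_zero]
        · simp
      simp only [this, le_refl]

end Lay

theorem ncard_eq_sum_nz {κ κ' : Type} [Fintype κ] [Fintype κ'] (W : κ' → κ → ℝ) :
    Set.ncard {p : κ' × κ | W p.1 p.2 ≠ 0} = ∑ j, ∑ i, nz (W j i) := by
  classical
  rw [Set.ncard_eq_toFinset_card', ← Fintype.sum_prod_type' (f := fun j i => nz (W j i)),
    Finset.card_eq_sum_ones, Set.toFinset_ofPred, Finset.sum_filter]
  refine Finset.sum_congr rfl fun p _ => ?_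
  by_cases h : W p.1 p.2 = 0 <;> simp [nz, h]

theorem ncard_eq_sum_nz' {κ : Type} [Fintype κ] (v : κ → ℝ) :
    Set.ncard {i : κ | v i ≠ 0} = ∑ i, nz (v i) := by
  classical
  rw [Set.ncard_eq_toFinset_card', Finset.card_eq_sum_ones, Set.toFinset_ofPred, Finset.sum_filter]
  refine Finset.sum_congr rfl fun p _ => ?_
  by_cases h : v p = 0 <;> simp [nz, h]

/-- A layered computation over the coordinate functions can be prefixed to any network which takes
its outputs as inputs. -/
theorem Lay.prefix_net {X : Type} {d w L s : ℕ} {b : Fin d → X → ℝ} {κ : Type} {u : κ → X → ℝ}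
    (h : Lay b w L s κ u) : ∃ (k : ℕ) (e : κ ≃ Fin k), ∀ T' : Net k, T'.WidthLE w →
      T'.ParamsLE 1 → ∃ T : Net d, (∀ x, T.eval (fun i => b i x) =
        T'.eval (fun i => u (e.symm i) x)) ∧ T.depth = L + T'.depth ∧ T.WidthLE w ∧
        T.nonzeros ≤ s + T'.nonzeros ∧ T.ParamsLE 1 := by
  induction h with
  | base s =>
    exact ⟨d, Equiv.refl _, fun T' hw hp => ⟨T', fun x => rfl, by simp, hw, by omega, hp⟩⟩
  | @step L s t κ κ' _ _ u h W v hW hv h1 hw ht ih =>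
    obtain ⟨k, e, ih⟩ := ih
    refine ⟨Fintype.card κ', Fintype.equivFin κ', fun T' hw' hp' => ?_⟩
    set e' := Fintype.equivFin κ'
    obtain ⟨T, hT, hd, hwT, hn, hp⟩ := ih
      (.hidden (fun j i => W (e'.symm j) (e.symm i)) (fun j => v (e'.symm j)) T')
      ⟨h1, by exact_mod_cast hw, hw'⟩ ⟨fun _ _ => hW _ _, fun _ => hv _, hp'⟩
    refine ⟨T, fun x => ?_, ?_, hwT, hn.trans ?_, hp⟩
    · rw [hT]
      simp only [Net.eval, Matrix.mulVec, dotProduct]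
      congr 1
      funext j
      rw [← Equiv.sum_comp e.symm]
    · rw [hd]; simp only [Net.depth]; omega
    · simp only [Net.nonzeros]
      rw [ncard_eq_sum_nz (fun j i => W (e'.symm j) (e.symm i)), ncard_eq_sum_nz']
      rw [Equiv.sum_comp e'.symm (fun j => ∑ i, nz (W j (e.symm i))),
        Equiv.sum_comp e'.symm (fun j => nz (v j))]
      have : ∀ j, ∑ i, nz (W j (e.symm i)) = ∑ i, nz (W j i) := fun j =>
        Equiv.sum_comp e.symm (fun i => nz (W j i))
      simp only [this]
      omega

/-- Reading off a linear combination of the outputs of a layered computation gives a network. -/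
theorem Lay.toNet {X : Type} {d w L s : ℕ} {b : Fin d → X → ℝ} {κ : Type} [Fintype κ]
    {u : κ → X → ℝ} (h : Lay b w L s κ u) (c : κ → ℝ) (hc : ∀ i, |c i| ≤ 1) :
    ∃ T : Net d, (∀ x, T.eval (fun i => b i x) = ∑ i, c i * u i x) ∧ T.depth = L ∧
      T.WidthLE w ∧ T.nonzeros ≤ s + Fintype.card κ ∧ T.ParamsLE 1 := by
  obtain ⟨k, e, H⟩ := h.prefix_net
  obtain ⟨T, hT, hd, hw, hn, hp⟩ := H (.out fun _ i => c (e.symm i)) trivial (fun _ _ => hc _)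
  refine ⟨T, fun x => ?_, hd, hw, hn.trans ?_, hp⟩
  · rw [hT]
    simp only [Net.eval, Matrix.mulVec, dotProduct]
    rw [← Equiv.sum_comp e.symm]
  · simp only [Net.nonzeros]
    rw [ncard_eq_sum_nz (fun (_ : Fin 1) i => c (e.symm i))]
    have : ∑ _j : Fin 1, ∑ i, nz (c (e.symm i)) ≤ Fintype.card κ := by
      rw [Fintype.sum_unique, Equiv.sum_comp e.symm (fun i => nz (c i))]
      calc ∑ i, nz (c i) ≤ ∑ _i : κ, 1 := Finset.sum_le_sum fun i _ => nz_le_one _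
        _ = _ := by simp
    omega

/-! ### Elementary network constructions -/

/-- The function `f` is the single output of a layered computation of depth `L` and width `w`
over `b`; the number of parameters is left open, see `Lay.dense`. -/
def Cmp {X ι : Type} (b : ι → X → ℝ) (w L : ℕ) (f : X → ℝ) : Prop :=
  ∃ s, Lay b w L s Unit (fun _ => f)

section Combine

variable {X ι : Type} {b : ι → X → ℝ}

theorem Lay.width_pos {w L t : ℕ} {κ : Type} {u : κ → X → ℝ} (h : Lay b w (L + 1) t κ u) :
    1 ≤ w := by
  cases h with
  | step h W v hW hv h1 hw1 ht => exact h1.trans hw1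

/-- Identity layers preserve a nonnegative output. -/
theorem Lay.pad {w L s : ℕ} {f : X → ℝ} (h : Lay b w (L + 1) s Unit (fun _ => f)) (m : ℕ) :
    Lay b w (L + 1 + m) (s + 2 * m) Unit (fun _ => f) := by
  induction m with
  | zero => exact h
  | succ m ih =>
    have := ih.step_dense (κ' := Unit) (fun _ _ => 1) (fun _ => 0) (fun _ => f) (by simp) (by simp)
      (by simp) (by simpa using h.width_pos) (by
        intro _ x
        have := h.nonneg (by omega) () x
        simp [this])
    exact this.mono le_rfl (by simp; omega)

theorem Lay.comb {A : Type} [Fintype A] [Nonempty A] {w L s : ℕ} {f : A → X → ℝ}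
    (h : ∀ a, Lay b w (L + 1) s Unit (fun _ => f a)) (c : A → ℝ) (v : ℝ) (hc : ∀ a, |c a| ≤ 1)
    (hv : |v| ≤ 1) :
    Lay b (Fintype.card A * w) (L + 2) (Fintype.card A * (s + 1) + 1) Unit
      (fun _ x => max (∑ a, c a * f a x - v) 0) := by
  have hw : 1 ≤ w := (h (Classical.arbitrary A)).width_pos
  have := (Lay.parallel (κ := fun _ => Unit) h).step_dense (κ' := Unit) (fun _ p => c p.1)
    (fun _ => v) (fun _ x => max (∑ a, c a * f a x - v) 0) (by simp [hc]) (by simp [hv]) (by simp)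
    (by rw [Fintype.card_unit]; exact Nat.mul_pos Fintype.card_pos hw) (by
      intro _ x
      rw [Fintype.sum_sigma]; simp)
  refine this.mono le_rfl ?_
  simp
  nlinarith

namespace Cmp

theorem mono {w w' L : ℕ} {f : X → ℝ} (h : Cmp b w L f) (hw : w ≤ w') : Cmp b w' L f := by
  obtain ⟨s, h⟩ := h
  exact ⟨s, h.mono hw le_rfl⟩

theorem width_pos {w L : ℕ} {f : X → ℝ} (h : Cmp b w (L + 1) f) : 1 ≤ w := by
  obtain ⟨s, h⟩ := h
  exact h.width_pos

theorem pad {w L : ℕ} {f : X → ℝ} (h : Cmp b w (L + 1) f) (m : ℕ) : Cmp b w (L + 1 + m) f := by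
  obtain ⟨s, h⟩ := h
  exact ⟨_, h.pad m⟩

theorem pad_to {w L L' : ℕ} {f : X → ℝ} (h : Cmp b w (L + 1) f) (hL : L + 1 ≤ L') :
    Cmp b w L' f := by
  have := h.pad (L' - (L + 1))
  rwa [Nat.add_sub_cancel' hL] at this

theorem add2 {w L : ℕ} {f g : X → ℝ} (hf : Cmp b w (L + 1) f) (hg : Cmp b w (L + 1) g)
    (c d v : ℝ) (hc : |c| ≤ 1) (hd : |d| ≤ 1) (hv : |v| ≤ 1) :
    Cmp b (2 * w) (L + 2) (fun x => max (c * f x + d * g x - v) 0) := by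
  obtain ⟨s, hf⟩ := hf
  obtain ⟨t, hg⟩ := hg
  have := Lay.comb (A := Bool) (f := fun a => if a then f else g) (s := max s t)
    (b := b) (w := w) (L := L) (by
      rintro (_ | _)
      · simpa using hg.mono le_rfl (le_max_right _ _)
      · simpa using hf.mono le_rfl (le_max_left _ _)) (fun a => if a then c else d) v
      (by rintro (_ | _) <;> simp [hc, hd]) hv
  refine ⟨Fintype.card Bool * (max s t + 1) + 1, ?_⟩
  convert this using 3 with _ x <;> simp

/-- One ReLU unit reading the base family. -/
theorem unit [Fintype ι] (W : ι → ℝ) (v : ℝ) (hW : ∀ i, |W i| ≤ 1) (hv : |v| ≤ 1) :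
    Cmp b 1 1 (fun x => max (∑ i, W i * b i x - v) 0) :=
  ⟨_, (Lay.base (b := b) (w := 1) 0).step_dense (κ' := Unit) (fun _ => W) (fun _ => v)
    (fun _ x => max (∑ i, W i * b i x - v) 0) (fun _ => hW) (fun _ => hv) (by simp) (by simp)
    (fun _ _ => rfl)⟩

end Cmp

end Combine

/-! ### Squares and products -/

mutual

/-- The `n`-th iterate of the tent map at `t`, divided by `4 ^ n`. -/
def sqP : ℕ → ℝ → ℝ
  | 0, t => t
  | n + 1, t => max (1 / 2 * sqP n t - sqR n t) 0

/-- The auxiliary unit which folds the tent map at its peak. -/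
def sqR : ℕ → ℝ → ℝ
  | 0, t => max (t - 1 / 2) 0
  | n + 1, t => max (1 / 2 * sqP n t - sqR n t - (1 / 4) ^ (n + 1) / 2) 0

end

/-- The piecewise linear interpolation of `t ↦ t ^ 2` on `[0,1]` at the multiples of `2 ^ (-n)`,
as computed by the recursion `t ^ 2 = t - ∑ j, g_j(t) / 4 ^ j` with the iterated tent maps
`g_j`. The scaling by `4 ^ (-j)` keeps all weights in `[-1,1]`. -/
def sqAcc : ℕ → ℝ → ℝ
  | 0, t => t
  | n + 1, t => max (sqAcc n t - 1 / 2 * sqP n t + sqR n t) 0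

theorem sq_invariant (n : ℕ) {t : ℝ} (h0 : 0 ≤ t) (h1 : t ≤ 1) :
    ∃ y : ℝ, 0 ≤ y ∧ y ≤ 1 ∧ sqP n t = y * (1 / 4) ^ n ∧
      sqR n t = max (y - 1 / 2) 0 * (1 / 4) ^ n ∧
      sqAcc n t - t ^ 2 = (y - y ^ 2) * (1 / 4) ^ n ∧ sqAcc n t ≤ t := by
  induction n with
  | zero => exact ⟨t, h0, h1, by simp [sqP], by simp [sqR], by simp [sqAcc], by simp [sqAcc]⟩
  | succ n ih =>
    obtain ⟨y, hy0, hy1, hP, hR, hA, hAt⟩ := ih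
    have hq : (0 : ℝ) < (1 / 4) ^ n := by positivity
    have hz0 : 0 ≤ 2 * y - 4 * max (y - 1 / 2) 0 := by
      rcases max_cases (y - 1 / 2) 0 with ⟨h, _⟩ | ⟨h, _⟩ <;> rw [h] <;> linarith
    have hz1 : 2 * y - 4 * max (y - 1 / 2) 0 ≤ 1 := by
      rcases max_cases (y - 1 / 2) 0 with ⟨h, _⟩ | ⟨h, _⟩ <;> rw [h] <;> linarith
    set z := 2 * y - 4 * max (y - 1 / 2) 0 with hz
    have hi : 1 / 2 * sqP n t - sqR n t = z * (1 / 4) ^ (n + 1) := by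
      rw [hP, hR, hz, pow_succ]; ring
    have hzz : y - y ^ 2 - z / 4 = (z - z ^ 2) / 4 := by
      rcases max_cases (y - 1 / 2) 0 with ⟨h, _⟩ | ⟨h, _⟩ <;> rw [hz, h] <;> ring
    have hAi : sqAcc n t - 1 / 2 * sqP n t + sqR n t = t ^ 2 + (z - z ^ 2) * (1 / 4) ^ (n + 1) := by
      have : sqAcc n t - 1 / 2 * sqP n t + sqR n t =
        t ^ 2 + (sqAcc n t - t ^ 2) - (1 / 2 * sqP n t - sqR n t) := by ring
      rw [this, hi, hA, pow_succ]
      linear_combination (1 / 4) ^ n * hzz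
    have hzn : 0 ≤ (z - z ^ 2) * (1 / 4) ^ (n + 1) := by
      have : 0 ≤ z - z ^ 2 := by nlinarith
      positivity
    refine ⟨z, hz0, hz1, ?_, ?_, ?_, ?_⟩
    · rw [sqP, hi, max_eq_left (by positivity)]
    · have hq' : (0 : ℝ) ≤ (1 / 4) ^ (n + 1) := by positivity
      rw [sqR, hi, max_mul_of_nonneg _ _ hq', zero_mul]
      congr 1; ring
    · rw [sqAcc, hAi, max_eq_left (by nlinarith)]; ring
    · rw [sqAcc]
      refine max_le ?_ h0
      have : 0 ≤ z * (1 / 4) ^ (n + 1) := by positivity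
      linarith

theorem sqAcc_bounds (n : ℕ) {t : ℝ} (h0 : 0 ≤ t) (h1 : t ≤ 1) :
    t ^ 2 ≤ sqAcc n t ∧ sqAcc n t ≤ t ^ 2 + (1 / 4) ^ n ∧ sqAcc n t ≤ t := by
  obtain ⟨y, hy0, hy1, -, -, hA, hAt⟩ := sq_invariant n h0 h1
  have hq : (0 : ℝ) < (1 / 4) ^ n := by positivity
  have h2 : 0 ≤ (y - y ^ 2) * (1 / 4) ^ n := mul_nonneg (by nlinarith) hq.le
  have h3 : (y - y ^ 2) * (1 / 4) ^ n ≤ 1 * (1 / 4) ^ n :=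
    mul_le_mul_of_nonneg_right (by nlinarith) hq.le
  exact ⟨by linarith, by linarith, hAt⟩

section Products

variable {X ι : Type} {b : ι → X → ℝ}

theorem Cmp.sq {w L : ℕ} {f : X → ℝ} (h : Cmp b w (L + 1) f) (n : ℕ) :
    Cmp b (max w 3) (L + 1 + (n + 2)) (fun x => sqAcc n (f x)) := by
  obtain ⟨s, h⟩ := h
  have h0 : ∀ x, 0 ≤ f x := fun x => h.nonneg (by omega) () x
  have key : ∀ n : ℕ, ∃ s', Lay b (max w 3) (L + 2 + n) s' (Fin 3)
      (fun i x => ![sqP n (f x), sqR n (f x), sqAcc n (f x)] i) := by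
    intro n
    induction n with
    | zero =>
      refine ⟨_, (h.mono (le_max_left w 3) le_rfl).step_dense (κ' := Fin 3) (fun _ _ => 1)
        ![0, 1 / 2, 0] _ (by simp) ?_ (by simp) (by simp) ?_⟩
      · intro j; fin_cases j <;> norm_num [abs_le]
      · intro j x
        fin_cases j <;> simp [sqP, sqR, sqAcc, h0 x]
    | succ n ih =>
      obtain ⟨s', ih⟩ := ih
      refine ⟨_, ih.step_dense (κ' := Fin 3) ![![1 / 2, -1, 0], ![1 / 2, -1, 0], ![-(1 / 2), 1, 1]]
        ![0, (1 / 4) ^ (n + 1) / 2, 0] _ ?_ ?_ (by simp) (by simp) ?_⟩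
      · intro j i; fin_cases j <;> fin_cases i <;> norm_num [abs_le]
      · have h4 : ((1 : ℝ) / 4) ^ (n + 1) ≤ 1 := pow_le_one₀ (by norm_num) (by norm_num)
        have h5 : (0 : ℝ) ≤ (1 / 4) ^ (n + 1) := by positivity
        intro j; fin_cases j
        · simp
        · change |((1 : ℝ) / 4) ^ (n + 1) / 2| ≤ 1
          rw [abs_le]; constructor <;> linarith
        · simp
      · intro j x
        fin_cases j <;> simp [sqP, sqR, sqAcc, Fin.sum_univ_three] <;> ring_nf
  obtain ⟨s', key⟩ := key n
  have e : L + 1 + (n + 2) = L + 2 + n + 1 := by ring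
  rw [e]
  refine ⟨_, key.step_dense (κ' := Unit) (fun _ => ![0, 0, 1]) (fun _ => 0)
    (fun _ x => sqAcc n (f x)) ?_ (by simp) (by simp) (by simp) ?_⟩
  · intro _ i; fin_cases i <;> simp
  · intro _ x
    have : 0 ≤ sqAcc n (f x) := by
      cases n with
      | zero => exact h0 x
      | succ n => exact le_max_right _ _
    simp [Fin.sum_univ_three, this]

/-- Approximate multiplication of numbers in `[0,1]` by polarisation,
`s t = ((s + t) / 2) ^ 2 - (|s - t| / 2) ^ 2`. -/
def mulA (n : ℕ) (s t : ℝ) : ℝ := max (sqAcc n ((s + t) / 2) - sqAcc n (|s - t| / 2)) 0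

theorem mulA_bounds (n : ℕ) {s t : ℝ} (hs0 : 0 ≤ s) (hs1 : s ≤ 1) (ht0 : 0 ≤ t) (ht1 : t ≤ 1) :
    0 ≤ mulA n s t ∧ mulA n s t ≤ 1 ∧ |mulA n s t - s * t| ≤ (1 / 4) ^ n := by
  have ha : |s - t| ≤ 1 := by rw [abs_le]; constructor <;> linarith
  obtain ⟨a1, a2, a3⟩ := sqAcc_bounds n (t := (s + t) / 2) (by linarith) (by linarith)
  obtain ⟨b1, b2, b3⟩ := sqAcc_bounds n (t := |s - t| / 2) (by positivity) (by linarith)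
  have hb : (|s - t| / 2) ^ 2 = (s - t) ^ 2 / 4 := by rw [div_pow, sq_abs]; norm_num
  rw [hb] at b1 b2
  have hst : 0 ≤ s * t := mul_nonneg hs0 ht0
  have hq : (0 : ℝ) < (1 / 4) ^ n := by positivity
  have h4 : 0 ≤ (s - t) ^ 2 := sq_nonneg _
  refine ⟨le_max_right _ _, max_le (by linarith) (by norm_num), ?_⟩
  unfold mulA
  rcases max_cases (sqAcc n ((s + t) / 2) - sqAcc n (|s - t| / 2)) 0 with ⟨h, h'⟩ | ⟨h, h'⟩ <;>
    rw [h, abs_le] <;> constructor <;> nlinarith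

theorem Cmp.mul {w L : ℕ} {f g : X → ℝ} (hf : Cmp b w (L + 1) f) (hg : Cmp b w (L + 1) g)
    (n : ℕ) : Cmp b (8 * w) (L + 1 + (n + 5)) (fun x => mulA n (f x) (g x)) := by
  have hw := hf.width_pos
  obtain ⟨_, hf'⟩ := id hf
  obtain ⟨_, hg'⟩ := id hg
  have hf0 : ∀ x, 0 ≤ f x := fun x => hf'.nonneg (by omega) () x
  have hg0 : ∀ x, 0 ≤ g x := fun x => hg'.nonneg (by omega) () x
  have a1 : |(1 : ℝ) / 2| ≤ 1 := by norm_num [abs_le]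
  have hs : Cmp b (2 * w) (L + 2) (fun x => (f x + g x) / 2) := by
    convert hf.add2 hg (1 / 2) (1 / 2) 0 a1 a1 (by simp) using 2 with x
    rw [max_eq_left (by linarith [hf0 x, hg0 x])]; ring
  have hd : Cmp b (2 * (2 * w)) (L + 3) (fun x => |f x - g x| / 2) := by
    convert (hf.add2 hg 1 (-1) 0 (by simp) (by simp) (by simp)).add2
      (hf.add2 hg (-1) 1 0 (by simp) (by simp) (by simp)) (1 / 2) (1 / 2) 0 a1 a1 (by simp)
      using 2 with x
    rcases le_total (f x) (g x) with h | h
    · rw [abs_of_nonpos (by linarith), max_eq_right (a := 1 * f x + -1 * g x - 0) (by linarith),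
        max_eq_left (a := -1 * f x + 1 * g x - 0) (by linarith), max_eq_left (by linarith)]
      ring
    · rw [abs_of_nonneg (by linarith), max_eq_left (a := 1 * f x + -1 * g x - 0) (by linarith),
        max_eq_right (a := -1 * f x + 1 * g x - 0) (by linarith), max_eq_left (by linarith)]
      ring
  have h1 := ((hs.pad 1).mono (show 2 * w ≤ 4 * w by omega)).sq n
  have h2 := (hd.mono (show 2 * (2 * w) ≤ 4 * w by omega)).sq n
  rw [max_eq_left (by omega)] at h1 h2
  have e : (fun x => mulA n (f x) (g x)) = fun x =>
      max (1 * sqAcc n ((f x + g x) / 2) + -1 * sqAcc n (|f x - g x| / 2) - 0) 0 := by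
    funext x
    rw [mulA, one_mul, neg_one_mul, sub_zero, sub_eq_add_neg]
  rw [e, show L + 1 + (n + 5) = (L + 2 + 1 + (n + 1)) + 2 by ring]
  exact (h1.add2 h2 1 (-1) 0 (by simp) (by simp) (by simp)).mono
    (show 2 * (4 * w) ≤ 8 * w by omega)

/-- Approximate product of finitely many functions with values in `[0,1]`. -/
theorem Cmp.prod [Fintype ι] {κ : Type} {w L : ℕ} (hw : 1 ≤ w) {f : κ → X → ℝ}
    (hf : ∀ i, Cmp b w (L + 1) (f i)) (h0 : ∀ i x, 0 ≤ f i x) (h1 : ∀ i x, f i x ≤ 1) (n : ℕ)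
    (t : Finset κ) :
    ∃ u : X → ℝ, Cmp b (8 ^ t.card * w) (L + 1 + t.card * (n + 5)) u ∧ ∀ x, 0 ≤ u x ∧ u x ≤ 1 ∧
      |u x - ∏ i ∈ t, f i x| ≤ t.card * (1 / 4) ^ n := by
  classical
  induction t using Finset.induction_on with
  | empty =>
    refine ⟨fun _ => 1, ?_, by simp⟩
    have := (Cmp.unit (b := b) (fun _ => 0) (-1) (by simp) (by simp)).pad_to (L' := L + 1) (by omega)
    simpa using this.mono hw
  | insert a t hat ih =>
    obtain ⟨u, hu, hux⟩ := ih
    rw [Finset.card_insert_of_notMem hat]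
    refine ⟨fun x => mulA n (u x) (f a x), ?_, fun x => ?_⟩
    · have hk : 1 ≤ 8 ^ t.card := Nat.one_le_pow _ _ (by norm_num)
      have h2 := ((hf a).pad_to (L' := L + 1 + t.card * (n + 5)) (by omega)).mono
        (show w ≤ 8 ^ t.card * w by nlinarith)
      have e : L + 1 + t.card * (n + 5) = (L + t.card * (n + 5)) + 1 := by ring
      rw [e] at hu h2
      convert hu.mul h2 n using 1
      · rw [pow_succ]; ring
      · ring
    · obtain ⟨hu0, hu1, he⟩ := hux x
      obtain ⟨m0, m1, m2⟩ := mulA_bounds n hu0 hu1 (h0 a x) (h1 a x)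
      refine ⟨m0, m1, ?_⟩
      rw [Finset.prod_insert hat]
      have e1 : mulA n (u x) (f a x) - f a x * ∏ i ∈ t, f i x =
        (mulA n (u x) (f a x) - u x * f a x) + (u x - ∏ i ∈ t, f i x) * f a x := by ring
      rw [e1]
      refine (abs_add_le _ _).trans ?_
      rw [abs_mul, abs_of_nonneg (h0 a x)]
      have : |u x - ∏ i ∈ t, f i x| * f a x ≤ |u x - ∏ i ∈ t, f i x| * 1 :=
        mul_le_mul_of_nonneg_left (h1 a x) (abs_nonneg _)
      push_cast
      linarith

/-! ### Scaling and clipping -/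

/-- The projection of `ℝ` onto `[0,1]`. -/
def clip01 (t : ℝ) : ℝ := max (min t 1) 0

theorem clip01_nonneg (t : ℝ) : 0 ≤ clip01 t := le_max_right _ _

theorem clip01_le_one (t : ℝ) : clip01 t ≤ 1 := max_le (min_le_right _ _) zero_le_one

theorem clip01_of_mem {t : ℝ} (h0 : 0 ≤ t) (h1 : t ≤ 1) : clip01 t = t := by
  simp [clip01, h0, h1]

theorem abs_clip01_sub_le (s t : ℝ) : |clip01 s - clip01 t| ≤ |s - t| :=
  (abs_max_sub_max_le_abs _ _ _).trans
    ((abs_min_sub_min_le_max s 1 t 1).trans (by simp))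

theorem clip01_max_zero (t : ℝ) : clip01 (max t 0) = clip01 t := by
  unfold clip01
  rcases le_total t 0 with h | h
  · rw [max_eq_right h, min_eq_left (by linarith), min_eq_left (h.trans zero_le_one), max_self,
      max_eq_right h]
  · rw [max_eq_left h]

theorem Lay.scale {f : X → ℝ} (hf : ∀ x, 0 ≤ f x) (p : ℕ) :
    ∃ s, Lay (fun _ : Unit => f) 2 (p + 2) s Unit (fun _ x => 2 ^ p * f x) := by
  have key : ∀ p : ℕ, ∃ s, Lay (fun _ : Unit => f) 2 (p + 1) s Bool (fun _ x => 2 ^ p * f x) := by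
    intro p
    induction p with
    | zero =>
      refine ⟨_, (Lay.base 0).step_dense (κ' := Bool) (fun _ _ => 1) (fun _ => 0) _ (by simp)
        (by simp) (by simp) (by simp) ?_⟩
      intro j x; simp [hf x]
    | succ p ih =>
      obtain ⟨s, ih⟩ := ih
      refine ⟨_, ih.step_dense (κ' := Bool) (fun _ _ => 1) (fun _ => 0) _ (by simp)
        (by simp) (by simp) (by simp) ?_⟩
      intro j x
      have : 0 ≤ 2 ^ p * f x := mul_nonneg (by positivity) (hf x)
      simp only [Fintype.sum_bool, one_mul, sub_zero]
      rw [max_eq_left (by linarith)]; ring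
  obtain ⟨s, h⟩ := key p
  refine ⟨_, h.step_dense (κ' := Unit) (fun _ c => if c then 1 else 0) (fun _ => 0) _ ?_
    (by simp) (by simp) (by simp) ?_⟩
  · rintro _ (_ | _) <;> simp
  · intro j x
    have : 0 ≤ 2 ^ p * f x := mul_nonneg (by positivity) (hf x)
    simp [this]

theorem Lay.clip (f : X → ℝ) :
    ∃ s, Lay (fun _ : Unit => f) 2 2 s Unit (fun _ x => clip01 (f x)) := by
  have h1 := (Lay.base (b := fun _ : Unit => f) (w := 2) 0).step_dense (κ' := Unit)
    (fun _ _ => -1) (fun _ => -1) _ (by simp) (by simp) (by simp) (by simp) (fun _ _ => rfl)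
  refine ⟨_, h1.step_dense (κ' := Unit) (fun _ _ => -1) (fun _ => -1) _ (by simp)
    (by simp) (by simp) (by simp) ?_⟩
  intro _ x
  simp only [Finset.univ_unique, Finset.sum_singleton, clip01]
  congr 1
  rcases le_total (f x) 1 with h | h
  · rw [min_eq_left h, max_eq_left (by linarith)]; ring
  · rw [min_eq_right h, max_eq_right (by linarith)]; ring

theorem Lay.scale_clip {w L s : ℕ} {f : X → ℝ} (hw : 2 ≤ w)
    (h : Lay b w (L + 1) s Unit (fun _ => f)) (p : ℕ) :
    Lay b w (L + 1 + (p + 4)) (s + (p + 4) * 6) Unit (fun _ x => clip01 (2 ^ p * f x)) := by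
  obtain ⟨s1, h1⟩ := Lay.scale (fun x => h.nonneg (by omega) () x) p
  obtain ⟨s2, h2⟩ := Lay.clip (fun x => 2 ^ p * f x)
  have h3 := (h1.comp h2).dense (by simp)
  exact h.comp (h3.mono hw (by omega))

end Products

/-! ### Local polynomial approximation -/

/-- The positive part (`true`) or the negative part (`false`) of `t - a`. -/
def part (σ : Bool) (a t : ℝ) : ℝ := if σ then max (t - a) 0 else max (a - t) 0

/-- The sign with which `part` enters `t - a`. -/
def partSign (σ : Bool) : ℝ := if σ then 1 else -1

/-- The hat function of height `h` and half-width `h` centred at `a`. -/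
def hat (h a t : ℝ) : ℝ := max (h - part true a t - part false a t) 0

theorem part_nonneg (σ : Bool) (a t : ℝ) : 0 ≤ part σ a t := by
  cases σ <;> simp [part]

theorem part_le_one (σ : Bool) {a t : ℝ} (ha0 : 0 ≤ a) (ha1 : a ≤ 1) (ht0 : 0 ≤ t) (ht1 : t ≤ 1) :
    part σ a t ≤ 1 := by
  cases σ <;> simp [part] <;> linarith

theorem sum_partSign (a t : ℝ) : ∑ σ : Bool, partSign σ * part σ a t = t - a := by
  simp only [Fintype.sum_bool, partSign, part]
  rcases le_total t a with h | h
  · simp [max_eq_right (sub_nonpos.2 h), max_eq_left (sub_nonneg.2 h)]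
  · simp [max_eq_right (sub_nonpos.2 h), max_eq_left (sub_nonneg.2 h)]

theorem hat_eq (h a t : ℝ) : hat h a t = max (h - |t - a|) 0 := by
  have : part true a t + part false a t = |t - a| := by
    simp only [part]
    rcases le_total t a with h | h
    · simp [max_eq_right (sub_nonpos.2 h), max_eq_left (sub_nonneg.2 h), abs_of_nonpos (sub_nonpos.2 h)]
    · simp [max_eq_right (sub_nonpos.2 h), max_eq_left (sub_nonneg.2 h), abs_of_nonneg (sub_nonneg.2 h)]
  rw [hat, ← this]; ring_nf

theorem hat_nonneg (h a t : ℝ) : 0 ≤ hat h a t := le_max_right _ _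

theorem abs_le_of_hat_ne_zero {h a t : ℝ} (H : hat h a t ≠ 0) : |t - a| ≤ h := by
  rw [hat_eq] at H
  by_contra hc
  exact H (max_eq_right (by linarith))

/-- The hat functions centred at the multiples of `1 / M` sum to the constant `1 / M`: each one is
a second difference of `t ↦ max t 0`, so that the sum telescopes. -/
theorem sum_hat (M : ℕ) (hM : 1 ≤ M) {t : ℝ} (h0 : 0 ≤ t) (h1 : t ≤ 1) :
    ∑ l : Fin (M + 1), hat (1 / M) (l / M) t = 1 / M := by
  have hM' : (0 : ℝ) < M := by exact_mod_cast hM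
  have key : ∀ z : ℝ, max (1 - |z|) 0 = max (z + 1) 0 - max z 0 - (max z 0 - max (z - 1) 0) := by
    intro z
    rcases le_total z 0 with h | h
    · rw [abs_of_nonpos h, max_eq_right h, max_eq_right (a := z - 1) (by linarith)]; ring_nf
    · rw [abs_of_nonneg h, max_eq_left h, max_eq_left (a := z + 1) (by linarith)]
      rcases le_total z 1 with h' | h'
      · rw [max_eq_left (by linarith), max_eq_right (a := z - 1) (by linarith)]; ring
      · rw [max_eq_right (by linarith), max_eq_left (a := z - 1) (by linarith)]; ring
  have hsum : ∀ (y : ℝ) (N : ℕ), ∑ l ∈ Finset.range N, max (1 - |y - l|) 0 =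
      max (y + 1) 0 - max y 0 - (max (y - N + 1) 0 - max (y - N) 0) := by
    intro y N
    induction N with
    | zero => simp
    | succ N ih =>
      rw [Finset.sum_range_succ, ih, key]; push_cast; ring_nf
  have hl : ∀ l : ℕ, hat (1 / M) (l / M) t = (1 / M) * max (1 - |M * t - l|) 0 := by
    intro l
    rw [hat_eq, mul_max_of_nonneg _ _ (by positivity), mul_zero]
    congr 1
    have : t - l / M = (1 / M) * (M * t - l) := by field_simp
    rw [this, abs_mul, abs_of_pos (show (0 : ℝ) < 1 / M by positivity)]; ring
  rw [Fin.sum_univ_eq_sum_range (fun l => hat (1 / M) (l / M) t) (M + 1)]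
  simp_rw [hl]
  rw [← Finset.mul_sum, hsum]
  have a1 : (M : ℝ) * t ≤ M := by nlinarith
  have a0 : 0 ≤ (M : ℝ) * t := by positivity
  push_cast
  rw [max_eq_left (by linarith), max_eq_left (by linarith), max_eq_right (by linarith),
    max_eq_right (by linarith)]
  ring

section Local

variable {X : Type} {s : ℕ} {b : Fin s → X → ℝ}

theorem cmp_part (σ : Bool) (i : Fin s) {a : ℝ} (ha0 : 0 ≤ a) (ha1 : a ≤ 1) :
    Cmp b 1 1 (fun x => part σ a (b i x)) := by
  classical
  have ha : |a| ≤ 1 := by rw [abs_of_nonneg ha0]; exact ha1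
  cases σ
  · convert Cmp.unit (b := b) (fun i' => if i' = i then -1 else 0) (-a)
      (fun i' => by split_ifs <;> simp) (by rwa [abs_neg]) using 2 with x
    simp [part]; ring_nf
  · convert Cmp.unit (b := b) (fun i' => if i' = i then 1 else 0) a
      (fun i' => by split_ifs <;> simp) ha using 2 with x
    simp [part]

theorem cmp_hat (i : Fin s) {a h : ℝ} (ha0 : 0 ≤ a) (ha1 : a ≤ 1) (hh0 : 0 ≤ h) (hh1 : h ≤ 1) :
    Cmp b 2 2 (fun x => hat h a (b i x)) := by
  convert (cmp_part true i ha0 ha1).add2 (cmp_part false i ha0 ha1) (-1) (-1) (-h) (by simp)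
    (by simp) (by rwa [abs_neg, abs_of_nonneg hh0]) using 2 with x
  rw [hat]; ring_nf

/-- The grid point of `[0,1]^s` with numerators `l` and denominator `2 ^ p`. -/
def gridPt {p : ℕ} (l : Fin s → Fin (2 ^ p + 1)) (i : Fin s) : ℝ := (l i : ℕ) / (2 ^ p : ℕ)

theorem gridPt_nonneg {p : ℕ} (l : Fin s → Fin (2 ^ p + 1)) (i : Fin s) : 0 ≤ gridPt l i := by
  unfold gridPt; positivity

theorem gridPt_le_one {p : ℕ} (l : Fin s → Fin (2 ^ p + 1)) (i : Fin s) : gridPt l i ≤ 1 := by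
  unfold gridPt
  rw [div_le_one (by positivity)]
  exact_mod_cast Nat.lt_succ_iff.1 (l i).2

/-- The product of the hat functions centred at the coordinates of a grid point. -/
def bump (b : Fin s → X → ℝ) {p : ℕ} (l : Fin s → Fin (2 ^ p + 1)) (x : X) : ℝ :=
  ∏ i, hat (1 / (2 ^ p : ℕ)) (gridPt l i) (b i x)

theorem bump_nonneg {p : ℕ} (l : Fin s → Fin (2 ^ p + 1)) (x : X) : 0 ≤ bump b l x :=
  Finset.prod_nonneg fun _ _ => hat_nonneg _ _ _

theorem sum_bump (hb0 : ∀ i x, 0 ≤ b i x) (hb1 : ∀ i x, b i x ≤ 1) (p : ℕ) (x : X) :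
    ∑ l : Fin s → Fin (2 ^ p + 1), bump b l x = (1 / 2 ^ p) ^ s := by
  unfold bump
  have := Finset.prod_univ_sum (fun _ : Fin s => (Finset.univ : Finset (Fin (2 ^ p + 1))))
    (fun i l => hat (1 / (2 ^ p : ℕ)) ((l : ℕ) / (2 ^ p : ℕ)) (b i x))
  rw [Fintype.piFinset_univ] at this
  unfold gridPt
  rw [← this]
  simp_rw [sum_hat (2 ^ p) Nat.one_le_two_pow (hb0 _ x) (hb1 _ x)]
  simp

/-- The building block of the construction: a single network of constant width multiplies one bump
with the positive or negative parts of the coordinate increments. -/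
theorem cmp_block (hb0 : ∀ i x, 0 ≤ b i x) (hb1 : ∀ i x, b i x ≤ 1) (n k : ℕ) {p : ℕ}
    (l : Fin s → Fin (2 ^ p + 1)) {j : ℕ} (hj : j ≤ k) (τ : Fin j → Fin s × Bool) :
    ∃ u : X → ℝ, Cmp b (8 ^ (s + k) * 2) (2 + (s + k) * (n + 5)) u ∧ ∀ x, 0 ≤ u x ∧ u x ≤ 1 ∧
      |u x - bump b l x * ∏ i, part (τ i).2 (gridPt l (τ i).1) (b (τ i).1 x)| ≤
        (s + k : ℕ) * (1 / 4) ^ n := by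
  have hh0 : (0 : ℝ) ≤ 1 / (2 ^ p : ℕ) := by positivity
  have hh1 : (1 : ℝ) / (2 ^ p : ℕ) ≤ 1 := by
    rw [div_le_one (by positivity)]; exact_mod_cast Nat.one_le_two_pow
  let f : Fin s ⊕ Fin j → X → ℝ := Sum.elim (fun i x => hat (1 / (2 ^ p : ℕ)) (gridPt l i) (b i x))
    (fun i x => part (τ i).2 (gridPt l (τ i).1) (b (τ i).1 x))
  have hf : ∀ i, Cmp b 2 (1 + 1) (f i) := by
    rintro (i | i)
    · exact cmp_hat i (gridPt_nonneg l i) (gridPt_le_one l i) hh0 hh1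
    · exact ((cmp_part _ _ (gridPt_nonneg l _) (gridPt_le_one l _)).pad 1).mono (by norm_num)
  have hf0 : ∀ i x, 0 ≤ f i x := by
    rintro (i | i) x
    · exact hat_nonneg _ _ _
    · exact part_nonneg _ _ _
  have hf1 : ∀ i x, f i x ≤ 1 := by
    rintro (i | i) x
    · refine max_le ?_ zero_le_one
      have := part_nonneg true (gridPt l i) (b i x)
      have := part_nonneg false (gridPt l i) (b i x)
      linarith
    · exact part_le_one _ (gridPt_nonneg l _) (gridPt_le_one l _) (hb0 _ _) (hb1 _ _)
  obtain ⟨u, hu, hux⟩ := Cmp.prod (by norm_num) hf hf0 hf1 n Finset.univ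
  have hcard : (Finset.univ : Finset (Fin s ⊕ Fin j)).card = s + j := by simp
  rw [hcard] at hu hux
  refine ⟨u, ?_, fun x => ⟨(hux x).1, (hux x).2.1, ?_⟩⟩
  · have e : 1 + 1 + (s + j) * (n + 5) = (1 + (s + j) * (n + 5)) + 1 := by ring
    rw [e] at hu
    refine (hu.pad_to ?_).mono (Nat.mul_le_mul_right _ (Nat.pow_le_pow_right (by norm_num) (by omega)))
    nlinarith
  · have h3 := (hux x).2.2
    rw [Fintype.prod_sum_type] at h3
    refine h3.trans (mul_le_mul_of_nonneg_right ?_ (by positivity))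
    exact_mod_cast (by omega : s + j ≤ s + k)

theorem prod_sub_eq_sum_parts {j : ℕ} (I : Fin j → Fin s) (a y : Fin s → ℝ) :
    ∏ i, (y (I i) - a (I i)) =
      ∑ σ : Fin j → Bool, (∏ i, partSign (σ i)) * ∏ i, part (σ i) (a (I i)) (y (I i)) := by
  simp_rw [← Finset.prod_mul_distrib, ← sum_partSign]
  rw [Finset.prod_univ_sum, Fintype.piFinset_univ]

theorem abs_prod_partSign {j : ℕ} (σ : Fin j → Bool) : |∏ i, partSign (σ i)| = 1 := by
  rw [Finset.abs_prod]
  refine Finset.prod_eq_one fun i _ => ?_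
  cases σ i <;> simp [partSign]

theorem sum_tuples_eq {j : ℕ} (c : (Fin j → Fin s) → ℝ) (a y : Fin s → ℝ) :
    ∑ I, c I * ∏ i, (y (I i) - a (I i)) =
      ∑ τ : Fin j → Fin s × Bool, (c (fun i => (τ i).1) * ∏ i, partSign (τ i).2) *
        ∏ i, part (τ i).2 (a (τ i).1) (y (τ i).1) := by
  simp_rw [prod_sub_eq_sum_parts, Finset.mul_sum]
  rw [← Fintype.sum_prod_type']
  rw [← Equiv.sum_comp (Equiv.arrowProdEquivProdArrow (Fin j) (fun _ => Fin s) (fun _ => Bool))]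
  refine Finset.sum_congr rfl fun τ _ => ?_
  simp [Equiv.arrowProdEquivProdArrow, mul_assoc]

/-- The index set of the blocks: grid points, degrees and signed tuples of coordinates. -/
abbrev Blocks (s k p : ℕ) : Type :=
  (Fin s → Fin (2 ^ p + 1)) × (Σ j : Fin (k + 1), Fin j → Fin s × Bool)

/-- The weight with which a block enters the approximation. -/
def blockCoeff {k p : ℕ} (c : (Fin s → Fin (2 ^ p + 1)) → (j : Fin (k + 1)) → (Fin j → Fin s) → ℝ)
    (a : Blocks s k p) : ℝ :=
  c a.1 a.2.1 (fun i => (a.2.2 i).1) * ∏ i, partSign (a.2.2 i).2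

theorem abs_blockCoeff_le {k p : ℕ} {R : ℝ}
    {c : (Fin s → Fin (2 ^ p + 1)) → (j : Fin (k + 1)) → (Fin j → Fin s) → ℝ}
    (hc : ∀ l j I, |c l j I| ≤ R) (a : Blocks s k p) : |blockCoeff c a| ≤ R := by
  rw [blockCoeff, abs_mul, abs_prod_partSign, mul_one]; exact hc _ _ _

theorem card_blocks_le (s k p : ℕ) : Fintype.card (Blocks s k p) ≤
    Fintype.card (Σ j : Fin (k + 1), Fin j → Fin s × Bool) * 2 ^ s * 2 ^ (p * s) := by
  have h2 : (2 ^ p + 1) ^ s ≤ (2 * 2 ^ p) ^ s :=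
    Nat.pow_le_pow_left (by have := Nat.one_le_two_pow (n := p); omega) _
  rw [Fintype.card_prod, Fintype.card_pi_const, Fintype.card_fin]
  calc _ ≤ (2 * 2 ^ p) ^ s * _ := Nat.mul_le_mul_right _ h2
    _ = _ := by rw [mul_pow, pow_mul]; ring

/-- The error at one point of a weighted sum of approximate blocks. -/
theorem abs_sum_blocks_sub_le (hb0 : ∀ i x, 0 ≤ b i x) (hb1 : ∀ i x, b i x ≤ 1) {k p ρ : ℕ}
    {c : (Fin s → Fin (2 ^ p + 1)) → (j : Fin (k + 1)) → (Fin j → Fin s) → ℝ}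
    (hc : ∀ l j I, |c l j I| ≤ 2 ^ ρ) {g E δ : ℝ} (x : X)
    (hE : ∀ l, (∀ i, |b i x - gridPt l i| ≤ 1 / 2 ^ p) →
      |g - ∑ j, ∑ I, c l j I * ∏ i, (b (I i) x - gridPt l (I i))| ≤ E)
    (v : Blocks s k p → ℝ) (hv : ∀ a, |v a - bump b a.1 x *
      ∏ i, part (a.2.2 i).2 (gridPt a.1 (a.2.2 i).1) (b (a.2.2 i).1 x)| ≤ δ) :
    |2 ^ (p * s) * ∑ a, blockCoeff c a * v a - g| ≤
      E + 2 ^ (p * s) * (Fintype.card (Blocks s k p) * (2 ^ ρ * δ)) := by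
  have hp2 : (0 : ℝ) < 2 ^ p := by positivity
  have hgrid : ∀ l : Fin s → Fin (2 ^ p + 1), bump b l x * |g - ∑ j, ∑ I, c l j I *
      ∏ i, (b (I i) x - gridPt l (I i))| ≤ bump b l x * E := by
    intro l
    rcases eq_or_ne (bump b l x) 0 with h | h
    · rw [h]; simp
    · refine mul_le_mul_of_nonneg_left (hE l fun i => ?_) (bump_nonneg l x)
      have := abs_le_of_hat_ne_zero (Finset.prod_ne_zero_iff.1 h i (Finset.mem_univ _))
      push_cast at this
      exact this
  have hsb := sum_bump hb0 hb1 p x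
  -- the exact blocks add up to the average of the local polynomials
  have hmain : ∑ a : Blocks s k p, blockCoeff c a * (bump b a.1 x *
      ∏ i, part (a.2.2 i).2 (gridPt a.1 (a.2.2 i).1) (b (a.2.2 i).1 x)) =
      ∑ l, bump b l x * ∑ j, ∑ I, c l j I * ∏ i, (b (I i) x - gridPt l (I i)) := by
    rw [Fintype.sum_prod_type]
    refine Finset.sum_congr rfl fun l _ => ?_
    rw [Fintype.sum_sigma, Finset.mul_sum]
    refine Finset.sum_congr rfl fun j _ => ?_
    rw [sum_tuples_eq (fun I => c l j I) (gridPt l) (fun i => b i x), Finset.mul_sum]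
    refine Finset.sum_congr rfl fun τ _ => ?_
    simp only [blockCoeff]; ring
  have hpow : (2 : ℝ) ^ (p * s) * (1 / 2 ^ p) ^ s = 1 := by
    rw [pow_mul, ← mul_pow, mul_one_div_cancel hp2.ne', one_pow]
  have hEerr : |2 ^ (p * s) * (∑ l, bump b l x * ∑ j, ∑ I, c l j I *
      ∏ i, (b (I i) x - gridPt l (I i))) - g| ≤ E := by
    have e : 2 ^ (p * s) * (∑ l, bump b l x * ∑ j, ∑ I, c l j I *
        ∏ i, (b (I i) x - gridPt l (I i))) - g = 2 ^ (p * s) * ∑ l, bump b l x *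
        (∑ j, ∑ I, c l j I * ∏ i, (b (I i) x - gridPt l (I i)) - g) := by
      simp_rw [mul_sub, Finset.sum_sub_distrib, ← Finset.sum_mul, hsb]
      rw [mul_sub, ← mul_assoc (2 ^ (p * s)) ((1 / 2 ^ p) ^ s), hpow, one_mul]
    rw [e, abs_mul, abs_of_pos (show (0 : ℝ) < 2 ^ (p * s) by positivity)]
    calc (2 : ℝ) ^ (p * s) * |∑ l, bump b l x * (∑ j, ∑ I, c l j I *
          ∏ i, (b (I i) x - gridPt l (I i)) - g)|
        ≤ 2 ^ (p * s) * ∑ l, bump b l x * E := by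
          refine mul_le_mul_of_nonneg_left ?_ (by positivity)
          refine (Finset.abs_sum_le_sum_abs _ _).trans (Finset.sum_le_sum fun l _ => ?_)
          rw [abs_mul, abs_of_nonneg (bump_nonneg l x), abs_sub_comm]
          exact hgrid l
      _ = E := by rw [← Finset.sum_mul, hsb, ← mul_assoc, hpow, one_mul]
  have hApprox : |∑ a : Blocks s k p, blockCoeff c a * v a - ∑ a : Blocks s k p, blockCoeff c a * (bump b a.1 x *
      ∏ i, part (a.2.2 i).2 (gridPt a.1 (a.2.2 i).1) (b (a.2.2 i).1 x))| ≤
      Fintype.card (Blocks s k p) * (2 ^ ρ * δ) := by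
    rw [← Finset.sum_sub_distrib]
    refine (Finset.abs_sum_le_sum_abs _ _).trans ?_
    calc _ ≤ ∑ _a : Blocks s k p, (2 : ℝ) ^ ρ * δ := by
          refine Finset.sum_le_sum fun a _ => ?_
          rw [← mul_sub, abs_mul]
          exact mul_le_mul (abs_blockCoeff_le hc a) (hv a) (abs_nonneg _) (by positivity)
      _ = _ := by simp
  rw [hmain] at hApprox
  have e6 : 2 ^ (p * s) * ∑ a : Blocks s k p, blockCoeff c a * v a - g = 2 ^ (p * s) * (∑ a : Blocks s k p, blockCoeff c a * v a -
      ∑ l, bump b l x * ∑ j, ∑ I, c l j I * ∏ i, (b (I i) x - gridPt l (I i))) +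
      (2 ^ (p * s) * (∑ l, bump b l x * ∑ j, ∑ I, c l j I *
      ∏ i, (b (I i) x - gridPt l (I i))) - g) := by ring
  rw [e6]
  refine (abs_add_le _ _).trans ?_
  rw [abs_mul, abs_of_pos (show (0 : ℝ) < 2 ^ (p * s) by positivity)]
  have h7 := (mul_le_mul_of_nonneg_left hApprox
    (show (0 : ℝ) ≤ 2 ^ (p * s) by positivity))
  linarith

theorem block_error_numerics {s k ρ A T p Z : ℕ} (hZ : Z ≤ T * 2 ^ s * 2 ^ (p * s)) :
    (2 : ℝ) ^ (p * s) * (Z * (2 ^ ρ * ((s + k : ℕ) *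
      (1 / 4) ^ ((p + 1) * (s + ρ + T * (s + k) + A))))) ≤ (1 / 2) ^ (A * p) := by
  set t : ℕ := T * (s + k) with ht
  set n : ℕ := (p + 1) * (s + ρ + t + A) with hn
  have h1 : (Z : ℝ) ≤ T * 2 ^ s * 2 ^ (p * s) := by exact_mod_cast hZ
  have h2 : (T : ℝ) * (s + k : ℕ) ≤ 2 ^ t := by
    have : t < 2 ^ t := Nat.lt_two_pow_self
    exact_mod_cast this.le
  have h3 : ((1 : ℝ) / 4) ^ n = (1 / 2) ^ (2 * n) := by rw [pow_mul (1 / 2 : ℝ) 2 n]; norm_num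
  have h4 : (2 : ℝ) ^ (p * s + s + p * s + ρ + t) * (1 / 2) ^ (2 * n) ≤ (1 / 2) ^ (A * p) := by
    have h5 : p * s + s + p * s + ρ + t + A * p ≤ 2 * n := by
      rw [hn]; nlinarith [Nat.zero_le (p * ρ), Nat.zero_le (p * t)]
    calc (2 : ℝ) ^ (p * s + s + p * s + ρ + t) * (1 / 2) ^ (2 * n)
        ≤ 2 ^ (p * s + s + p * s + ρ + t) * (1 / 2) ^ (p * s + s + p * s + ρ + t + A * p) :=
          mul_le_mul_of_nonneg_left
            (pow_le_pow_of_le_one (by norm_num) (by norm_num) h5) (by positivity)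
      _ = (1 / 2) ^ (A * p) := by
          rw [pow_add _ _ (A * p), ← mul_assoc, ← mul_pow]; norm_num
  calc (2 : ℝ) ^ (p * s) * (Z * (2 ^ ρ * ((s + k : ℕ) * (1 / 4) ^ n)))
      ≤ 2 ^ (p * s) * (T * 2 ^ s * 2 ^ (p * s) * (2 ^ ρ * ((s + k : ℕ) * (1 / 4) ^ n))) := by gcongr
    _ = (T * (s + k : ℕ)) * (2 ^ (p * s + s + p * s + ρ) * (1 / 2) ^ (2 * n)) := by
        rw [h3]; ring
    _ ≤ 2 ^ t * (2 ^ (p * s + s + p * s + ρ) * (1 / 2) ^ (2 * n)) := by gcongr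
    _ = 2 ^ (p * s + s + p * s + ρ + t) * (1 / 2) ^ (2 * n) := by ring
    _ ≤ _ := h4

/-- A function which is close to a polynomial of degree `k` near each point of the
grid of mesh `2 ^ (-p)` is computed, up to the same error and after clipping to `[0,1]`, by a
network with `O(2 ^ (p s))` units per layer, `O(p)` layers and `O(p 2 ^ (p s))` parameters. The
blocks for the different grid points and monomials run in parallel, and the normalisation
of the bumps is a final multiplication by a power of two. -/
theorem local_approx (s k ρ A : ℕ) : ∃ D C : ℕ, 1 ≤ D ∧ 1 ≤ C ∧ ∀ (p : ℕ) (X : Type)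
    (b : Fin s → X → ℝ), (∀ i x, 0 ≤ b i x) → (∀ i x, b i x ≤ 1) → ∀ (g : X → ℝ) (E : ℝ)
    (c : (Fin s → Fin (2 ^ p + 1)) → (j : Fin (k + 1)) → (Fin j → Fin s) → ℝ),
    (∀ l j I, |c l j I| ≤ 2 ^ ρ) →
    (∀ l x, (∀ i, |b i x - gridPt l i| ≤ 1 / 2 ^ p) →
      |g x - ∑ j, ∑ I, c l j I * ∏ i, (b (I i) x - gridPt l (I i))| ≤ E) →
    ∃ u : X → ℝ, Lay b (C * 2 ^ (p * s)) (D * (p + 1)) (C * (p + 1) * 2 ^ (p * s)) Unit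
        (fun _ => u) ∧
      ∀ x, 0 ≤ u x ∧ u x ≤ 1 ∧ |u x - clip01 (g x)| ≤ E + (1 / 2) ^ (A * p) := by
  classical
  set T : ℕ := Fintype.card (Σ j : Fin (k + 1), Fin j → Fin s × Bool) with hT
  set t : ℕ := T * (s + k) with ht
  set m : ℕ := s + ρ + t + A with hm
  set w : ℕ := 8 ^ (s + k) * 2 with hw
  set D : ℕ := (s + k) * (m + 5) + s + ρ + 10 with hD
  set Q : ℕ := T * 2 ^ s with hQ
  have hT1 : 1 ≤ T := by
    rw [hT]; exact Fintype.card_pos_iff.2 ⟨⟨0, fun i => i.elim0⟩⟩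
  have hQ1 : 1 ≤ Q := Nat.mul_pos hT1 (by positivity)
  have hw1 : 2 ≤ w := by
    have : 1 ≤ 8 ^ (s + k) := Nat.one_le_pow _ _ (by norm_num)
    omega
  have hws : s ≤ w := by
    have : s < 8 ^ s := Nat.lt_pow_self (by norm_num)
    have : 8 ^ s ≤ 8 ^ (s + k) := Nat.pow_le_pow_right (by norm_num) (by omega)
    omega
  refine ⟨D, D * (Q * (w * (w + 1) + 20)), by omega, Nat.mul_pos (by omega) (Nat.mul_pos hQ1 (by omega)), ?_⟩
  intro p X b hb0 hb1 g E c hc hE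
  set n : ℕ := (p + 1) * m with hn
  let B := Blocks s k p
  have hBne : Nonempty B := ⟨⟨fun _ => 0, ⟨0, fun i => i.elim0⟩⟩⟩
  have hBcard : Fintype.card B ≤ Q * 2 ^ (p * s) := card_blocks_le s k p
  choose u hu hux using fun a : B => cmp_block hb0 hb1 n k a.1 (Nat.lt_succ_iff.1 a.2.1.2) a.2.2
  set Lb : ℕ := 1 + (s + k) * (n + 5) with hLb
  have hlay : ∀ a, Lay b w (Lb + 1) ((Lb + 1) * (w * (w + 1))) Unit (fun _ => u a) := by
    intro a
    obtain ⟨s', h⟩ := hu a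
    have e : 2 + (s + k) * (n + 5) = Lb + 1 := by rw [hLb]; ring
    rw [e] at h
    exact h.dense (by simpa using hws)
  have hcomb := Lay.comb hlay (fun a => blockCoeff c a / 2 ^ ρ) 0
    (fun a => by
      rw [abs_div, abs_of_pos (show (0 : ℝ) < 2 ^ ρ by positivity)]
      exact div_le_one_of_le₀ (abs_blockCoeff_le hc a) (by positivity)) (by simp)
  have hBw : 2 ≤ Fintype.card B * w := by
    have : 1 ≤ Fintype.card B := Fintype.card_pos
    nlinarith
  have hfin := hcomb.scale_clip hBw (p * s + ρ)
  have e3 : Lb + 1 + 1 + (p * s + ρ + 4) = (Lb + 1 + (p * s + ρ + 4)) + 1 := by ring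
  rw [e3] at hfin
  have hLD : Lb + 1 + (p * s + ρ + 4) + 1 ≤ D * (p + 1) := by
    rw [hLb, hn, hD]
    have : 0 ≤ (s + k) * p := Nat.zero_le _
    nlinarith [Nat.zero_le ((s + k) * p * 5), Nat.zero_le (ρ * p)]
  set C := D * (Q * (w * (w + 1) + 20)) with hC
  have hpad := hfin.pad (D * (p + 1) - (Lb + 1 + (p * s + ρ + 4) + 1))
  rw [Nat.add_sub_cancel' hLD] at hpad
  refine ⟨_, hpad.mono ?_ ?_, fun x => ⟨clip01_nonneg _, clip01_le_one _, ?_⟩⟩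
  · calc Fintype.card B * w ≤ Q * 2 ^ (p * s) * w := Nat.mul_le_mul_right _ hBcard
      _ ≤ C * 2 ^ (p * s) := by
        have : Q * w ≤ C := by
          rw [hC]
          calc Q * w ≤ 1 * (Q * (w * (w + 1) + 20)) := by
                rw [one_mul]; exact Nat.mul_le_mul_left _ (by nlinarith)
            _ ≤ _ := Nat.mul_le_mul_right _ (by omega)
        calc Q * 2 ^ (p * s) * w = Q * w * 2 ^ (p * s) := by ring
          _ ≤ _ := Nat.mul_le_mul_right _ this
  · have hV : 1 ≤ D * (p + 1) := Nat.mul_pos (by omega) (by omega)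
    have hU : 1 ≤ Q * 2 ^ (p * s) := Nat.mul_pos hQ1 (by positivity)
    have h1 : Fintype.card B * ((Lb + 1) * (w * (w + 1)) + 1) ≤
        Q * 2 ^ (p * s) * (D * (p + 1) * (w * (w + 1)) + D * (p + 1)) :=
      Nat.mul_le_mul hBcard (Nat.add_le_add (Nat.mul_le_mul_right _ (by omega)) hV)
    have h2 : D * (p + 1) ≤ Q * 2 ^ (p * s) * (D * (p + 1)) := Nat.le_mul_of_pos_left _ hU
    have h3 : C * (p + 1) * 2 ^ (p * s) =
        Q * 2 ^ (p * s) * (D * (p + 1) * (w * (w + 1)) + D * (p + 1)) +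
          19 * (Q * 2 ^ (p * s) * (D * (p + 1))) := by rw [hC]; ring
    omega
  · have hscale : clip01 (2 ^ (p * s + ρ) * max (∑ a : B, blockCoeff c a / 2 ^ ρ * u a x - 0) 0) =
        clip01 (2 ^ (p * s) * ∑ a : B, blockCoeff c a * u a x) := by
      rw [mul_max_of_nonneg _ _ (by positivity), mul_zero, clip01_max_zero, sub_zero, pow_add]
      have : ∑ a : B, blockCoeff c a / 2 ^ ρ * u a x = (∑ a : B, blockCoeff c a * u a x) / 2 ^ ρ := by
        rw [Finset.sum_div]; exact Finset.sum_congr rfl fun a _ => by ring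
      rw [this]
      congr 1
      field_simp
    rw [hscale]
    exact ((abs_clip01_sub_le _ _).trans (abs_sum_blocks_sub_le hb0 hb1 hc x (fun l => hE l x)
      (fun a => u a x) fun a => (hux a x).2.2)).trans
      (add_le_add_right (block_error_numerics hBcard) E)

end Local

/-! ### Taylor expansion in Hölder balls -/

/-- Taylor's formula on `[0,1]` for a chain of derivatives, with the remainder bounded by
the oscillation of the highest one. -/
theorem abs_taylor_sub_le (k : ℕ) (D : ℕ → ℝ → ℝ) (R : ℝ)
    (hD : ∀ j < k, ∀ t ∈ Set.Icc (0 : ℝ) 1, HasDerivWithinAt (D j) (D (j + 1) t) (Set.Icc 0 1) t)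
    (hR : ∀ t ∈ Set.Icc (0 : ℝ) 1, |D k t - D k 0| ≤ R) :
    ∀ t ∈ Set.Icc (0 : ℝ) 1,
      |D 0 t - ∑ j ∈ Finset.range (k + 1), D j 0 * t ^ j / (j.factorial : ℝ)| ≤ R := by
  induction k generalizing D with
  | zero => intro t ht; simpa using hR t ht
  | succ k ih =>
    have ih' := ih (fun j => D (j + 1)) (fun j hj => hD (j + 1) (by omega)) hR
    have hR0 : 0 ≤ R := (abs_nonneg _).trans (hR 0 ⟨le_rfl, zero_le_one⟩)
    set f : ℝ → ℝ := fun t => D 0 t - ∑ j ∈ Finset.range (k + 1 + 1), D j 0 * t ^ j / (j.factorial : ℝ)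
    have hf : ∀ t ∈ Set.Icc (0 : ℝ) 1, HasDerivWithinAt f
        (D 1 t - ∑ j ∈ Finset.range (k + 1), D (j + 1) 0 * t ^ j / (j.factorial : ℝ))
        (Set.Icc 0 1) t := by
      intro t ht
      refine (hD 0 (by omega) t ht).sub ?_
      have h1 : HasDerivAt (fun t : ℝ => ∑ j ∈ Finset.range (k + 1 + 1),
          D j 0 * t ^ j / (j.factorial : ℝ)) (∑ j ∈ Finset.range (k + 1 + 1),
          D j 0 * (j * t ^ (j - 1)) / (j.factorial : ℝ)) t := by
        refine HasDerivAt.fun_sum fun j _ => ?_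
        exact ((hasDerivAt_pow j t).const_mul _).div_const _
      have h2 : ∑ j ∈ Finset.range (k + 1 + 1), D j 0 * (j * t ^ (j - 1)) / (j.factorial : ℝ) =
          ∑ j ∈ Finset.range (k + 1), D (j + 1) 0 * t ^ j / (j.factorial : ℝ) := by
        rw [Finset.sum_range_succ']
        simp only [Nat.cast_zero, zero_mul, mul_zero, zero_div, add_zero]
        refine Finset.sum_congr rfl fun j _ => ?_
        rw [Nat.factorial_succ, Nat.add_sub_cancel]
        push_cast
        have : (j : ℝ) + 1 ≠ 0 := by positivity
        have : (j.factorial : ℝ) ≠ 0 := by positivity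
        field_simp
      rw [h2] at h1
      exact h1.hasDerivWithinAt
    intro t ht
    have hmv := (convex_Icc (0 : ℝ) 1).norm_image_sub_le_of_norm_hasDerivWithin_le hf
      (fun t ht => by rw [Real.norm_eq_abs]; exact ih' t ht) ⟨le_rfl, zero_le_one⟩ ht
    have f0 : f 0 = 0 := by
      simp only [f]
      rw [Finset.sum_range_succ']
      simp
    rw [f0, sub_zero, Real.norm_eq_abs, sub_zero, Real.norm_eq_abs, abs_of_nonneg ht.1] at hmv
    exact hmv.trans (mul_le_of_le_one_right hR0 ht.2)

section Cubes

variable {d : ℕ}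

theorem convex_cube : Convex ℝ (Set.Icc (0 : Fin d → ℝ) 1) := convex_Icc _ _

theorem uniqueDiffOn_cube : UniqueDiffOn ℝ (Set.Icc (0 : Fin d → ℝ) 1) := by
  rw [← Set.pi_univ_Icc]
  exact UniqueDiffOn.univ_pi fun i => uniqueDiffOn_Icc zero_lt_one

theorem iteratedFDerivWithin_eq_sum_partialD (g : (Fin d → ℝ) → ℝ) (j : ℕ) (y v : Fin d → ℝ) :
    iteratedFDerivWithin ℝ j g (Set.Icc 0 1) y (fun _ => v) =
      ∑ I : Fin j → Fin d, (∏ i, v (I i)) * partialD g I y := by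
  have hv : v = ∑ i, v i • (Pi.single i 1 : Fin d → ℝ) := by
    funext j
    simp [Finset.sum_apply, Pi.single_apply]
  conv_lhs => rw [hv]
  have := (iteratedFDerivWithin ℝ j g (Set.Icc 0 1) y).toMultilinearMap.map_sum
    (fun (_ : Fin j) (i : Fin d) => v i • (Pi.single i 1 : Fin d → ℝ))
  simp only [ContinuousMultilinearMap.coe_coe] at this
  rw [this]
  refine Finset.sum_congr rfl fun I _ => ?_
  have h2 := (iteratedFDerivWithin ℝ j g (Set.Icc 0 1) y).toMultilinearMap.map_smul_univ
    (fun i => v (I i)) (fun i => (Pi.single (I i) 1 : Fin d → ℝ))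
  simp only [ContinuousMultilinearMap.coe_coe] at h2
  rw [h2, smul_eq_mul, partialD]

theorem partialD_zero (g : (Fin d → ℝ) → ℝ) (I : Fin 0 → Fin d) (x : Fin d → ℝ) :
    partialD g I x = g x := by
  simp [partialD]

/-- The derivatives of `g` along a segment in the cube. -/
theorem hasDerivWithinAt_segment {k : ℕ} {g : (Fin d → ℝ) → ℝ}
    (hg : ContDiffOn ℝ (k : WithTop ℕ∞) g (Set.Icc 0 1)) {a x : Fin d → ℝ}
    (ha : a ∈ Set.Icc (0 : Fin d → ℝ) 1) (hx : x ∈ Set.Icc (0 : Fin d → ℝ) 1) (j : ℕ) (hj : j < k)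
    (t : ℝ) (ht : t ∈ Set.Icc (0 : ℝ) 1) :
    HasDerivWithinAt
      (fun t => iteratedFDerivWithin ℝ j g (Set.Icc 0 1) (a + t • (x - a)) (fun _ => x - a))
      (iteratedFDerivWithin ℝ (j + 1) g (Set.Icc 0 1) (a + t • (x - a)) (fun _ => x - a))
      (Set.Icc 0 1) t := by
  have hmaps : Set.MapsTo (fun t : ℝ => a + t • (x - a)) (Set.Icc 0 1)
      (Set.Icc (0 : Fin d → ℝ) 1) := fun t ht =>
    convex_cube.add_smul_sub_mem ha hx ht
  have hd := (hg.differentiableOn_iteratedFDerivWithin (m := j) (by exact_mod_cast hj)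
    uniqueDiffOn_cube) _ (hmaps ht)
  have hγ : HasDerivWithinAt (fun t : ℝ => a + t • (x - a)) (x - a) (Set.Icc 0 1) t := by
    simpa using (((hasDerivAt_id t).smul_const (x - a)).const_add a).hasDerivWithinAt
  have h1 := hd.hasFDerivWithinAt.comp_hasDerivWithinAt t hγ hmaps
  have h2 := (ContinuousMultilinearMap.apply ℝ (fun _ : Fin j => Fin d → ℝ) ℝ
    (fun _ => x - a)).hasFDerivAt.comp_hasDerivWithinAt t h1
  rw [iteratedFDerivWithin_succ_apply_left]
  exact h2

theorem dist_toLp_le {x z : Fin d → ℝ} {h : ℝ} (hh : 0 ≤ h) (H : ∀ i, |x i - z i| ≤ h) :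
    dist (WithLp.toLp 2 x) (WithLp.toLp 2 z) ≤ d * h := by
  rw [EuclideanSpace.dist_eq]
  refine Real.sqrt_le_iff.2 ⟨by positivity, ?_⟩
  calc ∑ i, dist (WithLp.toLp 2 x i) (WithLp.toLp 2 z i) ^ 2 ≤ ∑ _i : Fin d, h ^ 2 := by
        refine Finset.sum_le_sum fun i _ => pow_le_pow_left₀ dist_nonneg ?_ 2
        rw [Real.dist_eq]; exact H i
    _ = d * h ^ 2 := by simp
    _ ≤ (d * h) ^ 2 := by
      rw [mul_pow]
      refine mul_le_mul_of_nonneg_right ?_ (by positivity)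
      rcases Nat.eq_zero_or_pos d with h0 | h0
      · simp [h0]
      · have : (1 : ℝ) ≤ d := by exact_mod_cast h0
        nlinarith

variable {β r : ℝ} {g : (Fin d → ℝ) → ℝ}

theorem holder_coeff_le (hg : g ∈ HolderBall d β r) {j : ℕ} (hj : j ≤ ⌈β⌉₊ - 1)
    (I : Fin j → Fin d) {a : Fin d → ℝ} (ha : a ∈ Set.Icc (0 : Fin d → ℝ) 1) :
    |partialD g I a / (j.factorial : ℝ)| ≤ r := by
  obtain ⟨-, A, B, hA, hB, hAB, h1, -⟩ := hg
  rw [abs_div, Nat.abs_cast]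
  refine (div_le_self (abs_nonneg _) (by exact_mod_cast j.factorial_pos)).trans ?_
  linarith [h1 j hj I a ha]

theorem ceil_sub_one_add (hβ : 0 < β) : ((⌈β⌉₊ - 1 : ℕ) : ℝ) + (β - (⌈β⌉₊ : ℝ) + 1) = β := by
  have : 1 ≤ ⌈β⌉₊ := Nat.one_le_iff_ne_zero.2 (by simpa using hβ)
  push_cast [this]; ring

theorem holder_exponent_mem (hβ : 0 < β) :
    0 < β - (⌈β⌉₊ : ℝ) + 1 ∧ β - (⌈β⌉₊ : ℝ) + 1 ≤ 1 := by
  have h1 := Nat.le_ceil β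
  have h2 := Nat.ceil_lt_add_one hβ.le
  constructor <;> linarith

/-- The local Taylor polynomials of a function in a Hölder ball. -/
theorem holder_taylor (hd : 1 ≤ d) (hβ : 0 < β) (hg : g ∈ HolderBall d β r) {a x : Fin d → ℝ}
    (ha : a ∈ Set.Icc (0 : Fin d → ℝ) 1) (hx : x ∈ Set.Icc (0 : Fin d → ℝ) 1) {h : ℝ} (hh : 0 < h)
    (H : ∀ i, |x i - a i| ≤ h) :
    |g x - ∑ j : Fin (⌈β⌉₊ - 1 + 1), ∑ I : Fin j → Fin d,
      partialD g I a / ((j : ℕ).factorial : ℝ) * ∏ i, (x (I i) - a (I i))| ≤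
      r * d ^ ⌈β⌉₊ * h ^ β := by
  obtain ⟨hC, A, B, hA, hB, hAB, h1, h2⟩ := id hg
  set k := ⌈β⌉₊ - 1 with hk
  set l := β - (⌈β⌉₊ : ℝ) + 1 with hl
  obtain ⟨hl0, hl1⟩ := holder_exponent_mem hβ
  have hd1 : (1 : ℝ) ≤ d := by exact_mod_cast hd
  set D : ℕ → ℝ → ℝ := fun j t =>
    iteratedFDerivWithin ℝ j g (Set.Icc 0 1) (a + t • (x - a)) (fun _ => x - a) with hD
  have hR : ∀ t ∈ Set.Icc (0 : ℝ) 1, |D k t - D k 0| ≤ r * d ^ ⌈β⌉₊ * h ^ β := by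
    intro t ht
    have hy : a + t • (x - a) ∈ Set.Icc (0 : Fin d → ℝ) 1 := convex_cube.add_smul_sub_mem ha hx ht
    simp only [hD, iteratedFDerivWithin_eq_sum_partialD, zero_smul, add_zero]
    rw [← Finset.sum_sub_distrib]
    have hterm : ∀ I : Fin k → Fin d, |(∏ i, (x - a) (I i)) * partialD g I (a + t • (x - a)) -
        (∏ i, (x - a) (I i)) * partialD g I a| ≤ h ^ k * (B * (d * h) ^ l) := by
      intro I
      rw [← mul_sub, abs_mul]
      refine mul_le_mul ?_ ((h2 I _ hy a ha).trans ?_) (abs_nonneg _) (by positivity)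
      · rw [Finset.abs_prod]
        calc ∏ i, |(x - a) (I i)| ≤ ∏ _i : Fin k, h :=
              Finset.prod_le_prod (fun _ _ => abs_nonneg _) fun i _ => H (I i)
          _ = h ^ k := by simp
      · refine mul_le_mul_of_nonneg_left ?_ hB
        refine Real.rpow_le_rpow dist_nonneg (dist_toLp_le hh.le fun i => ?_) hl0.le
        simp only [Pi.add_apply, Pi.smul_apply, Pi.sub_apply, smul_eq_mul, add_sub_cancel_left]
        rw [abs_mul, abs_of_nonneg ht.1]
        exact (mul_le_of_le_one_left (abs_nonneg _) ht.2).trans (H i)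
    have hsum := (Finset.abs_sum_le_sum_abs _ _).trans
      (Finset.sum_le_sum fun (I : Fin k → Fin d) (_ : I ∈ Finset.univ) => hterm I)
    refine hsum.trans ?_
    simp only [Finset.sum_const, Finset.card_univ, Fintype.card_pi_const, Fintype.card_fin,
      nsmul_eq_mul]
    have e1 : h ^ β = h ^ k * h ^ l := by
      rw [← Real.rpow_natCast, ← Real.rpow_add hh, hk, hl, ceil_sub_one_add hβ]
    have e2 : (d : ℝ) ^ ⌈β⌉₊ = d ^ k * d := by
      rw [← pow_succ, hk, Nat.sub_add_cancel]
      exact Nat.one_le_iff_ne_zero.2 (by simpa using hβ)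
    have e3 : (d * h) ^ l ≤ d * h ^ l := by
      rw [Real.mul_rpow (by positivity) hh.le]
      refine mul_le_mul_of_nonneg_right ?_ (by positivity)
      calc (d : ℝ) ^ l ≤ (d : ℝ) ^ (1 : ℝ) := Real.rpow_le_rpow_of_exponent_le hd1 hl1
        _ = d := Real.rpow_one _
    have hBr : B ≤ r := by linarith
    have hr0 : 0 ≤ r := by linarith
    calc ((d ^ k : ℕ) : ℝ) * (h ^ k * (B * (d * h) ^ l))
        ≤ ((d ^ k : ℕ) : ℝ) * (h ^ k * (r * (d * h ^ l))) := by gcongr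
      _ = r * d ^ ⌈β⌉₊ * h ^ β := by rw [e1, e2]; push_cast; ring
  have := abs_taylor_sub_le k D _ (fun j hj t ht => hasDerivWithinAt_segment hC ha hx j hj t ht) hR
    1 ⟨zero_le_one, le_rfl⟩
  have e0 : D 0 1 = g x := by simp [hD]
  rw [e0, ← Fin.sum_univ_eq_sum_range (fun j => D j 0 * 1 ^ j / (j.factorial : ℝ))] at this
  convert this using 4 with j
  simp only [hD, iteratedFDerivWithin_eq_sum_partialD, zero_smul, add_zero, one_pow, mul_one,
    Finset.sum_div, Pi.sub_apply]
  exact Finset.sum_congr rfl fun I _ => by ring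

theorem holder_modulus (hβ : 0 < β) (hg : g ∈ HolderBall d β r) {x z : Fin d → ℝ}
    (hx : x ∈ Set.Icc (0 : Fin d → ℝ) 1) (hz : z ∈ Set.Icc (0 : Fin d → ℝ) 1) {h : ℝ} (hh : 0 < h)
    (H : ∀ i, |x i - z i| ≤ h) : |g x - g z| ≤ r * (d + 1) * h ^ min 1 β := by
  obtain ⟨hC, A, B, hA, hB, hAB, h1, h2⟩ := id hg
  have hr : 0 ≤ r := by linarith
  rcases le_or_gt β 1 with hb | hb
  · rw [min_eq_right hb]
    have hc : ⌈β⌉₊ = 1 := by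
      refine le_antisymm (Nat.ceil_le.2 (by simpa using hb)) ?_
      exact Nat.one_le_iff_ne_zero.2 (by simpa using hβ)
    rw [hc] at h2
    have : |partialD g (Fin.elim0 : Fin 0 → Fin d) x - partialD g (Fin.elim0 : Fin 0 → Fin d) z| ≤
        B * dist (WithLp.toLp 2 x) (WithLp.toLp 2 z) ^ (β - ((1 : ℕ) : ℝ) + 1) :=
      h2 Fin.elim0 x hx z hz
    simp only [partialD_zero] at this
    refine this.trans ?_
    have e3 : dist (WithLp.toLp 2 x) (WithLp.toLp 2 z) ^ (β - ((1 : ℕ) : ℝ) + 1) ≤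
        (d + 1) * h ^ β := by
      have e4 : β - ((1 : ℕ) : ℝ) + 1 = β := by push_cast; ring
      rw [e4]
      calc dist (WithLp.toLp 2 x) (WithLp.toLp 2 z) ^ β ≤ ((d + 1) * h) ^ β := by
            refine Real.rpow_le_rpow dist_nonneg ((dist_toLp_le hh.le H).trans ?_) hβ.le
            nlinarith
        _ = (d + 1) ^ β * h ^ β := Real.mul_rpow (by positivity) hh.le
        _ ≤ (d + 1) * h ^ β := by
            refine mul_le_mul_of_nonneg_right ?_ (by positivity)
            calc ((d : ℝ) + 1) ^ β ≤ (d + 1) ^ (1 : ℝ) :=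
                  Real.rpow_le_rpow_of_exponent_le (by linarith [(Nat.cast_nonneg d : (0 : ℝ) ≤ d)]) hb
              _ = _ := Real.rpow_one _
    calc _ ≤ B * ((d + 1) * h ^ β) := mul_le_mul_of_nonneg_left e3 hB
      _ ≤ r * ((d + 1) * h ^ β) := mul_le_mul_of_nonneg_right (by linarith) (by positivity)
      _ = _ := by ring
  · rw [min_eq_left hb.le, Real.rpow_one]
    have hk : 1 ≤ ⌈β⌉₊ - 1 := by
      have : 1 < ⌈β⌉₊ := Nat.lt_ceil.2 (by simpa using hb)
      omega
    set D : ℕ → ℝ → ℝ := fun j t =>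
      iteratedFDerivWithin ℝ j g (Set.Icc 0 1) (z + t • (x - z)) (fun _ => x - z) with hD
    have hder : ∀ t ∈ Set.Icc (0 : ℝ) 1, HasDerivWithinAt (D 0) (D 1 t) (Set.Icc 0 1) t :=
      fun t ht => hasDerivWithinAt_segment hC hz hx 0 (by omega) t ht
    have hbd : ∀ t ∈ Set.Icc (0 : ℝ) 1, ‖D 1 t‖ ≤ r * d * h := by
      intro t ht
      have hy : z + t • (x - z) ∈ Set.Icc (0 : Fin d → ℝ) 1 := convex_cube.add_smul_sub_mem hz hx ht
      simp only [hD, iteratedFDerivWithin_eq_sum_partialD]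
      rw [Real.norm_eq_abs]
      refine (Finset.abs_sum_le_sum_abs _ _).trans ?_
      calc _ ≤ ∑ _I : Fin 1 → Fin d, h * r := by
            refine Finset.sum_le_sum fun I _ => ?_
            rw [abs_mul]
            refine mul_le_mul ?_ ((h1 1 hk I _ hy).trans (by linarith)) (abs_nonneg _) hh.le
            simpa using H (I 0)
        _ = _ := by simp; ring
    have hmv := (convex_Icc (0 : ℝ) 1).norm_image_sub_le_of_norm_hasDerivWithin_le hder hbd
      (x := 0) (y := 1) ⟨le_rfl, zero_le_one⟩ ⟨zero_le_one, le_rfl⟩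
    have e0 : D 0 1 - D 0 0 = g x - g z := by simp [hD]
    rw [e0, Real.norm_eq_abs] at hmv
    simp only [sub_zero, norm_one, mul_one] at hmv
    refine hmv.trans ?_
    nlinarith [mul_nonneg hr hh.le]

end Cubes

/-- Networks approximating the functions of a Hölder ball at the optimal rate. -/
theorem holder_approx (s : ℕ) (hs : 1 ≤ s) (β r : ℝ) (hβ : 0 < β) : ∃ D C : ℕ, 1 ≤ D ∧ 1 ≤ C ∧
    ∃ C₀ : ℝ, 0 < C₀ ∧ ∀ (p : ℕ) (X : Type) (b : Fin s → X → ℝ), (∀ i x, 0 ≤ b i x) →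
    (∀ i x, b i x ≤ 1) → ∀ g ∈ HolderBall s β r, ∃ u : X → ℝ,
      Lay b (C * 2 ^ (p * s)) (D * (p + 1)) (C * (p + 1) * 2 ^ (p * s)) Unit (fun _ => u) ∧
      ∀ x, 0 ≤ u x ∧ u x ≤ 1 ∧
        |u x - clip01 (g fun i => b i x)| ≤ C₀ * ((1 / 2 : ℝ) ^ p) ^ β := by
  obtain ⟨ρ, hρ⟩ : ∃ ρ : ℕ, r ≤ 2 ^ ρ := by
    obtain ⟨n, hn⟩ := pow_unbounded_of_one_lt r (one_lt_two)
    exact ⟨n, hn.le⟩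
  obtain ⟨D, C, hD, hC, H⟩ := local_approx s (⌈β⌉₊ - 1) ρ ⌈β⌉₊
  refine ⟨D, C, hD, hC, |r| * s ^ ⌈β⌉₊ + 1, by positivity, ?_⟩
  intro p X b hb0 hb1 g hg
  have hgm : ∀ l : Fin s → Fin (2 ^ p + 1), gridPt l ∈ Set.Icc (0 : Fin s → ℝ) 1 := fun l =>
    ⟨fun i => gridPt_nonneg l i, fun i => gridPt_le_one l i⟩
  have hh : (0 : ℝ) < (1 / 2) ^ p := by positivity
  obtain ⟨u, hu, hux⟩ := H p X b hb0 hb1 (fun x => g fun i => b i x)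
    (r * s ^ ⌈β⌉₊ * ((1 / 2 : ℝ) ^ p) ^ β)
    (fun l j I => partialD g I (gridPt l) / ((j : ℕ).factorial : ℝ))
    (fun l j I => (holder_coeff_le hg (Nat.lt_succ_iff.1 j.2) I (hgm l)).trans hρ)
    (fun l x hx => holder_taylor hs hβ hg (hgm l) ⟨fun i => hb0 i x, fun i => hb1 i x⟩ hh
      (fun i => (hx i).trans (by rw [one_div_pow])))
  refine ⟨u, hu, fun x => ⟨(hux x).1, (hux x).2.1, (hux x).2.2.trans ?_⟩⟩
  have h1 : ((1 : ℝ) / 2) ^ (⌈β⌉₊ * p) ≤ ((1 / 2 : ℝ) ^ p) ^ β := by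
    rw [mul_comm, pow_mul, ← Real.rpow_natCast _ ⌈β⌉₊]
    exact Real.rpow_le_rpow_of_exponent_ge hh (pow_le_one₀ (by norm_num) (by norm_num))
      (Nat.le_ceil β)
  have h2 : r * s ^ ⌈β⌉₊ * ((1 / 2 : ℝ) ^ p) ^ β ≤ |r| * s ^ ⌈β⌉₊ * ((1 / 2 : ℝ) ^ p) ^ β := by
    have := le_abs_self r
    gcongr
  linarith

/-! ### Compositional functions -/

theorem Lay.reindex {X ι : Type} {b : ι → X → ℝ} {w L s : ℕ} {κ κ' : Type} {u : κ → X → ℝ}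
    (h : Lay b w (L + 1) s κ u) (e : κ' ≃ κ) : Lay b w (L + 1) s κ' (fun j => u (e j)) := by
  obtain ⟨s0, κ0, i0, i1, u0, W, v, h0, hW, hv, h1, hw, ht, rfl⟩ := h.succ_inv
  have i2 : Fintype κ' := Fintype.ofEquiv κ e.symm
  have hc : Fintype.card κ' = Fintype.card κ := Fintype.card_congr e
  refine .step h0 (fun j i => W (e j) i) (fun j => v (e j)) (fun _ _ => hW _ _) (fun _ => hv _)
    (by rwa [hc]) (by rwa [hc]) ?_
  rw [Equiv.sum_comp e (fun j => ∑ i, nz (W j i)), Equiv.sum_comp e (fun j => nz (v j))]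
  exact ht

theorem Lay.parallel_unit {X ι A : Type} [Fintype A] [Nonempty A] {b : ι → X → ℝ} {w L s : ℕ}
    {u : A → X → ℝ} (h : ∀ a, Lay b w (L + 1) s Unit (fun _ => u a)) :
    Lay b (Fintype.card A * w) (L + 1) (Fintype.card A * s) A u := by
  have := (Lay.parallel (κ := fun _ : A => Unit) h).reindex
    (κ' := A) ((Equiv.sigmaUnique A (fun _ => Unit)).symm)
  simpa using this

/-- The coordinate functions of the cube. -/
def coord {d : ℕ} (i : Fin d) (x : Cube d) : ℝ := (x i : ℝ)

theorem coord_nonneg {d : ℕ} (i : Fin d) (x : Cube d) : 0 ≤ coord i x := (x i).2.1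

theorem coord_le_one {d : ℕ} (i : Fin d) (x : Cube d) : coord i x ≤ 1 := (x i).2.2

theorem coord_mem_Icc {d s : ℕ} (e : Fin s → Fin d) (x : Cube d) :
    (fun i => coord (e i) x) ∈ Set.Icc (0 : Fin s → ℝ) 1 :=
  ⟨fun _ => coord_nonneg _ _, fun _ => coord_le_one _ _⟩

theorem cmp_coord {d : ℕ} (i : Fin d) : Cmp (coord (d := d)) 1 1 (coord i) := by
  classical
  convert Cmp.unit (b := coord (d := d)) (fun i' => if i' = i then 1 else 0) 0
    (fun i' => by split_ifs <;> simp) (by simp) using 2 with x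
  simp [coord_nonneg]

/-- Maxima of coordinates are computed exactly, through `max s t = max (t - s) 0 + s`. -/
theorem cmp_sup {d : ℕ} (I : Finset (Fin d)) (hI : I.Nonempty) :
    Cmp (coord (d := d)) (4 ^ I.card) (2 * I.card + 1) (fun x => I.sup' hI fun i => coord i x) := by
  classical
  induction hI using Finset.Nonempty.cons_induction with
  | singleton i =>
    simpa using ((cmp_coord i).pad 2).mono (show 1 ≤ 4 by norm_num)
  | cons i t hi ht ih =>
    rw [Finset.card_cons]
    have hw : 1 ≤ 4 ^ t.card := Nat.one_le_pow _ _ (by norm_num)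
    have h1 := ((cmp_coord i).pad (2 * t.card)).mono hw
    rw [show 0 + 1 + 2 * t.card = 2 * t.card + 1 by ring] at h1
    have h2 := ih.add2 h1 1 (-1) 0 (by simp) (by simp) (by simp)
    have h3 := ((h1.pad 1).mono (show 4 ^ t.card ≤ 2 * 4 ^ t.card by omega))
    have h4 := h2.add2 h3 1 1 0 (by simp) (by simp) (by simp)
    rw [show 2 * (t.card + 1) + 1 = 2 * t.card + 1 + 2 by ring,
      show 4 ^ (t.card + 1) = 2 * (2 * 4 ^ t.card) by rw [pow_succ]; ring]
    convert h4 using 2 with x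
    · rw [Finset.sup'_cons ht]
      have := coord_nonneg i x
      generalize (t.sup' ht fun i => coord i x) = m
      rcases le_total (coord i x) m with h | h
      · rw [max_eq_right h, max_eq_left (a := 1 * m + -1 * coord i x - 0) (by linarith),
          max_eq_left (by linarith)]; ring
      · rw [max_eq_left h, max_eq_right (a := 1 * m + -1 * coord i x - 0) (by linarith),
          max_eq_left (by linarith)]; ring

theorem sup_mem_unit {d : ℕ} (I : Finset (Fin d)) (hI : I.Nonempty) (x : Cube d) :
    0 ≤ I.sup' hI (fun i => coord i x) ∧ I.sup' hI (fun i => coord i x) ≤ 1 := by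
  refine ⟨?_, Finset.sup'_le _ _ fun i _ => coord_le_one i x⟩
  obtain ⟨i, hi⟩ := hI
  exact (coord_nonneg i x).trans (Finset.le_sup' (fun i => coord i x) hi)

theorem Lay.pad_to {X ι : Type} {b : ι → X → ℝ} {w L L' s : ℕ} {f : X → ℝ}
    (h : Lay b w (L + 1) s Unit (fun _ => f)) (hL : L + 1 ≤ L') :
    Lay b w L' (s + 2 * L') Unit (fun _ => f) := by
  have := h.pad (L' - (L + 1))
  rw [Nat.add_sub_cancel' hL] at this
  exact this.mono le_rfl (by omega)

/-- Approximation of the component functions of the compositional class. -/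
theorem component_approx (dmax s : ℕ) (hs : 1 ≤ s) (β r : ℝ) (hβ : 0 < β) :
    ∃ D : ℕ, 1 ≤ D ∧ ∃ C₀ : ℝ, 0 < C₀ ∧ ∀ d : ℕ, ∃ C : ℕ, 1 ≤ C ∧ ∀ p : ℕ,
      ∀ f ∈ GH d s β r ∪ GM d dmax, ∃ u : Cube d → ℝ,
        Lay (coord (d := d)) (C * 2 ^ (p * s)) (D * (p + 1)) (C * (p + 1) * 2 ^ (p * s)) Unit
          (fun _ => u) ∧
        ∀ x, 0 ≤ u x ∧ u x ≤ 1 ∧ |u x - clip01 (f x)| ≤ C₀ * ((1 / 2 : ℝ) ^ p) ^ β := by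
  classical
  obtain ⟨D, C, hD, hC, C₀, hC₀, H⟩ := holder_approx s hs β r hβ
  set D' := D + 2 * dmax + 2 with hD'
  refine ⟨D', by omega, C₀, hC₀, fun d => ?_⟩
  obtain ⟨w, hw0⟩ : ∃ w, w = 4 ^ dmax + d := ⟨_, rfl⟩
  refine ⟨C + s * (d + 1) + s + w + D' * (w * (w + 1) + 2), by omega, fun p f hf => ?_⟩
  set C' := C + s * (d + 1) + s + w + D' * (w * (w + 1) + 2) with hC'
  have h2 : 1 ≤ 2 ^ (p * s) := Nat.one_le_two_pow
  rcases hf with ⟨e, g, hg, hfg⟩ | ⟨I, hI, hcard, hfI⟩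
  · have hsel := (Lay.base (b := coord (d := d)) (w := s) 0).step_dense (κ' := Fin s)
      (fun j i => if i = e j then 1 else 0) (fun _ => 0) (fun j => coord (e j))
      (fun j i => by split_ifs <;> simp) (by simp) (by simpa using hs) (by simp) (by
        intro j x; simp [coord_nonneg])
    obtain ⟨u, hu, hux⟩ := H p (Cube d) (fun j => coord (e j)) (fun _ _ => coord_nonneg _ _)
      (fun _ _ => coord_le_one _ _) g hg
    have hw1 : s ≤ C' * 2 ^ (p * s) := le_trans (by omega) (Nat.le_mul_of_pos_right C' h2)
    have hw2 : C * 2 ^ (p * s) ≤ C' * 2 ^ (p * s) := Nat.mul_le_mul_right _ (by omega)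
    have hcomp := (hsel.mono hw1 le_rfl).comp (hu.mono hw2 le_rfl)
    rw [show 0 + 1 + D * (p + 1) = D * (p + 1) + 1 by ring] at hcomp
    have hpad := hcomp.pad_to (L' := D' * (p + 1)) (by rw [hD']; nlinarith)
    refine ⟨u, hpad.mono le_rfl ?_, fun x => ?_⟩
    · simp only [Fintype.card_fin, zero_add]
      have hm : 1 ≤ (p + 1) * 2 ^ (p * s) := Nat.mul_pos (by omega) h2
      have a1 : s * (d + 1) ≤ s * (d + 1) * ((p + 1) * 2 ^ (p * s)) :=
        Nat.le_mul_of_pos_right _ hm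
      have a2 : D' * (p + 1) ≤ D' * (p + 1) * 2 ^ (p * s) := Nat.le_mul_of_pos_right _ h2
      have a3 : C' * (p + 1) * 2 ^ (p * s) = s * (d + 1) * ((p + 1) * 2 ^ (p * s)) +
          C * (p + 1) * 2 ^ (p * s) + 2 * (D' * (p + 1) * 2 ^ (p * s)) +
          (s + w + D' * (w * (w + 1))) * ((p + 1) * 2 ^ (p * s)) := by rw [hC']; ring
      omega
    · have : f x = g (fun i => coord (e i) x) := hfg x
      rw [this]; exact hux x
  · obtain ⟨s', hcs⟩ := cmp_sup I hI
    have h4 : 4 ^ I.card ≤ w := (Nat.pow_le_pow_right (by norm_num) hcard).trans (by omega)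
    have hden := (hcs.mono h4 le_rfl).dense (by simp [hw0])
    have hL : 2 * I.card + 1 ≤ D' * (p + 1) := by
      rw [hD']; nlinarith
    have hpad := hden.pad_to (L' := D' * (p + 1)) hL
    refine ⟨_, hpad.mono ?_ ?_, fun x => ⟨(sup_mem_unit I hI x).1, (sup_mem_unit I hI x).2, ?_⟩⟩
    · exact le_trans (by omega) (Nat.le_mul_of_pos_right C' h2)
    · have a1 : (2 * I.card + 1) * (w * (w + 1)) ≤ D' * (p + 1) * (w * (w + 1)) :=
        Nat.mul_le_mul_right _ hL
      have a2 : D' * (p + 1) * (w * (w + 1)) + 2 * (D' * (p + 1)) ≤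
          (D' * (p + 1) * (w * (w + 1)) + 2 * (D' * (p + 1))) * 2 ^ (p * s) :=
        Nat.le_mul_of_pos_right _ h2
      have a3 : C' * (p + 1) * 2 ^ (p * s) =
          (D' * (p + 1) * (w * (w + 1)) + 2 * (D' * (p + 1))) * 2 ^ (p * s) +
          (C + s * (d + 1) + s + w) * (p + 1) * 2 ^ (p * s) := by rw [hC']; ring
      omega
    · have : f x = I.sup' hI fun i => coord i x := hfI x
      rw [this, clip01_of_mem (sup_mem_unit I hI x).1 (sup_mem_unit I hI x).2, sub_self, abs_zero]
      positivity

theorem component_modulus (d dmax s : ℕ) (β r : ℝ) (hβ : 0 < β) (hr : 0 < r) {f : Cube d → ℝ}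
    (hf : f ∈ GH d s β r ∪ GM d dmax) {h : ℝ} (hh : 0 < h) (hh1 : h ≤ 1) {x y : Cube d}
    (H : ∀ i, |(x i : ℝ) - y i| ≤ h) : |f x - f y| ≤ (r * (s + 1) + 1) * h ^ min 1 β := by
  have hm : 0 < min 1 β := lt_min one_pos hβ
  have hpos : 0 < h ^ min 1 β := Real.rpow_pos_of_pos hh _
  rcases hf with ⟨e, g, hg, hfg⟩ | ⟨I, hI, hcard, hfI⟩
  · rw [hfg, hfg]
    refine (holder_modulus hβ hg (coord_mem_Icc e x) (coord_mem_Icc e y) hh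
      (fun i => H (e i))).trans ?_
    nlinarith
  · have h1 : ∀ x y : Cube d, (∀ i, |(x i : ℝ) - y i| ≤ h) → f x ≤ f y + h := by
      intro x y H
      rw [hfI, hfI]
      refine Finset.sup'_le _ _ fun i hi => ?_
      have := Finset.le_sup' (fun i => (y i : ℝ)) hi
      have := (abs_le.1 (H i)).2
      linarith
    have h2 : |f x - f y| ≤ h := by
      rw [abs_le]
      constructor
      · linarith [h1 y x (fun i => by rw [abs_sub_comm]; exact H i)]
      · linarith [h1 x y H]
    have h3 : h ≤ h ^ min 1 β := by
      calc h = h ^ (1 : ℝ) := (Real.rpow_one h).symm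
        _ ≤ _ := Real.rpow_le_rpow_of_exponent_ge hh hh1 (min_le_left _ _)
    have : 0 ≤ r * (s + 1) := by positivity
    nlinarith

/-- The modulus of continuity of the members of the compositional class: each composition raises
the exponent by the factor `min 1 β`. -/
theorem chom_modulus (dmax s : ℕ) (β r : ℝ) (hβ : 0 < β) (hr : 0 < r) (q : ℕ) :
    ∃ C₁ : ℝ, 0 < C₁ ∧ ∀ (d K : ℕ) (f : Cube d → ℝ), f ∈ CHOM K dmax s β r q d →
      ∀ (h : ℝ), 0 < h → h ≤ 1 → ∀ x y : Cube d, (∀ i, |(x i : ℝ) - y i| ≤ h) →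
        |f x - f y| ≤ C₁ * h ^ (min 1 β) ^ (q + 1) := by
  have hm : 0 < min 1 β := lt_min one_pos hβ
  induction q with
  | zero =>
    refine ⟨r * (s + 1) + 1, by positivity, fun d K f hf h hh hh1 x y H => ?_⟩
    simpa using component_modulus d dmax s β r hβ hr hf hh hh1 H
  | succ q ih =>
    obtain ⟨C₁, hC₁, ih⟩ := ih
    set A := r * (s + 1) + 1 with hA
    have hA0 : 0 < A := by positivity
    refine ⟨C₁ * A ^ (min 1 β) ^ (q + 1), by positivity, fun d K f hf h hh hh1 x y H => ?_⟩
    obtain ⟨φ, hφ, g, hg, rfl⟩ := hf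
    have hpos : 0 < h ^ min 1 β := Real.rpow_pos_of_pos hh _
    have h1 : ∀ j, |(φ x j : ℝ) - φ y j| ≤ min 1 (A * h ^ min 1 β) := by
      intro j
      refine le_min ?_ (component_modulus d dmax s β r hβ hr (hφ j) hh hh1 H)
      rw [abs_le]
      constructor <;> linarith [(φ x j).2.1, (φ x j).2.2, (φ y j).2.1, (φ y j).2.2]
    have h2 := ih K K g hg _ (lt_min one_pos (by positivity)) (min_le_left _ _) _ _ h1
    refine h2.trans ?_
    rw [mul_assoc]
    refine mul_le_mul_of_nonneg_left ?_ hC₁.le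
    calc (min 1 (A * h ^ min 1 β)) ^ (min 1 β) ^ (q + 1)
        ≤ (A * h ^ min 1 β) ^ (min 1 β) ^ (q + 1) :=
          Real.rpow_le_rpow (by positivity) (min_le_right _ _) (by positivity)
      _ = A ^ (min 1 β) ^ (q + 1) * h ^ (min 1 β) ^ (q + 1 + 1) := by
          rw [Real.mul_rpow hA0.le hpos.le, ← Real.rpow_mul hh.le, ← pow_succ']

theorem effSmooth_pos {β : ℝ} (hβ : 0 < β) (q : ℕ) : 0 < effSmooth β q :=
  mul_pos hβ (pow_pos (lt_min one_pos hβ) q)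

theorem rpow_half_pow_anti {a b : ℝ} (hab : a ≤ b) (p : ℕ) :
    ((1 / 2 : ℝ) ^ p) ^ b ≤ ((1 / 2 : ℝ) ^ p) ^ a :=
  Real.rpow_le_rpow_of_exponent_ge (by positivity) (pow_le_one₀ (by norm_num) (by norm_num)) hab

/-- Network approximation of the members of the compositional class, by induction on the number of
compositions: the inner error is passed through the modulus of continuity of the outer function,
and the outer error is that of its own network. The outputs of the inner networks are
in `[0,1]`, so that they are admissible inputs. -/
theorem chom_approx (dmax s : ℕ) (hs : 1 ≤ s) (β r : ℝ) (hβ : 0 < β) (hr : 0 < r) (q : ℕ) :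
    ∃ D : ℕ, 1 ≤ D ∧ ∃ C₀ : ℝ, 0 < C₀ ∧ ∀ d K : ℕ, 1 ≤ K → ∃ C : ℕ, 1 ≤ C ∧ ∀ p : ℕ,
      ∀ f ∈ CHOM K dmax s β r q d, ∃ u : Cube d → ℝ,
        Lay (coord (d := d)) (C * 2 ^ (p * s)) (D * (p + 1)) (C * (p + 1) * 2 ^ (p * s)) Unit
          (fun _ => u) ∧
        ∀ x, 0 ≤ u x ∧ u x ≤ 1 ∧
          |u x - clip01 (f x)| ≤ C₀ * ((1 / 2 : ℝ) ^ p) ^ effSmooth β q := by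
  obtain ⟨D₁, hD₁, C₁, hC₁, H₁⟩ := component_approx dmax s hs β r hβ
  have hm : 0 < min 1 β := lt_min one_pos hβ
  induction q with
  | zero =>
    refine ⟨D₁, hD₁, C₁, hC₁, fun d K _ => ?_⟩
    obtain ⟨C, hC, H⟩ := H₁ d
    refine ⟨C, hC, fun p f hf => ?_⟩
    simpa [effSmooth] using H p f hf
  | succ q ih =>
    obtain ⟨D₂, hD₂, C₂, hC₂, H₂⟩ := ih
    obtain ⟨C₃, hC₃, Hmod⟩ := chom_modulus dmax s β r hβ hr q
    refine ⟨D₁ + D₂, by omega, C₂ + C₃ * C₁ ^ (min 1 β) ^ (q + 1), by positivity,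
      fun d K hK => ?_⟩
    obtain ⟨C₄, hC₄, H₁⟩ := H₁ d
    obtain ⟨C₅, hC₅, H₂⟩ := H₂ K K hK
    have hK4 : 1 ≤ K * C₄ := Nat.mul_pos hK hC₄
    refine ⟨K * C₄ + C₅, by omega, fun p f hf => ?_⟩
    obtain ⟨φ, hφ, g, hg, rfl⟩ := hf
    choose v hv hvx using fun j => H₁ p _ (hφ j)
    obtain ⟨u, hu, hux⟩ := H₂ p g hg
    have : Nonempty (Fin K) := ⟨⟨0, hK⟩⟩
    let ψ : Cube d → Cube K := fun x j => ⟨v j x, (hvx j x).1, (hvx j x).2.1⟩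
    obtain ⟨L, hL⟩ : ∃ L, D₁ * (p + 1) = L + 1 :=
      ⟨D₁ * (p + 1) - 1, (Nat.sub_add_cancel (Nat.mul_pos hD₁ (by omega))).symm⟩
    rw [hL] at hv
    have hpar := Lay.parallel_unit hv
    rw [← hL, Fintype.card_fin] at hpar
    have hcomp := Lay.comp (hpar.mono (w' := (K * C₄ + C₅) * 2 ^ (p * s)) (by
      calc K * (C₄ * 2 ^ (p * s)) = K * C₄ * 2 ^ (p * s) := by ring
        _ ≤ _ := Nat.mul_le_mul_right _ (by omega)) le_rfl)
      ((hu.precomp ψ).mono (w' := (K * C₄ + C₅) * 2 ^ (p * s))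
        (Nat.mul_le_mul_right _ (by omega)) le_rfl)
    refine ⟨fun x => u (ψ x), ?_, fun x => ⟨(hux _).1, (hux _).2.1, ?_⟩⟩
    · convert hcomp using 1
      · ring
      · ring
    · set h := (1 / 2 : ℝ) ^ p with hh
      have hh0 : 0 < h := by positivity
      have hhβ : 0 < h ^ β := Real.rpow_pos_of_pos hh0 _
      have h1 : ∀ j, |(ψ x j : ℝ) - φ x j| ≤ min 1 (C₁ * h ^ β) := by
        intro j
        refine le_min ?_ ?_
        · rw [abs_le]
          constructor <;> linarith [(φ x j).2.1, (φ x j).2.2, (ψ x j).2.1, (ψ x j).2.2]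
        · have := (hvx j x).2.2
          rwa [clip01_of_mem (φ x j).2.1 (φ x j).2.2] at this
      have h2 := Hmod K K g hg _ (lt_min one_pos (by positivity)) (min_le_left _ _) _ _ h1
      have h3 : (min 1 (C₁ * h ^ β)) ^ (min 1 β) ^ (q + 1) ≤
          C₁ ^ (min 1 β) ^ (q + 1) * h ^ effSmooth β (q + 1) := by
        calc (min 1 (C₁ * h ^ β)) ^ (min 1 β) ^ (q + 1)
            ≤ (C₁ * h ^ β) ^ (min 1 β) ^ (q + 1) :=
              Real.rpow_le_rpow (by positivity) (min_le_right _ _) (by positivity)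
          _ = _ := by
              rw [Real.mul_rpow hC₁.le hhβ.le, ← Real.rpow_mul hh0.le, effSmooth]
      have h4 : h ^ effSmooth β q ≤ h ^ effSmooth β (q + 1) := by
        refine rpow_half_pow_anti ?_ p
        unfold effSmooth
        refine mul_le_mul_of_nonneg_left ?_ hβ.le
        rw [pow_succ]
        exact mul_le_of_le_one_right (by positivity) (min_le_left _ _)
      have h5 := (abs_clip01_sub_le (g (ψ x)) (g (φ x))).trans
        (h2.trans (mul_le_mul_of_nonneg_left h3 hC₃.le))
      have h6 := (hux (ψ x)).2.2.trans (mul_le_mul_of_nonneg_left h4 hC₂.le)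
      calc |u (ψ x) - clip01 ((g ∘ φ) x)|
          ≤ |u (ψ x) - clip01 (g (ψ x))| + |clip01 (g (ψ x)) - clip01 (g (φ x))| :=
            abs_sub_le _ _ _
        _ ≤ _ := by rw [add_mul, mul_assoc]; exact add_le_add h6 h5

/-! ### The logit of a network output -/

/-- The function `w ↦ -log ((1 + w) / 2)`, which maps `[0,1]` to `[0, log 2]`. -/
def logPiece (w : ℝ) : ℝ := -Real.log ((1 + w) / 2)

theorem logPiece_mem {w : ℝ} (h0 : 0 ≤ w) (h1 : w ≤ 1) : 0 ≤ logPiece w ∧ logPiece w ≤ 1 := by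
  unfold logPiece
  have h2 := Real.log_nonpos (show 0 ≤ (1 + w) / 2 by linarith) (by linarith)
  have h3 := Real.log_le_log (show (0 : ℝ) < 1 / 2 by norm_num) (show 1 / 2 ≤ (1 + w) / 2 by linarith)
  rw [one_div, Real.log_inv] at h3
  have := Real.log_two_lt_d9
  constructor <;> linarith

/-- Taylor coefficients of `logPiece` at `a`. -/
def logCoeff (a : ℝ) (j : ℕ) : ℝ :=
  if j = 0 then logPiece a else (-1) ^ j / (j * (1 + a) ^ j)

theorem abs_logCoeff_le {a : ℝ} (h0 : 0 ≤ a) (h1 : a ≤ 1) (j : ℕ) : |logCoeff a j| ≤ 1 := by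
  unfold logCoeff
  split_ifs with hj
  · rw [abs_of_nonneg (logPiece_mem h0 h1).1]; exact (logPiece_mem h0 h1).2
  · rw [abs_div, abs_pow, abs_neg, abs_one, one_pow]
    have h2 : (1 : ℝ) ≤ j := by exact_mod_cast Nat.one_le_iff_ne_zero.2 hj
    have h3 : (1 : ℝ) ≤ (1 + a) ^ j := one_le_pow₀ (by linarith)
    have h4 : 1 ≤ (j : ℝ) * (1 + a) ^ j := by nlinarith
    rw [abs_of_pos (by linarith)]
    exact div_le_one_of_le₀ h4 (by linarith)

theorem logPiece_taylor (n : ℕ) {a w h : ℝ} (ha0 : 0 ≤ a) (hw0 : 0 ≤ w)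
    (hh : h ≤ 1 / 2) (H : |w - a| ≤ h) :
    |logPiece w - ∑ j ∈ Finset.range (n + 1), logCoeff a j * (w - a) ^ j| ≤ 2 * h ^ (n + 1) := by
  set y := -((w - a) / (1 + a)) with hy
  have h1a : 0 < 1 + a := by linarith
  have hyh : |y| ≤ h := by
    rw [hy, abs_neg, abs_div, abs_of_pos h1a]
    exact (div_le_self (abs_nonneg _) (by linarith)).trans H
  have h1y : 1 - y = (1 + w) / (1 + a) := by rw [hy]; field_simp; ring
  have e1 : logPiece w = logPiece a - Real.log (1 - y) := by
    have : (1 + w) / 2 = (1 + a) / 2 * (1 - y) := by rw [h1y]; field_simp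
    unfold logPiece
    rw [this, Real.log_mul (by positivity) (by rw [h1y]; positivity)]; ring
  have e2 : ∑ j ∈ Finset.range (n + 1), logCoeff a j * (w - a) ^ j =
      logPiece a + ∑ i ∈ Finset.range n, y ^ (i + 1) / (i + 1) := by
    rw [Finset.sum_range_succ', add_comm]
    congr 1
    · simp [logCoeff]
    · refine Finset.sum_congr rfl fun i _ => ?_
      have : y ^ (i + 1) = (-1) ^ (i + 1) * (w - a) ^ (i + 1) / (1 + a) ^ (i + 1) := by
        rw [hy, neg_pow, div_pow, mul_div_assoc]
      rw [this]
      simp only [logCoeff, Nat.succ_ne_zero, if_false]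
      push_cast
      field_simp
  have h2 := Real.abs_log_sub_add_sum_range_le (x := y) (by linarith) n
  rw [e1, e2]
  have e3 : logPiece a - Real.log (1 - y) -
      (logPiece a + ∑ i ∈ Finset.range n, y ^ (i + 1) / (i + 1)) =
      -((∑ i ∈ Finset.range n, y ^ (i + 1) / (i + 1)) + Real.log (1 - y)) := by ring
  rw [e3, abs_neg]
  refine h2.trans ?_
  rw [div_le_iff₀ (by linarith)]
  have h3 : |y| ^ (n + 1) ≤ h ^ (n + 1) := pow_le_pow_left₀ (abs_nonneg _) hyh _
  have h4 : 0 ≤ h ^ (n + 1) := (by positivity : 0 ≤ |y| ^ (n + 1)).trans h3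
  nlinarith

theorem logPiece_approx (n : ℕ) : ∃ D C : ℕ, 1 ≤ D ∧ 1 ≤ C ∧ ∀ p : ℕ, 1 ≤ p → ∀ (X : Type)
    (w : X → ℝ), (∀ x, 0 ≤ w x) → (∀ x, w x ≤ 1) → ∃ u : X → ℝ,
      Lay (fun _ : Fin 1 => w) (C * 2 ^ p) (D * (p + 1)) (C * (p + 1) * 2 ^ p) Unit (fun _ => u) ∧
      ∀ x, |u x - logPiece (w x)| ≤ 3 * ((1 / 2 : ℝ) ^ p) ^ (n + 1) := by
  obtain ⟨D, C, hD, hC, H⟩ := local_approx 1 n 0 (n + 1)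
  refine ⟨D, C, hD, hC, fun p hp X w hw0 hw1 => ?_⟩
  have hh : (1 / 2 : ℝ) ^ p ≤ 1 / 2 := by
    calc (1 / 2 : ℝ) ^ p ≤ (1 / 2) ^ 1 := pow_le_pow_of_le_one (by norm_num) (by norm_num) hp
      _ = _ := pow_one _
  obtain ⟨u, hu, hux⟩ := H p X (fun _ => w) (fun _ => hw0) (fun _ => hw1) (fun x => logPiece (w x))
    (2 * ((1 / 2 : ℝ) ^ p) ^ (n + 1)) (fun l j _ => logCoeff (gridPt l 0) j)
    (fun l j _ => by simpa using abs_logCoeff_le (gridPt_nonneg l 0) (gridPt_le_one l 0) j)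
    (fun l x hx => by
      have h1 := logPiece_taylor n (gridPt_nonneg l 0) (hw0 x) hh
        ((hx 0).trans (by rw [one_div_pow]))
      rw [← Fin.sum_univ_eq_sum_range (fun j => logCoeff (gridPt l 0) j * (w x - gridPt l 0) ^ j)] at h1
      convert h1 using 4 with j
      rw [Fintype.sum_unique]
      congr 1
      rw [Finset.prod_congr rfl (fun i _ => by
        rw [Fin.eq_zero ((default : Fin (j : ℕ) → Fin 1) i)])]
      simp)
  rw [mul_one] at hu
  refine ⟨u, hu, fun x => ?_⟩
  have h2 := (hux x).2.2
  rw [clip01_of_mem (logPiece_mem (hw0 x) (hw1 x)).1 (logPiece_mem (hw0 x) (hw1 x)).2,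
    mul_comm (n + 1) p, pow_mul] at h2
  linarith

/-- Extraction of the `j`-th dyadic scale of a number in `[0,1]`. -/
def dyadic (j : ℕ) (t : ℝ) : ℝ := clip01 (2 ^ (j + 1) * t - 1)

/-- On `[0,1]`, the logarithm truncated below at `2 ^ (-J)` is a sum over the dyadic scales. -/
theorem sum_logPiece_dyadic (J : ℕ) {t : ℝ} (h1 : t ≤ 1) :
    ∑ j ∈ Finset.range J, logPiece (dyadic j t) = -Real.log (max t ((1 / 2) ^ J)) := by
  induction J with
  | zero => simp [h1]
  | succ J ih =>
    rw [Finset.sum_range_succ, ih]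
    have hJ : (0 : ℝ) < (1 / 2) ^ J := by positivity
    have hinv : (2 : ℝ) ^ (J + 1) * (1 / 2) ^ J = 2 := by
      rw [pow_succ, mul_right_comm, ← mul_pow]; norm_num
    have h2J : (0 : ℝ) < 2 ^ (J + 1) := by positivity
    rw [pow_succ (1 / 2 : ℝ) J]
    unfold logPiece dyadic clip01
    rcases le_total ((1 / 2) ^ J) t with h | h
    · have : 2 ≤ 2 ^ (J + 1) * t := by
        calc (2 : ℝ) = 2 ^ (J + 1) * (1 / 2) ^ J := hinv.symm
          _ ≤ _ := mul_le_mul_of_nonneg_left h h2J.le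
      have h3 : (1 / 2) ^ J * (1 / 2) ≤ t := by linarith
      rw [max_eq_left h, max_eq_left h3, min_eq_right (by linarith),
        max_eq_left (zero_le_one (α := ℝ))]
      norm_num
    · have h2 : 2 ^ (J + 1) * t ≤ 2 := by
        calc 2 ^ (J + 1) * t ≤ 2 ^ (J + 1) * (1 / 2) ^ J := mul_le_mul_of_nonneg_left h h2J.le
          _ = 2 := hinv
      rw [max_eq_right h, min_eq_left (by linarith)]
      rcases le_total ((1 / 2) ^ J * (1 / 2)) t with h' | h'
      · have h3 : 1 ≤ 2 ^ (J + 1) * t := by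
          have := mul_le_mul_of_nonneg_left h' h2J.le
          nlinarith
        have ht : 0 < t := lt_of_lt_of_le (by positivity) h'
        rw [max_eq_left h', max_eq_left (by linarith)]
        have e : t = (1 + (2 ^ (J + 1) * t - 1)) / 2 * (1 / 2) ^ J := by
          have : (1 + (2 ^ (J + 1) * t - 1)) / 2 * (1 / 2) ^ J =
            (2 ^ (J + 1) * (1 / 2) ^ J) * t / 2 := by ring
          rw [this, hinv]; ring
        conv_rhs => rw [e]
        rw [Real.log_mul (by positivity) hJ.ne']; ring
      · have h3 : 2 ^ (J + 1) * t ≤ 1 := by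
          have := mul_le_mul_of_nonneg_left h' h2J.le
          nlinarith
        rw [max_eq_right h', max_eq_right (by linarith), Real.log_mul hJ.ne' (by norm_num)]
        norm_num
        ring

theorem Lay.dyadic {X : Type} {f : X → ℝ} (hf : ∀ x, 0 ≤ f x) (j : ℕ) :
    ∃ s, Lay (fun _ : Unit => f) 2 (j + 6) s Unit (fun _ x => dyadic j (f x)) := by
  obtain ⟨s1, h1⟩ := Lay.scale hf (j + 1)
  have h2 := h1.step_dense (κ' := Unit) (fun _ _ => 1) (fun _ => 1)
    (fun _ x => max (2 ^ (j + 1) * f x - 1) 0) (by simp) (by simp) (by simp) (by simp) (by simp)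
  obtain ⟨s3, h3⟩ := Lay.clip (fun x => max (2 ^ (j + 1) * f x - 1) 0)
  have h4 := h2.comp h3
  simp only [clip01_max_zero] at h4
  exact ⟨_, h4⟩

/-- The logit of `t` with both logarithms truncated at `-J log 2`. -/
def truncLogit (J : ℕ) (t : ℝ) : ℝ :=
  Real.log (max t ((1 / 2) ^ J)) - Real.log (max (1 - t) ((1 / 2) ^ J))

/-- A network for the truncated logit of a function with values in `[0,1]`: each dyadic scale of
each of the two logarithms is an approximation of `logPiece`, and all of them run in parallel. -/
theorem truncLogit_approx (n : ℕ) : ∃ D C : ℕ, 1 ≤ D ∧ 1 ≤ C ∧ ∀ p J : ℕ, 1 ≤ p → 1 ≤ J →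
    ∀ (X : Type) (u : X → ℝ), (∀ x, 0 ≤ u x) → (∀ x, u x ≤ 1) → ∃ v : Bool × Fin J → X → ℝ,
      Lay (fun _ : Unit => u) (2 * J * (C * 2 ^ p)) (D * (p + J))
        (2 * J * (C * (J + (p + 1) * 2 ^ p))) (Bool × Fin J) v ∧
      ∀ x, |∑ a, (if a.1 then -1 else 1) * v a x - truncLogit J (u x)| ≤
        6 * J * ((1 / 2 : ℝ) ^ p) ^ (n + 1) := by
  obtain ⟨D, C, hD, hC, H⟩ := logPiece_approx n
  refine ⟨2 * D + 10, C + 60 + 2 * (2 * D + 10), by omega, by omega,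
    fun p J hp hJ X u hu0 hu1 => ?_⟩
  let t : Bool → X → ℝ := fun σ x => if σ then u x else 1 - u x
  have ht0 : ∀ σ x, 0 ≤ t σ x := by
    rintro (_ | _) x
    · simpa [t] using hu1 x
    · simpa [t] using hu0 x
  have ht1 : ∀ σ x, t σ x ≤ 1 := by
    rintro (_ | _) x
    · simpa [t] using hu0 x
    · simpa [t] using hu1 x
  have key : ∀ a : Bool × Fin J, ∃ v : X → ℝ,
      Lay (fun _ : Unit => u) ((C + 60) * 2 ^ p) (J + 7 + D * (p + 1))
        ((C + 60) * (J + (p + 1) * 2 ^ p)) Unit (fun _ => v) ∧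
        ∀ x, |v x - logPiece (LogisticDNN.dyadic a.2 (t a.1 x))| ≤ 3 * ((1 / 2 : ℝ) ^ p) ^ (n + 1) := by
    rintro ⟨σ, j⟩
    have h1 := (Lay.base (b := fun _ : Unit => u) (w := 2) 0).step_dense (κ' := Unit)
      (fun _ _ => if σ then 1 else -1) (fun _ => if σ then 0 else -1) (fun _ => t σ)
      (by cases σ <;> simp) (by cases σ <;> simp) (by simp) (by simp) (by
        intro _ x
        have := ht0 σ x
        cases σ
        · simp only [t] at this ⊢
          simp at this
          simp [this]; ring
        · simp only [t] at this ⊢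
          simp at this
          simp [this])
    obtain ⟨s2, h2⟩ := Lay.dyadic (ht0 σ) j
    have h3 := (h1.comp h2).dense (by simp)
    rw [show 0 + 1 + ((j : ℕ) + 6) = (j + 6) + 1 by ring] at h3
    have h4 := h3.pad_to (L' := J + 7) (by have := j.2; omega)
    have h5 := h4.reindex (L := J + 6) (Equiv.ofUnique (Fin 1) Unit)
    obtain ⟨v, hv, hvx⟩ := H p hp X (fun x => LogisticDNN.dyadic j (t σ x)) (fun x => clip01_nonneg _)
      (fun x => clip01_le_one _)
    have h2p : 1 ≤ 2 ^ p := Nat.one_le_two_pow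
    have h6 := (h5.mono (w' := (C + 60) * 2 ^ p) (by nlinarith) le_rfl).comp
      (hv.mono (w' := (C + 60) * 2 ^ p) (Nat.mul_le_mul_right _ (by omega)) le_rfl)
    refine ⟨v, h6.mono le_rfl ?_, hvx⟩
    have hj := j.2
    have hCJ : J ≤ C * J := Nat.le_mul_of_pos_left _ hC
    have hp1 : 1 ≤ (p + 1) * 2 ^ p := Nat.mul_pos (by omega) h2p
    nlinarith
  choose v hv hvx using key
  have hne : Nonempty (Bool × Fin J) := ⟨⟨true, ⟨0, hJ⟩⟩⟩
  rw [show J + 7 + D * (p + 1) = (J + 6 + D * (p + 1)) + 1 by ring] at hv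
  obtain ⟨L, hL⟩ : ∃ L, (2 * D + 10) * (p + J) = L + 1 :=
    ⟨(2 * D + 10) * (p + J) - 1,
      (Nat.sub_add_cancel (Nat.mul_pos (by omega) (by omega))).symm⟩
  have hv' := fun a => (hv a).pad_to (L' := L + 1) (by
    rw [← hL]; nlinarith [Nat.mul_le_mul_left D hp, Nat.zero_le (D * J)])
  have hpar := Lay.parallel_unit hv'
  have hcard : Fintype.card (Bool × Fin J) = 2 * J := by simp
  rw [hcard, ← hL] at hpar
  refine ⟨v, hpar.mono ?_ ?_, fun x => ?_⟩
  · exact Nat.mul_le_mul_left _ (Nat.mul_le_mul_right _ (by omega))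
  · refine Nat.mul_le_mul_left _ ?_
    have h2p : 1 ≤ 2 ^ p := Nat.one_le_two_pow
    have h3 : p + J ≤ J + (p + 1) * 2 ^ p := by nlinarith
    have h4 := Nat.mul_le_mul_left (2 * (2 * D + 10)) h3
    calc (C + 60) * (J + (p + 1) * 2 ^ p) + 2 * ((2 * D + 10) * (p + J))
        = (C + 60) * (J + (p + 1) * 2 ^ p) + 2 * (2 * D + 10) * (p + J) := by ring
      _ ≤ (C + 60) * (J + (p + 1) * 2 ^ p) + 2 * (2 * D + 10) * (J + (p + 1) * 2 ^ p) := by omega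
      _ = _ := by ring
  · have hsum : ∑ a : Bool × Fin J, (if a.1 then -1 else 1) *
        logPiece (LogisticDNN.dyadic a.2 (t a.1 x)) = truncLogit J (u x) := by
      rw [Fintype.sum_prod_type, Fintype.sum_bool]
      simp only [if_true, Bool.false_eq_true, if_false, t, ← Finset.mul_sum]
      rw [Fin.sum_univ_eq_sum_range (fun j => logPiece (LogisticDNN.dyadic j (u x))),
        Fin.sum_univ_eq_sum_range (fun j => logPiece (LogisticDNN.dyadic j (1 - u x))),
        sum_logPiece_dyadic J (hu1 x), sum_logPiece_dyadic J (by linarith [hu0 x]), truncLogit]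
      ring
    rw [← hsum, ← Finset.sum_sub_distrib]
    refine (Finset.abs_sum_le_sum_abs _ _).trans ?_
    calc _ ≤ ∑ _a : Bool × Fin J, 3 * ((1 / 2 : ℝ) ^ p) ^ (n + 1) := by
          refine Finset.sum_le_sum fun a _ => ?_
          rw [← mul_sub, abs_mul]
          have : |if a.1 = true then (-1 : ℝ) else 1| = 1 := by split_ifs <;> simp
          rw [this, one_mul]
          exact hvx a x
      _ = _ := by
          rw [Finset.sum_const, Finset.card_univ, hcard, nsmul_eq_mul]
          push_cast; ring

/-- Networks for the truncated logits of the members of the compositional class. The truncation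
level `2 ^ (-J)` is of the order of the approximation error. -/
theorem chom_logit_approx (dmax s : ℕ) (hs : 1 ≤ s) (β r : ℝ) (hβ : 0 < β) (hr : 0 < r) (q : ℕ) :
    ∃ D : ℕ, ∀ d K : ℕ, 1 ≤ K → ∃ C : ℕ, ∃ C₀ : ℝ, 0 < C₀ ∧ ∀ p : ℕ, 2 ≤ p →
      ∀ f ∈ CHOM K dmax s β r q d, ∃ (T : Net d) (u : Cube d → ℝ),
        T.depth ≤ D * (p + 1) ∧ T.WidthLE (C * 2 ^ (p * s) : ℕ) ∧
        T.nonzeros ≤ C * (p + 1) * 2 ^ (p * s) ∧ T.ParamsLE 1 ∧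
        ∀ x, 0 ≤ u x ∧ u x ≤ 1 ∧
          |u x - clip01 (f x)| ≤ C₀ * ((1 / 2 : ℝ) ^ p) ^ effSmooth β q ∧
          |T.eval (toVec x) - truncLogit (⌊p * effSmooth β q⌋₊ + 1) (u x)| ≤
            C₀ * ((1 / 2 : ℝ) ^ p) ^ effSmooth β q := by
  have hb := effSmooth_pos hβ q
  set bq := effSmooth β q with hbq
  set B := ⌈bq⌉₊ + 1 with hB
  obtain ⟨D₁, hD₁, C₁, hC₁, H₁⟩ := chom_approx dmax s hs β r hβ hr q
  obtain ⟨D₂, C₂, hD₂, hC₂, H₂⟩ := truncLogit_approx (2 * B - 1)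
  refine ⟨D₁ + D₂ * (1 + B), fun d K hK => ?_⟩
  obtain ⟨C₃, hC₃, H₁⟩ := H₁ d K hK
  refine ⟨C₃ + 8 * B * C₂ + 4 * B * B * C₂ + 2 * B, C₁ + 6 * B * 2 ^ B, by positivity, fun p hp f hf => ?_⟩
  set C := C₃ + 8 * B * C₂ + 4 * B * B * C₂ + 2 * B with hC
  obtain ⟨u, hu, hux⟩ := H₁ p f hf
  set J := ⌊p * bq⌋₊ + 1 with hJ
  have hJB : J ≤ B * (p + 1) := by
    have : ⌊p * bq⌋₊ ≤ p * ⌈bq⌉₊ := by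
      have h1 : (p : ℝ) * bq ≤ ((p * ⌈bq⌉₊ : ℕ) : ℝ) := by
        push_cast
        exact mul_le_mul_of_nonneg_left (Nat.le_ceil _) (Nat.cast_nonneg _)
      exact (Nat.floor_le_floor h1).trans (Nat.floor_natCast _).le
    rw [hJ, hB]; nlinarith
  have hp2 : p + 1 ≤ 2 * 2 ^ (p / 2) := by
    have : p / 2 + 1 ≤ 2 ^ (p / 2) := Nat.lt_two_pow_self
    omega
  have hpp : 2 ^ (p / 2) * 2 ^ (p / 2) ≤ 2 ^ (p * s) := by
    rw [← pow_add]
    exact Nat.pow_le_pow_right (by norm_num) (by nlinarith [Nat.div_mul_le_self p 2])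
  have hp1 : p + 1 ≤ 2 ^ (p * s) :=
    (Nat.lt_two_pow_self (n := p)).trans_le (Nat.pow_le_pow_right (by norm_num) (by nlinarith))
  obtain ⟨v, hv, hvx⟩ := H₂ (p / 2) J (by omega) (by omega) (Cube d) u (fun x => (hux x).1)
    (fun x => (hux x).2.1)
  have hJ2 : J * 2 ^ (p / 2) ≤ 2 * B * 2 ^ (p * s) := by
    calc J * 2 ^ (p / 2) ≤ B * (2 * 2 ^ (p / 2)) * 2 ^ (p / 2) :=
          Nat.mul_le_mul_right _ (hJB.trans (Nat.mul_le_mul_left _ hp2))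
      _ = 2 * B * (2 ^ (p / 2) * 2 ^ (p / 2)) := by ring
      _ ≤ _ := Nat.mul_le_mul_left _ hpp
  have hwid : 2 * J * (C₂ * 2 ^ (p / 2)) ≤ C * 2 ^ (p * s) := by
    calc 2 * J * (C₂ * 2 ^ (p / 2)) = 2 * C₂ * (J * 2 ^ (p / 2)) := by ring
      _ ≤ 2 * C₂ * (2 * B * 2 ^ (p * s)) := Nat.mul_le_mul_left _ hJ2
      _ = (4 * B * C₂) * 2 ^ (p * s) := by ring
      _ ≤ _ := Nat.mul_le_mul_right _ (by rw [hC]; nlinarith [Nat.zero_le (B * C₂), Nat.zero_le (B * B * C₂)])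
  have hcomp := (hu.mono (w' := C * 2 ^ (p * s)) (Nat.mul_le_mul_right _ (by omega)) le_rfl).comp
    (hv.mono hwid le_rfl)
  obtain ⟨T, hT, hTd, hTw, hTn, hTp⟩ := hcomp.toNet (fun a => if a.1 then -1 else 1)
    (by rintro ⟨_ | _, _⟩ <;> simp)
  refine ⟨T, u, ?_, hTw, hTn.trans ?_, hTp, fun x => ⟨(hux x).1, (hux x).2.1, ?_, ?_⟩⟩
  · rw [hTd]
    have h1 : p / 2 + J ≤ (1 + B) * (p + 1) := by
      have := Nat.div_le_self p 2
      rw [add_mul]; omega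
    have h2 := Nat.mul_le_mul_left D₂ h1
    calc D₁ * (p + 1) + D₂ * (p / 2 + J) ≤ D₁ * (p + 1) + D₂ * ((1 + B) * (p + 1)) := by omega
      _ = _ := by ring
  · have hcard : Fintype.card (Bool × Fin J) = 2 * J := by simp
    rw [hcard]
    have h1 : 2 * J * (C₂ * J) ≤ 2 * B * B * C₂ * ((p + 1) * 2 ^ (p * s)) := by
      calc 2 * J * (C₂ * J) = 2 * C₂ * (J * J) := by ring
        _ ≤ 2 * C₂ * ((B * (p + 1)) * (B * 2 ^ (p * s))) := by
          refine Nat.mul_le_mul_left _ (Nat.mul_le_mul hJB (hJB.trans ?_))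
          exact Nat.mul_le_mul_left _ hp1
        _ = _ := by ring
    have h2 : 2 * J * (C₂ * ((p / 2 + 1) * 2 ^ (p / 2))) ≤ 4 * B * C₂ * ((p + 1) * 2 ^ (p * s)) := by
      have h3 : p / 2 + 1 ≤ p + 1 := by omega
      calc 2 * J * (C₂ * ((p / 2 + 1) * 2 ^ (p / 2)))
          = 2 * C₂ * ((p / 2 + 1) * (J * 2 ^ (p / 2))) := by ring
        _ ≤ 2 * C₂ * ((p + 1) * (2 * B * 2 ^ (p * s))) :=
          Nat.mul_le_mul_left _ (Nat.mul_le_mul h3 hJ2)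
        _ = _ := by ring
    have h4 : 2 * J ≤ 2 * B * ((p + 1) * 2 ^ (p * s)) := by
      have : p + 1 ≤ (p + 1) * 2 ^ (p * s) := Nat.le_mul_of_pos_right _ (by positivity)
      calc 2 * J ≤ 2 * (B * (p + 1)) := Nat.mul_le_mul_left _ hJB
        _ = 2 * B * (p + 1) := by ring
        _ ≤ _ := Nat.mul_le_mul_left _ this
    have h5 : C * (p + 1) * 2 ^ (p * s) = C₃ * (p + 1) * 2 ^ (p * s) +
        (4 * B * C₂ * ((p + 1) * 2 ^ (p * s)) + 4 * B * C₂ * ((p + 1) * 2 ^ (p * s))) +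
        (2 * B * B * C₂ * ((p + 1) * 2 ^ (p * s)) + 2 * B * B * C₂ * ((p + 1) * 2 ^ (p * s))) +
        2 * B * ((p + 1) * 2 ^ (p * s)) := by rw [hC]; ring
    have h6 : 2 * J * (C₂ * (J + (p / 2 + 1) * 2 ^ (p / 2))) =
        2 * J * (C₂ * J) + 2 * J * (C₂ * ((p / 2 + 1) * 2 ^ (p / 2))) := by ring
    omega
  · refine (hux x).2.2.trans (mul_le_mul_of_nonneg_right ?_ (by positivity))
    have : (0 : ℝ) ≤ 6 * B * 2 ^ B := by positivity
    linarith
  · have e : T.eval (toVec x) = ∑ a : Bool × Fin J, (if a.1 then -1 else 1) * v a x := hT x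
    rw [e]
    refine (hvx x).trans ?_
    have h1 : 2 * B - 1 + 1 = 2 * B := by omega
    -- the accuracy `2 ^ (-(p / 2) * 2 B)` leaves a factor `2 ^ (-p)` to absorb `J`
    have h2 : ((1 / 2 : ℝ) ^ (p / 2)) ^ (2 * B) ≤ 2 ^ B * (1 / 2) ^ (p * B) := by
      have h3 : p * B ≤ B + p / 2 * (2 * B) := by
        have : p ≤ 1 + p / 2 * 2 := by omega
        calc p * B ≤ (1 + p / 2 * 2) * B := Nat.mul_le_mul_right _ this
          _ = _ := by ring
      calc ((1 / 2 : ℝ) ^ (p / 2)) ^ (2 * B) = 2 ^ B * (1 / 2) ^ (B + p / 2 * (2 * B)) := by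
            rw [← pow_mul, pow_add (1 / 2 : ℝ) B, ← mul_assoc ((2 : ℝ) ^ B), ← mul_pow (2 : ℝ)]
            norm_num
        _ ≤ _ := mul_le_mul_of_nonneg_left
            (pow_le_pow_of_le_one (by norm_num) (by norm_num) h3) (by positivity)
    have h4 : ((1 / 2 : ℝ) ^ (p * B)) ≤ (1 / 2) ^ p * ((1 / 2 : ℝ) ^ p) ^ bq := by
      have h5 : (1 / 2 : ℝ) ^ (p * B) = (1 / 2) ^ p * ((1 / 2 : ℝ) ^ p) ^ (⌈bq⌉₊ : ℝ) := by
        rw [Real.rpow_natCast, ← pow_mul, ← pow_add, hB]; ring_nf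
      rw [h5]
      exact mul_le_mul_of_nonneg_left (rpow_half_pow_anti (Nat.le_ceil bq) p) (by positivity)
    have h6 : (J : ℝ) * (1 / 2) ^ p ≤ B := by
      have h7 : J ≤ B * 2 ^ p :=
        hJB.trans (Nat.mul_le_mul_left _ (Nat.lt_two_pow_self (n := p)))
      have h8 : (J : ℝ) ≤ B * 2 ^ p := by exact_mod_cast h7
      calc (J : ℝ) * (1 / 2) ^ p ≤ B * 2 ^ p * (1 / 2) ^ p :=
            mul_le_mul_of_nonneg_right h8 (by positivity)
        _ = B := by rw [mul_assoc, ← mul_pow]; norm_num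
    rw [h1]
    have h0 : 0 ≤ ((1 / 2 : ℝ) ^ p) ^ bq := by positivity
    calc 6 * (J : ℝ) * ((1 / 2 : ℝ) ^ (p / 2)) ^ (2 * B)
        ≤ 6 * J * (2 ^ B * ((1 / 2) ^ p * ((1 / 2 : ℝ) ^ p) ^ bq)) := by
          refine mul_le_mul_of_nonneg_left (h2.trans ?_) (by positivity)
          exact mul_le_mul_of_nonneg_left h4 (by positivity)
      _ = 6 * 2 ^ B * ((1 / 2 : ℝ) ^ p) ^ bq * (J * (1 / 2) ^ p) := by ring
      _ ≤ 6 * 2 ^ B * ((1 / 2 : ℝ) ^ p) ^ bq * B := mul_le_mul_of_nonneg_left h6 (by positivity)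
      _ ≤ _ := by nlinarith [mul_nonneg hC₁.le h0]

/-! ### Covering numbers of network classes -/

/-- Integer functions bounded by `g` with at most `s` nonzero values are sums of `s` functions
supported at one point. -/
theorem exists_sparse_code {α : Type} [Fintype α] [DecidableEq α] [Nonempty α] (g s : ℕ)
    (Z : α → ℤ) (hZ : ∀ a, |Z a| ≤ g) (hs : (Finset.univ.filter fun a => Z a ≠ 0).card ≤ s) :
    ∃ θ : Fin s → α × Fin (2 * g + 1),
      ∀ a, Z a = ∑ t, if (θ t).1 = a then (((θ t).2 : ℕ) : ℤ) - g else 0 := by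
  induction s generalizing Z with
  | zero =>
    refine ⟨fun t => t.elim0, fun a => ?_⟩
    by_contra h
    have : a ∈ Finset.univ.filter fun a => Z a ≠ 0 := by simpa using h
    have := Finset.card_pos.2 ⟨a, this⟩
    omega
  | succ s ih =>
    by_cases h0 : ∃ a, Z a ≠ 0
    · obtain ⟨a, ha⟩ := h0
      obtain ⟨θ, hθ⟩ := ih (Function.update Z a 0) (fun b => by
        rcases eq_or_ne b a with rfl | h
        · simp
        · rw [Function.update_of_ne h]; exact hZ b) (by
        have : (Finset.univ.filter fun b => Function.update Z a 0 b ≠ 0) =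
            (Finset.univ.filter fun b => Z b ≠ 0).erase a := by
          ext b
          rcases eq_or_ne b a with rfl | h
          · simp
          · simp [h]
        rw [this, Finset.card_erase_of_mem (by simpa using ha)]
        omega)
      have hb := abs_le.1 (hZ a)
      refine ⟨Fin.cons (a, ⟨(Z a + g).toNat, by omega⟩) θ, fun b => ?_⟩
      rw [Fin.sum_univ_succ]
      simp only [Fin.cons_zero, Fin.cons_succ]
      rw [← hθ b]
      rcases eq_or_ne b a with rfl | h
      · simp; omega
      · simp [h, h.symm]
    · push Not at h0
      obtain ⟨θ, hθ⟩ := ih Z hZ (by simp [h0])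
      refine ⟨Fin.cons (Classical.arbitrary α, ⟨g, by omega⟩) θ, fun b => ?_⟩
      rw [Fin.sum_univ_succ]
      simp only [Fin.cons_zero, Fin.cons_succ]
      rw [← hθ b]; simp

/-- A finite family of functions which contains, up to an error of `h` at each point, all the
functions bounded by `B` with at most `s` nonzero values. -/
theorem sparse_cover {α : Type} [Fintype α] [Nonempty α] (s g : ℕ) {B h : ℝ} (hh : 0 < h)
    (hg : B / h + 1 ≤ g) : ∃ (Θ : Type) (_ : Fintype Θ) (dec : Θ → α → ℝ),
      Fintype.card Θ = (Fintype.card α * (2 * g + 1)) ^ s ∧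
      ∀ W : α → ℝ, (∀ a, |W a| ≤ B) → ∑ a, nz (W a) ≤ s → ∃ θ, ∀ a, |W a - dec θ a| ≤ h := by
  classical
  refine ⟨Fin s → α × Fin (2 * g + 1), inferInstance,
    fun θ a => h * ((∑ t, if (θ t).1 = a then (((θ t).2 : ℕ) : ℤ) - g else 0 : ℤ) : ℝ),
    by simp, fun W hW hs => ?_⟩
  obtain ⟨θ, hθ⟩ := exists_sparse_code g s (fun a => round (W a / h)) (fun a => by
    have h1 := abs_sub_round (W a / h)
    have h2 : |W a / h| ≤ B / h := by
      rw [abs_div, abs_of_pos hh]; exact div_le_div_of_nonneg_right (hW a) hh.le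
    have h3 : |(round (W a / h) : ℝ)| ≤ g := by
      have := abs_sub_abs_le_abs_sub (round (W a / h) : ℝ) (W a / h)
      rw [abs_sub_comm] at this
      linarith
    exact_mod_cast h3) (by
    refine le_trans ?_ hs
    rw [Finset.card_eq_sum_ones, Finset.sum_filter]
    refine Finset.sum_le_sum fun a _ => ?_
    by_cases h0 : W a = 0
    · simp [h0]
    · simp only [nz, h0, if_false]; split_ifs <;> simp)
  refine ⟨θ, fun a => ?_⟩
  beta_reduce
  rw [← hθ a]
  have h1 := abs_sub_round (W a / h)
  have e : W a - h * (round (W a / h) : ℝ) = h * (W a / h - round (W a / h)) := by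
    field_simp
  rw [e, abs_mul, abs_of_pos hh]
  nlinarith

theorem abs_mulVec_sub_le {m : ℕ} {D B h ρ R : ℝ} (hmD : (m : ℝ) ≤ D) (hB : 1 ≤ B)
    (hh : 0 < h) (hh1 : h ≤ 1) (hρ : 0 ≤ ρ) (hR : 1 ≤ R) {w w' x x' : Fin m → ℝ}
    (hw : ∀ j, |w j| ≤ B) (hww : ∀ j, |w j - w' j| ≤ h) (hx : ∀ j, |x j| ≤ R)
    (hxx : ∀ j, |x j - x' j| ≤ ρ) :
    |∑ j, w j * x j - ∑ j, w' j * x' j| ≤ 2 * D * B * ρ + D * h * R := by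
  rw [← Finset.sum_sub_distrib]
  refine (Finset.abs_sum_le_sum_abs _ _).trans ?_
  calc ∑ j, |w j * x j - w' j * x' j| ≤ ∑ _j : Fin m, (2 * B * ρ + h * R) := by
        refine Finset.sum_le_sum fun j _ => ?_
        have e : w j * x j - w' j * x' j = w' j * (x j - x' j) + (w j - w' j) * x j := by ring
        have h1 : |w' j| ≤ 2 * B := by
          have := abs_sub_abs_le_abs_sub (w' j) (w j)
          rw [abs_sub_comm] at this
          linarith [hw j, hww j]
        rw [e]
        refine (abs_add_le _ _).trans ?_
        rw [abs_mul, abs_mul]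
        exact add_le_add (mul_le_mul h1 (hxx j) (abs_nonneg _) (by linarith))
          (mul_le_mul (hww j) (hx j) (abs_nonneg _) hh.le)
    _ = m * (2 * B * ρ + h * R) := by
        rw [Finset.sum_const, Finset.card_univ, Fintype.card_fin, nsmul_eq_mul]
    _ ≤ D * (2 * B * ρ + h * R) := mul_le_mul_of_nonneg_right hmD (by positivity)
    _ = _ := by ring

theorem abs_mulVec_le {m : ℕ} {D B R : ℝ} (hmD : (m : ℝ) ≤ D) (hB : 1 ≤ B) (hR : 1 ≤ R)
    {w x : Fin m → ℝ} (hw : ∀ j, |w j| ≤ B) (hx : ∀ j, |x j| ≤ R) :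
    |∑ j, w j * x j| ≤ D * B * R := by
  refine (Finset.abs_sum_le_sum_abs _ _).trans ?_
  calc ∑ j, |w j * x j| ≤ ∑ _j : Fin m, B * R := by
        refine Finset.sum_le_sum fun j _ => ?_
        rw [abs_mul]
        exact mul_le_mul (hw j) (hx j) (abs_nonneg _) (by linarith)
    _ = m * (B * R) := by simp
    _ ≤ D * (B * R) := mul_le_mul_of_nonneg_right hmD (by positivity)
    _ = _ := by ring

/-- Rounding all parameters of a network to multiples of `h` gives a finite family; the error
grows at most geometrically with the depth. The numbers of nonzero parameters of the
layers are bounded separately, which costs a factor of the depth in the exponent. -/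
theorem net_cover (D s g : ℕ) (hD : 1 ≤ D) {B h N : ℝ} (hB : 1 ≤ B) (hN : N ≤ D) (hh : 0 < h)
    (hh1 : h ≤ 1) (hg : B / h + 1 ≤ g) (L : ℕ) : ∀ m : ℕ, 1 ≤ m → m ≤ D →
    ∃ (Θ : Type) (_ : Fintype Θ) (dec : Θ → (Fin m → ℝ) → ℝ),
      Fintype.card Θ ≤ ((D + 1) * ((D * D * (2 * g + 1)) ^ s * (D * D * (2 * g + 1)) ^ s)) ^ (L + 1) ∧
      ∀ T : Net m, T.depth ≤ L → T.WidthLE N → T.nonzeros ≤ s → T.ParamsLE B →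
        ∃ θ, ∀ (x x' : Fin m → ℝ) (ρ R : ℝ), 0 ≤ ρ → 1 ≤ R → (∀ i, |x i| ≤ R) →
          (∀ i, |x i - x' i| ≤ ρ) →
          |T.eval x - dec θ x'| ≤ (2 * D * B) ^ (L + 1) * (ρ + (L + 1) * h * R) := by
  set Q := (D * D * (2 * g + 1)) ^ s with hQ
  have hQ1 : 1 ≤ Q := Nat.one_le_pow _ _ (Nat.mul_pos (Nat.mul_pos hD hD) (by omega))
  have hD' : (1 : ℝ) ≤ D := by exact_mod_cast hD
  have hκ : 1 ≤ 2 * (D : ℝ) * B := by nlinarith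
  have hDκ : (D : ℝ) + 1 ≤ 2 * D * B := by nlinarith
  -- networks without hidden layer
  have hout : ∀ (L m : ℕ), 1 ≤ m → m ≤ D → ∃ (Θ : Type) (_ : Fintype Θ)
      (dec : Θ → (Fin m → ℝ) → ℝ), Fintype.card Θ ≤ Q ∧
      ∀ W : Matrix (Fin 1) (Fin m) ℝ, (Net.out W).nonzeros ≤ s → (Net.out W).ParamsLE B →
        ∃ θ, ∀ (x x' : Fin m → ℝ) (ρ R : ℝ), 0 ≤ ρ → 1 ≤ R → (∀ i, |x i| ≤ R) →
          (∀ i, |x i - x' i| ≤ ρ) →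
          |(Net.out W).eval x - dec θ x'| ≤ (2 * D * B) ^ (L + 1) * (ρ + (L + 1) * h * R) := by
    intro L m hm hmD
    have : Nonempty (Fin m) := ⟨⟨0, hm⟩⟩
    obtain ⟨Θ, i1, dec, hc, H⟩ := sparse_cover (α := Fin m) s g hh hg
    refine ⟨Θ, i1, fun θ x => ∑ j, dec θ j * x j, ?_, ?_⟩
    · rw [hc, Fintype.card_fin]
      exact Nat.pow_le_pow_left (Nat.mul_le_mul_right _ (by nlinarith)) _
    · intro W hn hp
      have hn' : ∑ j, nz (W 0 j) ≤ s := by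
        simp only [Net.nonzeros] at hn
        rw [ncard_eq_sum_nz (fun i j => W i j), Fintype.sum_unique] at hn
        exact hn
      obtain ⟨θ, hθ⟩ := H (fun j => W 0 j) (fun j => hp 0 j) hn'
      refine ⟨θ, fun x x' ρ R hρ hR hx hxx => ?_⟩
      have h1 := abs_mulVec_sub_le (D := D) (by exact_mod_cast hmD) hB hh hh1 hρ hR
        (fun j => hp 0 j) hθ hx hxx
      have h2 : 2 * D * B * ρ + D * h * R ≤ 2 * D * B * (ρ + (L + 1) * h * R) := by
        have h3 : (D : ℝ) * (h * R) ≤ 2 * D * B * ((L + 1) * (h * R)) := by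
          have : (1 : ℝ) ≤ L + 1 := by linarith [(Nat.cast_nonneg L : (0 : ℝ) ≤ L)]
          have h4 : h * R ≤ (L + 1) * (h * R) := le_mul_of_one_le_left (by positivity) this
          exact mul_le_mul (by linarith) h4 (by positivity) (by linarith)
        nlinarith
      have h5 : 2 * D * B * (ρ + (L + 1) * h * R) ≤
          (2 * D * B) ^ (L + 1) * (ρ + (L + 1) * h * R) := by
        refine mul_le_mul_of_nonneg_right ?_ (by positivity)
        exact le_self_pow₀ hκ (by omega)
      have e : (Net.out W).eval x = ∑ j, W 0 j * x j := rfl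
      rw [e]
      exact h1.trans (h2.trans h5)
  induction L with
  | zero =>
    intro m hm hmD
    obtain ⟨Θ, i1, dec, hc, H⟩ := hout 0 m hm hmD
    refine ⟨Θ, i1, dec, hc.trans ?_, ?_⟩
    · rw [zero_add, pow_one]; nlinarith
    · intro T hd hw hn hp
      cases T with
      | out W => exact H W hn hp
      | hidden W v T => simp [Net.depth] at hd
  | succ L ih =>
    intro m hm hmD
    obtain ⟨Θ₀, i0, dec₀, hc₀, H₀⟩ := hout (L + 1) m hm hmD
    have hne : Nonempty (Fin m) := ⟨⟨0, hm⟩⟩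
    choose Θ₁ i1 dec₁ hc₁ H₁ using fun k : Fin D => sparse_cover (α := Fin (k + 1) × Fin m) s g hh hg
    choose Θ₂ i2 dec₂ hc₂ H₂ using fun k : Fin D => sparse_cover (α := Fin (k + 1)) s g hh hg
    choose Θ₃ i3 dec₃ hc₃ H₃ using fun k : Fin D => ih (k + 1) (by omega) k.2
    refine ⟨Θ₀ ⊕ (Σ k : Fin D, Θ₁ k × Θ₂ k × Θ₃ k), inferInstance,
      Sum.elim dec₀ fun θ x => dec₃ θ.1 θ.2.2.2 fun i =>
        max (∑ j, dec₁ θ.1 θ.2.1 (i, j) * x j - dec₂ θ.1 θ.2.2.1 i) 0, ?_, ?_⟩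
    · rw [Fintype.card_sum, Fintype.card_sigma]
      set P := ((D + 1) * (Q * Q)) ^ (L + 1) with hP
      have hP1 : 1 ≤ P := Nat.one_le_pow _ _ (Nat.mul_pos (by omega) (Nat.mul_pos hQ1 hQ1))
      have hk : ∀ k : Fin D, Fintype.card (Θ₁ k × Θ₂ k × Θ₃ k) ≤ Q * (Q * P) := by
        intro k
        have hkD : (k : ℕ) + 1 ≤ D := k.2
        rw [Fintype.card_prod, Fintype.card_prod]
        refine Nat.mul_le_mul ?_ (Nat.mul_le_mul ?_ (hc₃ k))
        · rw [hc₁, Fintype.card_prod, Fintype.card_fin, Fintype.card_fin]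
          exact Nat.pow_le_pow_left (Nat.mul_le_mul_right _ (Nat.mul_le_mul hkD hmD)) _
        · rw [hc₂, Fintype.card_fin]
          exact Nat.pow_le_pow_left (Nat.mul_le_mul_right _ (by nlinarith)) _
      have hsum : ∑ k : Fin D, Fintype.card (Θ₁ k × Θ₂ k × Θ₃ k) ≤ D * (Q * (Q * P)) := by
        calc _ ≤ ∑ _k : Fin D, Q * (Q * P) := Finset.sum_le_sum fun k _ => hk k
          _ = _ := by simp
      calc Fintype.card Θ₀ + ∑ k : Fin D, Fintype.card (Θ₁ k × Θ₂ k × Θ₃ k)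
          ≤ Q * (Q * P) + D * (Q * (Q * P)) :=
            Nat.add_le_add (hc₀.trans (Nat.le_mul_of_pos_right _ (Nat.mul_pos hQ1 hP1))) hsum
        _ = (D + 1) * (Q * Q) * P := by ring
        _ = _ := by rw [hP, ← pow_succ']
    · intro T hd hw hn hp
      cases T with
      | out W =>
        obtain ⟨θ, hθ⟩ := H₀ W hn hp
        exact ⟨Sum.inl θ, hθ⟩
      | @hidden _ m' W v T =>
        obtain ⟨hm1, hmN, hwT⟩ := hw
        obtain ⟨hpW, hpv, hpT⟩ := hp
        have hm'D : m' ≤ D := by exact_mod_cast hmN.trans hN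
        obtain ⟨k, rfl⟩ : ∃ k, m' = k + 1 := ⟨m' - 1, by omega⟩
        simp only [Net.nonzeros] at hn
        rw [ncard_eq_sum_nz (fun i j => W i j), ncard_eq_sum_nz'] at hn
        simp only [Net.depth] at hd
        have hnW : ∑ i, ∑ j, nz (W i j) ≤ s := by omega
        have hnv : ∑ i, nz (v i) ≤ s := by omega
        let k' : Fin D := ⟨k, by omega⟩
        obtain ⟨θ₁, hθ₁⟩ := H₁ k' (fun p => W p.1 p.2) (fun p => hpW _ _) (by
          rw [Fintype.sum_prod_type]; exact hnW)
        obtain ⟨θ₂, hθ₂⟩ := H₂ k' v hpv hnv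
        obtain ⟨θ₃, hθ₃⟩ := H₃ k' T (by omega) hwT (by omega) hpT
        refine ⟨Sum.inr ⟨k', θ₁, θ₂, θ₃⟩, fun x x' ρ R hρ hR hx hxx => ?_⟩
        have h1 : ∀ i, |∑ j, W i j * x j - ∑ j, dec₁ k' θ₁ (i, j) * x' j| ≤
            2 * D * B * ρ + D * h * R := fun i =>
          abs_mulVec_sub_le (D := D) (by exact_mod_cast hmD) hB hh hh1 hρ hR (hpW i)
            (fun j => hθ₁ (i, j)) hx hxx
        have h2 : ∀ i, |∑ j, W i j * x j| ≤ D * B * R := fun i =>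
          abs_mulVec_le (D := D) (by exact_mod_cast hmD) hB hR (hpW i) hx
        have hhR : h ≤ h * R := le_mul_of_one_le_right hh.le hR
        have h3 := hθ₃ (fun i => max (W.mulVec x i - v i) 0)
          (fun i => max (∑ j, dec₁ k' θ₁ (i, j) * x' j - dec₂ k' θ₂ i) 0)
          (2 * D * B * ρ + 2 * D * B * (h * R)) (2 * D * B * R) (by positivity) (by nlinarith)
          (fun i => by
            have e : W.mulVec x i = ∑ j, W i j * x j := rfl
            have h4 := abs_le.1 (h2 i)
            have h5 := abs_le.1 (hpv i)
            have h6 : B ≤ D * B * R := by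
              calc B = 1 * B * 1 := by ring
                _ ≤ D * B * R := by gcongr
            rw [e, abs_le]
            constructor
            · have := le_max_right (∑ j, W i j * x j - v i) 0
              have : 0 ≤ 2 * D * B * R := by positivity
              linarith
            · refine max_le ?_ (by positivity)
              linarith)
          (fun i => by
            have e : W.mulVec x i = ∑ j, W i j * x j := rfl
            rw [e]
            refine (abs_max_sub_max_le_abs _ _ _).trans ?_
            have h4 := h1 i
            have h5 := hθ₂ i
            have e2 : ∑ j, W i j * x j - v i - (∑ j, dec₁ k' θ₁ (i, j) * x' j - dec₂ k' θ₂ i) =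
              (∑ j, W i j * x j - ∑ j, dec₁ k' θ₁ (i, j) * x' j) + -(v i - dec₂ k' θ₂ i) := by ring
            rw [e2]
            refine (abs_add_le _ _).trans ?_
            rw [abs_neg]
            have h6 := mul_le_mul_of_nonneg_right hDκ (show 0 ≤ h * R by positivity)
            nlinarith)
        have e3 : (2 * D * B) ^ (L + 1) * (2 * D * B * ρ + 2 * D * B * (h * R) +
            (L + 1) * h * (2 * D * B * R)) =
            (2 * D * B) ^ (L + 1 + 1) * (ρ + (((L + 1 : ℕ) : ℝ) + 1) * h * R) := by
          push_cast; ring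
        rw [e3] at h3
        exact h3

/-- The network class has, inside itself, a finite uniform `δ`-net on the cube whose logarithmic
cardinality is of the order of depth times sparsity times `log (1 / δ)` plus depth. -/
theorem FNN_cover (d D s L : ℕ) (hd : 1 ≤ d) (hdD : d ≤ D) {G N S B F δ : ℝ} (hG : G < L + 1)
    (hN : N ≤ D) (hS : S < s + 1) (hB : 1 ≤ B) (hδ : 0 < δ) (hδ1 : δ ≤ 1) :
    ∃ (ι : Type) (_ : Fintype ι) (f : ι → (Fin d → ℝ) → ℝ), (∀ i, f i ∈ FNN d G N S B F) ∧
      (∀ φ ∈ FNN d G N S B F, ∃ i, ∀ x : Cube d, |φ (toVec x) - f i (toVec x)| ≤ δ) ∧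
      Real.log (Fintype.card ι) ≤ (L + 1) * (Real.log (D + 1) +
        2 * s * Real.log (14 * D * D * B * (L + 1) * (2 * D * B) ^ (L + 1) / δ)) := by
  classical
  have hD : 1 ≤ D := hd.trans hdD
  have hD' : (1 : ℝ) ≤ D := by exact_mod_cast hD
  have hκ : 1 ≤ 2 * (D : ℝ) * B := by nlinarith
  have hκL : 1 ≤ (2 * (D : ℝ) * B) ^ (L + 1) := one_le_pow₀ hκ
  have hL1 : (1 : ℝ) ≤ L + 1 := by linarith [(Nat.cast_nonneg L : (0 : ℝ) ≤ L)]
  set A := 2 * ((L : ℝ) + 1) * (2 * D * B) ^ (L + 1) with hA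
  have hA1 : 1 ≤ A := by nlinarith
  set h := δ / A with hhdef
  have hh : 0 < h := by positivity
  have hh1 : h ≤ 1 := (div_le_one (by linarith)).2 (by linarith)
  set g := ⌈B / h⌉₊ + 1 with hg
  have hgle : B / h + 1 ≤ g := by
    rw [hg]; push_cast; linarith [Nat.le_ceil (B / h)]
  obtain ⟨Θ, iΘ, dec, hcard, H⟩ := net_cover D s g hD hB hN hh hh1 hgle L d hd hdD
  have hcov : ∀ φ ∈ FNN d G N S B F, ∃ θ, ∀ x : Cube d, |φ (toVec x) - dec θ (toVec x)| ≤ δ / 2 := by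
    rintro φ ⟨⟨T, rfl, hTd, hTw, hTn, hTp⟩, -⟩
    have h1 : T.depth ≤ L := by
      have : (T.depth : ℝ) < L + 1 := lt_of_le_of_lt hTd hG
      exact Nat.lt_succ_iff.1 (by exact_mod_cast this)
    have h2 : T.nonzeros ≤ s := by
      have : (T.nonzeros : ℝ) < s + 1 := lt_of_le_of_lt hTn hS
      exact Nat.lt_succ_iff.1 (by exact_mod_cast this)
    obtain ⟨θ, hθ⟩ := H T h1 hTw h2 hTp
    refine ⟨θ, fun x => ?_⟩
    have h3 := hθ (toVec x) (toVec x) 0 1 le_rfl le_rfl (fun i => by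
      rw [toVec, abs_of_nonneg (x i).2.1]; exact (x i).2.2) (fun i => by simp)
    refine h3.trans (le_of_eq ?_)
    have : A ≠ 0 := by positivity
    rw [hhdef, hA]
    field_simp
    ring
  let ι := {θ : Θ // ∃ φ ∈ FNN d G N S B F, ∀ x : Cube d, |φ (toVec x) - dec θ (toVec x)| ≤ δ / 2}
  choose f hf hfx using fun i : ι => i.2
  refine ⟨ι, inferInstance, f, hf, fun φ hφ => ?_, ?_⟩
  · obtain ⟨θ, hθ⟩ := hcov φ hφ
    refine ⟨⟨θ, φ, hφ, hθ⟩, fun x => ?_⟩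
    have h1 := hθ x
    have h2 := hfx ⟨θ, φ, hφ, hθ⟩ x
    rw [abs_sub_comm] at h2
    have := abs_sub_le (φ (toVec x)) (dec θ (toVec x)) (f ⟨θ, φ, hφ, hθ⟩ (toVec x))
    linarith
  · have hBh : 1 ≤ B / h := by
      rw [le_div_iff₀ hh]; linarith
    have hg7 : (2 * g + 1 : ℝ) ≤ 7 * (B / h) := by
      have := Nat.ceil_lt_add_one (show 0 ≤ B / h by linarith)
      rw [hg]; push_cast; linarith
    have hE : 7 * (D * D * (B / h)) = 14 * D * D * B * (L + 1) * (2 * D * B) ^ (L + 1) / δ := by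
      rw [hhdef, hA]; field_simp; ring
    set E := 14 * D * D * B * (L + 1) * (2 * D * B) ^ (L + 1) / δ with hEdef
    have hE1 : 1 ≤ E := by
      rw [← hE]
      nlinarith [mul_le_mul hD' hD' zero_le_one (by linarith)]
    have hnum : (D * D * (2 * g + 1) : ℝ) ≤ E := by
      rw [← hE]
      calc (D * D * (2 * g + 1) : ℝ) ≤ D * D * (7 * (B / h)) := by gcongr
        _ = _ := by ring
    have hc : (Fintype.card ι : ℝ) ≤ ((D + 1) * (E ^ s * E ^ s)) ^ (L + 1) := by
      have h1 : Fintype.card ι ≤ Fintype.card Θ := Fintype.card_subtype_le _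
      calc (Fintype.card ι : ℝ) ≤ (((D + 1) * ((D * D * (2 * g + 1)) ^ s *
            (D * D * (2 * g + 1)) ^ s)) ^ (L + 1) : ℕ) := by exact_mod_cast h1.trans hcard
        _ ≤ _ := by push_cast; gcongr
    have hlogE : 0 ≤ Real.log E := Real.log_nonneg hE1
    have hlogD : 0 ≤ Real.log ((D : ℝ) + 1) := Real.log_nonneg (by linarith)
    rcases Nat.eq_zero_or_pos (Fintype.card ι) with h0 | h0
    · rw [h0, Nat.cast_zero, Real.log_zero]; positivity
    · refine (Real.log_le_log (by exact_mod_cast h0) hc).trans (le_of_eq ?_)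
      rw [Real.log_pow, Real.log_mul (by positivity) (by positivity),
        Real.log_mul (by positivity) (by positivity), Real.log_pow]
      push_cast; ring

/-! ### The pointwise excess risk of the logistic loss -/

/-- The excess of the conditional logistic risk at a point where the label `1` has probability `η`
and the prediction is `t`. It is the Kullback–Leibler divergence from the Bernoulli law
with parameter `1 / (1 + exp (-t))` to that with parameter `η`; the convention
`0 * log 0 = 0` holds for `Real.log`. -/
def bernKL (η t : ℝ) : ℝ :=
  η * logisticLoss t + (1 - η) * logisticLoss (-t) + (η * Real.log η + (1 - η) * Real.log (1 - η))

theorem logisticLoss_nonneg (t : ℝ) : 0 ≤ logisticLoss t :=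
  Real.log_nonneg (by linarith [Real.exp_pos (-t)])

theorem exp_neg_logisticLoss (t : ℝ) : Real.exp (-logisticLoss t) = 1 / (1 + Real.exp (-t)) := by
  rw [logisticLoss, Real.exp_neg, Real.exp_log (by positivity), one_div]

theorem exp_neg_logisticLoss_add (t : ℝ) :
    Real.exp (-logisticLoss t) + Real.exp (-logisticLoss (-t)) = 1 := by
  rw [exp_neg_logisticLoss, exp_neg_logisticLoss, neg_neg, Real.exp_neg]
  have := Real.exp_pos t
  field_simp
  ring

theorem logisticLoss_le_add {a b e : ℝ} (h : |a - b| ≤ e) :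
    logisticLoss a ≤ logisticLoss b + e := by
  have he : 0 ≤ e := (abs_nonneg _).trans h
  have h1 : -a ≤ -b + e := by linarith [(abs_le.mp h).1]
  have h2 : Real.exp (-a) ≤ Real.exp (-b) * Real.exp e := by
    rw [← Real.exp_add]; exact Real.exp_le_exp.mpr h1
  have h3 : 1 ≤ Real.exp e := Real.one_le_exp he
  have h4 : 1 + Real.exp (-a) ≤ (1 + Real.exp (-b)) * Real.exp e := by nlinarith
  calc logisticLoss a ≤ Real.log ((1 + Real.exp (-b)) * Real.exp e) :=
        Real.log_le_log (by positivity) h4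
    _ = logisticLoss b + e := by
        rw [Real.log_mul (by positivity) (by positivity), Real.log_exp, logisticLoss]

theorem logisticLoss_le_of_abs_le {t F : ℝ} (h : |t| ≤ F) : logisticLoss t ≤ F + 1 := by
  have h1 : logisticLoss t ≤ logisticLoss 0 + F := logisticLoss_le_add (by simpa using h)
  have h2 : logisticLoss 0 ≤ 1 := by
    have := Real.log_le_sub_one_of_pos (x := 2) (by norm_num)
    simp only [logisticLoss, neg_zero, Real.exp_zero]
    norm_num at this ⊢
    exact this
  linarith

theorem continuous_logisticLoss : Continuous logisticLoss := by
  unfold logisticLoss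
  exact Continuous.log (by fun_prop) fun x => by positivity

/-- A Hellinger lower bound for one summand of the Kullback–Leibler divergence. -/
theorem sub_add_sq_sqrt_le {p u : ℝ} (hp : 0 ≤ p) :
    p - Real.exp (-u) + (Real.sqrt p - Real.sqrt (Real.exp (-u))) ^ 2 ≤ p * u + p * Real.log p := by
  rcases hp.eq_or_lt with rfl | hp
  · simp [Real.sq_sqrt (Real.exp_pos (-u)).le]
  · have hq := Real.exp_pos (-u)
    have hs : 0 < Real.sqrt (Real.exp (-u)) / Real.sqrt p := by positivity
    have h1 := Real.log_le_sub_one_of_pos hs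
    rw [Real.log_div (by positivity) (by positivity), Real.log_sqrt hq.le, Real.log_sqrt hp.le,
      Real.log_exp] at h1
    have h2 : p * (Real.sqrt (Real.exp (-u)) / Real.sqrt p) =
        Real.sqrt p * Real.sqrt (Real.exp (-u)) := by
      have : 0 < Real.sqrt p := by positivity
      field_simp
      rw [Real.sq_sqrt hp.le]
    have h3 := mul_le_mul_of_nonneg_left h1 hp.le
    nlinarith [Real.sq_sqrt hp.le, Real.sq_sqrt hq.le]

/-- A weak form of Pinsker's inequality. -/
theorem sq_sub_le_bernKL {η : ℝ} (h0 : 0 ≤ η) (h1 : η ≤ 1) (t : ℝ) :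
    (η - Real.exp (-logisticLoss t)) ^ 2 / 2 ≤ bernKL η t := by
  have key : ∀ p q : ℝ, 0 ≤ p → p ≤ 1 → 0 ≤ q → q ≤ 1 →
      (p - q) ^ 2 / 4 ≤ (Real.sqrt p - Real.sqrt q) ^ 2 := by
    intro p q hp hp1 hq hq1
    have e : (p - q) ^ 2 = (Real.sqrt p - Real.sqrt q) ^ 2 * (Real.sqrt p + Real.sqrt q) ^ 2 := by
      rw [← mul_pow]
      congr 1
      nlinarith [Real.sq_sqrt hp, Real.sq_sqrt hq]
    have h2 : (Real.sqrt p + Real.sqrt q) ^ 2 ≤ 4 := by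
      nlinarith [Real.sqrt_le_one.mpr hp1, Real.sqrt_le_one.mpr hq1, Real.sqrt_nonneg p,
        Real.sqrt_nonneg q]
    nlinarith [sq_nonneg (Real.sqrt p - Real.sqrt q)]
  have hs := exp_neg_logisticLoss_add t
  have hp1 := Real.exp_pos (-logisticLoss t)
  have hp2 := Real.exp_pos (-logisticLoss (-t))
  have a1 := sub_add_sq_sqrt_le (u := logisticLoss t) h0
  have a2 := sub_add_sq_sqrt_le (u := logisticLoss (-t)) (sub_nonneg.mpr h1)
  have b1 := key _ _ h0 h1 hp1.le (by linarith)
  have b2 := key _ _ (sub_nonneg.mpr h1) (by linarith) hp2.le (by linarith)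
  have e2 : 1 - η - Real.exp (-logisticLoss (-t)) = -(η - Real.exp (-logisticLoss t)) := by linarith
  rw [e2, neg_sq] at b2
  unfold bernKL
  linarith

theorem bernKL_nonneg {η : ℝ} (h0 : 0 ≤ η) (h1 : η ≤ 1) (t : ℝ) : 0 ≤ bernKL η t :=
  (by positivity : (0 : ℝ) ≤ _).trans (sq_sub_le_bernKL h0 h1 t)

theorem bernKL_le_add {η a b e : ℝ} (h0 : 0 ≤ η) (h1 : η ≤ 1) (h : |a - b| ≤ e) :
    bernKL η a ≤ bernKL η b + e := by
  have h2 := mul_le_mul_of_nonneg_left (logisticLoss_le_add h) h0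
  have h3 : |-a - -b| ≤ e := by rwa [neg_sub_neg, abs_sub_comm]
  have h4 := mul_le_mul_of_nonneg_left (logisticLoss_le_add h3) (sub_nonneg.mpr h1)
  unfold bernKL
  linarith

/-- A prediction of the wrong sign costs `|1 - 2η|` in misclassification probability; the
divergence is then at least `(1 - 2η)² / 8`. -/
theorem abs_le_of_wrong_sign {η t a : ℝ} (h0 : 0 ≤ η) (h1 : η ≤ 1) (ha : 0 < a)
    (h : (0 ≤ t ∧ η ≤ 1 / 2) ∨ (t < 0 ∧ 1 / 2 ≤ η)) : |1 - 2 * η| ≤ 2 * a + bernKL η t / a := by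
  have h2 := sq_sub_le_bernKL h0 h1 t
  have h3 : (1 - 2 * η) ^ 2 / 8 ≤ bernKL η t := by
    refine le_trans ?_ h2
    rw [exp_neg_logisticLoss]
    rcases h with ⟨ht, hη⟩ | ⟨ht, hη⟩
    · have h4 : Real.exp (-t) ≤ 1 := Real.exp_le_one_iff.mpr (by linarith)
      have h5 : 1 / 2 ≤ 1 / (1 + Real.exp (-t)) :=
        one_div_le_one_div_of_le (by positivity) (by linarith)
      nlinarith
    · have h4 : 1 ≤ Real.exp (-t) := Real.one_le_exp (by linarith)
      have h5 : 1 / (1 + Real.exp (-t)) ≤ 1 / 2 :=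
        one_div_le_one_div_of_le (by positivity) (by linarith)
      nlinarith
  rw [← sub_le_iff_le_add', le_div_iff₀ ha]
  rw [← sq_abs] at h3
  nlinarith [sq_nonneg (|1 - 2 * η| - 4 * a)]

/-- The regression functions `truncLogit J u` of a probability `u` close to `η`: the
truncation at level `2⁻ᴶ` costs `2⁻ᴶ`, and the error `e` of `u` costs `e + e² 2ᴶ` for each label. -/
theorem bernKL_truncLogit_le {η u e : ℝ} {J : ℕ} (h0 : 0 ≤ η) (h1 : η ≤ 1) (hu0 : 0 ≤ u)
    (hu1 : u ≤ 1) (he : |u - η| ≤ e) :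
    bernKL η (truncLogit J u) ≤ (1 / 2) ^ J + 2 * (e + e ^ 2 / (1 / 2) ^ J) := by
  have hτ : (0 : ℝ) < (1 / 2) ^ J := by positivity
  have hτ1 : (1 / 2 : ℝ) ^ J ≤ 1 := pow_le_one₀ (by norm_num) (by norm_num)
  unfold truncLogit bernKL
  set τ : ℝ := (1 / 2) ^ J
  set A := max u τ
  set B := max (1 - u) τ
  have hA : 0 < A := lt_of_lt_of_le hτ (le_max_right _ _)
  have hB : 0 < B := lt_of_lt_of_le hτ (le_max_right _ _)
  have loss : ∀ a b : ℝ, 0 < a → 0 < b →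
      logisticLoss (Real.log a - Real.log b) = Real.log (a + b) - Real.log a := by
    intro a b ha hb
    rw [logisticLoss, neg_sub, Real.exp_sub, Real.exp_log ha, Real.exp_log hb,
      ← Real.log_div (by positivity) (by positivity)]
    congr 1
    field_simp
  have summand : ∀ p a v : ℝ, 0 ≤ p → v ≤ a → τ ≤ a → |v - p| ≤ e →
      p * Real.log p - p * Real.log a ≤ e + e ^ 2 / τ := by
    intro p a v hp hva hτa hvp
    have ha : 0 < a := lt_of_lt_of_le hτ hτa
    have he0 : 0 ≤ e := (abs_nonneg _).trans hvp
    rcases hp.eq_or_lt with rfl | hp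
    · simp; positivity
    have h2 := Real.log_le_sub_one_of_pos (div_pos hp ha)
    rw [Real.log_div hp.ne' ha.ne'] at h2
    have h3 := (abs_le.mp hvp).1
    have h4 : p / a - 1 ≤ e / a := by
      rw [div_sub_one ha.ne']
      gcongr
      linarith
    have h5 : p * (e / a) ≤ (a + e) * (e / a) := by gcongr; linarith
    have h6 : (a + e) * (e / a) = e + e ^ 2 / a := by field_simp
    have h7 : e ^ 2 / a ≤ e ^ 2 / τ := by gcongr
    have h8 := mul_le_mul_of_nonneg_left (h2.trans h4) hp.le
    linarith
  have s1 := summand η A u h0 (le_max_left _ _) (le_max_right _ _) he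
  have s2 := summand (1 - η) B (1 - u) (by linarith) (le_max_left _ _) (le_max_right _ _)
    (by rwa [sub_sub_sub_cancel_left, abs_sub_comm])
  have hsum : A + B ≤ 1 + τ := by
    rcases max_cases u τ with ⟨hm, _⟩ | ⟨hm, _⟩ <;> rcases max_cases (1 - u) τ with ⟨hm', _⟩ | ⟨hm', _⟩ <;>
      simp only [A, B, hm, hm'] <;> linarith
  have hlog : Real.log (A + B) ≤ τ := by
    have := Real.log_le_sub_one_of_pos (add_pos hA hB)
    linarith
  rw [loss A B hA hB, neg_sub, loss B A hB hA, add_comm B A]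
  linarith

/-- Bernstein's inequality in exponential form for `s` bounded below: if `exp s` is a likelihood
ratio, the right-hand side controls the exponential moment by the divergence. -/
theorem exp_mul_le {s V l : ℝ} (hV : 0 ≤ V) (hs : -V ≤ s) (hl : 0 ≤ l) (hl1 : l * (4 * (1 + V)) ≤ 1) :
    Real.exp (l * s) ≤ 1 + l * s + l / 2 * (Real.exp s - 1 - s) := by
  have hl4 : l ≤ 1 / 4 := by nlinarith
  rcases le_total 0 s with hs0 | hs0
  · -- convexity of `exp` between `0` and `s / 2`
    have hc := convexOn_exp.2 (Set.mem_univ (0 : ℝ)) (Set.mem_univ (s / 2))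
      (by linarith : (0 : ℝ) ≤ 1 - 2 * l) (by linarith : (0 : ℝ) ≤ 2 * l) (by ring)
    simp only [smul_eq_mul, mul_zero, zero_add, Real.exp_zero, mul_one] at hc
    rw [show 2 * l * (s / 2) = l * s by ring] at hc
    set u := Real.exp (s / 2) with hu
    have hu1 : 1 ≤ u := Real.one_le_exp (by linarith)
    have hsu : Real.exp s = u ^ 2 := by rw [hu, ← Real.exp_nat_mul]; congr 1; push_cast; ring
    have hlog : s = 2 * Real.log u := by rw [hu, Real.log_exp]; ring
    have h1 := Real.le_log_one_add_of_nonneg (x := u - 1) (by linarith)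
    rw [show 1 + (u - 1) = u by ring, show u - 1 + 2 = u + 1 by ring,
      div_le_iff₀ (by linarith)] at h1
    have h2 : 0 ≤ u ^ 2 - 4 * u + 3 + s := by
      rw [hlog]
      by_contra hneg
      push Not at hneg
      have h3 : (u ^ 2 - 4 * u + 3 + 2 * Real.log u) * (u + 1) < 0 := by nlinarith
      nlinarith [pow_nonneg (sub_nonneg.mpr hu1) 3]
    rw [hsu]
    nlinarith
  · obtain ⟨w, rfl⟩ : ∃ w, s = -w := ⟨-s, by ring⟩
    have hw : 0 ≤ w := by linarith
    have hwV : w ≤ V := by linarith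
    have quad : ∀ x : ℝ, 0 ≤ x → Real.exp (-x) ≤ 1 - x + x ^ 2 / 2 := by
      intro x hx
      have h1 := Real.quadratic_le_exp_of_nonneg hx
      have h2 : Real.exp (-x) * Real.exp x = 1 := by rw [← Real.exp_add]; simp
      have h3 : 0 < 1 - x + x ^ 2 / 2 := by nlinarith [sq_nonneg (x - 1)]
      have h4 : 0 < Real.exp x := Real.exp_pos x
      by_contra hneg
      push Not at hneg
      have h5 : (1 - x + x ^ 2 / 2) * (1 + x + x ^ 2 / 2) ≤ (1 - x + x ^ 2 / 2) * Real.exp x :=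
        mul_le_mul_of_nonneg_left h1 h3.le
      have h6 : (1 - x + x ^ 2 / 2) * Real.exp x < Real.exp (-x) * Real.exp x :=
        mul_lt_mul_of_pos_right hneg h4
      nlinarith [pow_nonneg hx 4]
    have low : w ^ 2 ≤ 4 * (1 + w) * (Real.exp (-w) - 1 + w) := by
      rcases le_total w 2 with h2 | h2
      · have h3 : 1 - w / 2 ≤ Real.exp (-(w / 2)) := by
          have := Real.add_one_le_exp (-(w / 2)); linarith
        have h4 : Real.exp (-w) = Real.exp (-(w / 2)) ^ 2 := by
          rw [← Real.exp_nat_mul]; congr 1; push_cast; ring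
        have h5 : (1 - w / 2) ^ 2 ≤ Real.exp (-w) := by
          rw [h4]; exact pow_le_pow_left₀ (by linarith) h3 2
        nlinarith [pow_nonneg hw 3]
      · have := Real.exp_pos (-w)
        nlinarith
    have h1 := quad (l * w) (by positivity)
    have h2 : 0 ≤ Real.exp (-w) - 1 + w := by linarith [Real.add_one_le_exp (-w)]
    have h3 : l * w ^ 2 ≤ Real.exp (-w) - 1 + w := by
      have : l * (4 * (1 + w)) ≤ 1 := le_trans (by gcongr) hl1
      calc l * w ^ 2 ≤ l * (4 * (1 + w) * (Real.exp (-w) - 1 + w)) :=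
            mul_le_mul_of_nonneg_left low hl
        _ = l * (4 * (1 + w)) * (Real.exp (-w) - 1 + w) := by ring
        _ ≤ 1 * (Real.exp (-w) - 1 + w) := mul_le_mul_of_nonneg_right this h2
        _ = _ := one_mul _
    rw [show l * -w = -(l * w) by ring]
    have h4 := mul_le_mul_of_nonneg_left h3 (by positivity : 0 ≤ l / 2)
    nlinarith

/-- The exponential moment of the negative excess loss is controlled by the excess risk. -/
theorem exp_moment_le {η t F l : ℝ} (h0 : 0 ≤ η) (h1 : η ≤ 1) (ht : |t| ≤ F)
    (hl : 0 ≤ l) (hl1 : l * (4 * (F + 2)) ≤ 1) :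
    η * Real.exp (-l * (logisticLoss t + Real.log η)) +
      (1 - η) * Real.exp (-l * (logisticLoss (-t) + Real.log (1 - η))) ≤
      1 - l / 2 * bernKL η t := by
  have hF : 0 ≤ F := (abs_nonneg _).trans ht
  have key : ∀ p u : ℝ, 0 ≤ p → p ≤ 1 → u ≤ F + 1 →
      p * Real.exp (-l * (u + Real.log p)) ≤
        p - l / 2 * (p * u + p * Real.log p) + l / 2 * (Real.exp (-u) - p) := by
    intro p u hp hp1 hu
    rcases hp.eq_or_lt with rfl | hp
    · simp; positivity
    have h2 := exp_mul_le (s := -(u + Real.log p)) (V := F + 1) (l := l) (by linarith)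
      (by linarith [Real.log_nonpos hp.le hp1]) hl (by linarith)
    have h3 : p * Real.exp (-(u + Real.log p)) = Real.exp (-u) := by
      rw [neg_add, Real.exp_add, Real.exp_neg (Real.log p), Real.exp_log hp]
      field_simp
    have h4 := mul_le_mul_of_nonneg_left h2 hp.le
    rw [show -l * (u + Real.log p) = l * -(u + Real.log p) by ring]
    refine h4.trans (le_of_eq ?_)
    rw [← h3]
    ring
  have k1 := key η _ h0 h1 (logisticLoss_le_of_abs_le ht)
  have k2 := key (1 - η) _ (by linarith) (by linarith)
    (logisticLoss_le_of_abs_le (by rwa [abs_neg] : |-t| ≤ F))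
  have hs := exp_neg_logisticLoss_add t
  have e : Real.exp (-logisticLoss (-t)) = 1 - Real.exp (-logisticLoss t) := by linarith
  rw [e] at k2
  unfold bernKL
  linarith

/-! ### Disintegration along the label and the excess risks -/

/-- The label `1`. -/
def posLabel : Label := ⟨1, by simp⟩

/-- The label `-1`. -/
def negLabel : Label := ⟨-1, by simp⟩

@[simp] theorem coe_posLabel : (posLabel : ℝ) = 1 := rfl

@[simp] theorem coe_negLabel : (negLabel : ℝ) = -1 := rfl

theorem setOf_label_eq_one : {y : Label | (y : ℝ) = 1} = {posLabel} := by
  ext y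
  simp [Subtype.ext_iff]

theorem compl_posLabel : ({posLabel} : Set Label)ᶜ = {negLabel} := by
  ext ⟨y, hy⟩
  rcases hy with rfl | hy
  · simp [Subtype.ext_iff]; norm_num
  · simp only [Set.mem_singleton_iff] at hy
    subst hy
    simp [Subtype.ext_iff]; norm_num

/-- The conditional probability of the label `1`. -/
def condProb {d : ℕ} (P : Measure (Cube d × Label)) [IsFiniteMeasure P] (x : Cube d) : ℝ :=
  (P.condKernel x {y | (y : ℝ) = 1}).toReal

/-- The conditional probability of the observed label. -/
def labelProb {d : ℕ} (P : Measure (Cube d × Label)) [IsFiniteMeasure P] (z : Cube d × Label) : ℝ :=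
  if (z.2 : ℝ) = 1 then condProb P z.1 else 1 - condProb P z.1

/-- The logistic loss of `f` minus the loss of the optimal predictor `log (η / (1 - η))`, which is
minus the log-likelihood ratio of the models given by `f` and by `P`. -/
def excessLoss {d : ℕ} (P : Measure (Cube d × Label)) [IsFiniteMeasure P] (f : Cube d → ℝ)
    (z : Cube d × Label) : ℝ :=
  logisticLoss ((z.2 : ℝ) * f z.1) + Real.log (labelProb P z)

/-- The mean over the inputs of the divergence of the prediction from the label distribution. -/
def meanKL {d : ℕ} (P : Measure (Cube d × Label)) [IsFiniteMeasure P] (f : Cube d → ℝ) : ℝ :=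
  ∫ x, bernKL (condProb P x) (f x) ∂P.fst

section

variable {d : ℕ} (P : Measure (Cube d × Label)) [IsProbabilityMeasure P]

theorem measurable_condProb : Measurable (condProb P) := by
  unfold condProb
  rw [setOf_label_eq_one]
  exact (ProbabilityTheory.Kernel.measurable_coe _ (measurableSet_singleton _)).ennreal_toReal

theorem condProb_nonneg (x : Cube d) : 0 ≤ condProb P x := ENNReal.toReal_nonneg

theorem condProb_le_one (x : Cube d) : condProb P x ≤ 1 := by
  unfold condProb
  exact ENNReal.toReal_le_of_le_ofReal zero_le_one (by simpa using prob_le_one)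

theorem condKernel_posLabel (x : Cube d) :
    P.condKernel x {posLabel} = ENNReal.ofReal (condProb P x) := by
  rw [condProb, setOf_label_eq_one, ENNReal.ofReal_toReal (measure_ne_top _ _)]

theorem condKernel_negLabel (x : Cube d) :
    P.condKernel x {negLabel} = ENNReal.ofReal (1 - condProb P x) := by
  rw [← compl_posLabel, prob_compl_eq_one_sub (measurableSet_singleton _), condKernel_posLabel,
    ENNReal.ofReal_sub _ (condProb_nonneg P x), ENNReal.ofReal_one]

theorem lintegral_label {f : Cube d × Label → ℝ≥0∞} (hf : Measurable f) :
    ∫⁻ z, f z ∂P = ∫⁻ x, (ENNReal.ofReal (condProb P x) * f (x, posLabel) +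
      ENNReal.ofReal (1 - condProb P x) * f (x, negLabel)) ∂P.fst := by
  rw [← Measure.lintegral_condKernel hf]
  refine lintegral_congr fun x => ?_
  rw [← lintegral_add_compl _ (measurableSet_singleton posLabel), compl_posLabel,
    lintegral_singleton, lintegral_singleton, condKernel_posLabel, condKernel_negLabel, mul_comm,
    mul_comm (f (x, negLabel))]

/-- The function need not be bounded: logarithms of `condProb` are unbounded, but harmless after
multiplication by the probability of the label. -/
theorem integral_label {f : Cube d × Label → ℝ} (hf : Measurable f) {C : ℝ}
    (h1 : ∀ x, |condProb P x * f (x, posLabel)| ≤ C)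
    (h2 : ∀ x, |(1 - condProb P x) * f (x, negLabel)| ≤ C) :
    Integrable f P ∧ ∫ z, f z ∂P = ∫ x, (condProb P x * f (x, posLabel) +
      (1 - condProb P x) * f (x, negLabel)) ∂P.fst := by
  have aux : ∀ a b : ℝ, 0 ≤ a → |a * b| ≤ C → ENNReal.ofReal a * ‖b‖ₑ ≤ ENNReal.ofReal C := by
    intro a b ha hab
    rw [← ofReal_norm, ← ENNReal.ofReal_mul ha, Real.norm_eq_abs]
    rw [abs_mul, abs_of_nonneg ha] at hab
    exact ENNReal.ofReal_le_ofReal hab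
  have hint : Integrable f P := by
    refine ⟨hf.aestronglyMeasurable, ?_⟩
    rw [HasFiniteIntegral, lintegral_label P hf.enorm]
    calc _ ≤ ∫⁻ _, (ENNReal.ofReal C + ENNReal.ofReal C) ∂P.fst :=
          lintegral_mono fun x => add_le_add (aux _ _ (condProb_nonneg P x) (h1 x))
            (aux _ _ (sub_nonneg.mpr (condProb_le_one P x)) (h2 x))
      _ < ⊤ := by simp
  refine ⟨hint, ?_⟩
  rw [← Measure.integral_condKernel hint]
  refine integral_congr_ae ?_
  have hfib := hint.condKernel_ae
  filter_upwards [hfib] with x hx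
  rw [← integral_add_compl (measurableSet_singleton posLabel) hx, compl_posLabel,
    integral_singleton, integral_singleton, measureReal_def, measureReal_def, condKernel_posLabel,
    condKernel_negLabel, ENNReal.toReal_ofReal (condProb_nonneg P x),
    ENNReal.toReal_ofReal (sub_nonneg.mpr (condProb_le_one P x)), smul_eq_mul, smul_eq_mul]

theorem labelProb_pos (x : Cube d) : labelProb P (x, posLabel) = condProb P x := by
  simp [labelProb]

theorem labelProb_neg (x : Cube d) : labelProb P (x, negLabel) = 1 - condProb P x := by
  simp [labelProb]; norm_num

theorem measurable_labelProb : Measurable (labelProb P) := by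
  have h : Measurable fun z : Cube d × Label => condProb P z.1 :=
    (measurable_condProb P).comp measurable_fst
  refine Measurable.ite ?_ h (measurable_const.sub h)
  exact (measurable_subtype_coe.comp measurable_snd) (measurableSet_singleton (1 : ℝ))

variable {f : Cube d → ℝ}

theorem measurable_excessLoss (hf : Measurable f) : Measurable (excessLoss P f) := by
  unfold excessLoss
  refine Measurable.add ?_ (Real.measurable_log.comp (measurable_labelProb P))
  exact continuous_logisticLoss.measurable.comp
    ((measurable_subtype_coe.comp measurable_snd).mul (hf.comp measurable_fst))

theorem excessLoss_pos (x : Cube d) :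
    excessLoss P f (x, posLabel) = logisticLoss (f x) + Real.log (condProb P x) := by
  simp [excessLoss, labelProb_pos]

theorem excessLoss_neg (x : Cube d) :
    excessLoss P f (x, negLabel) = logisticLoss (-f x) + Real.log (1 - condProb P x) := by
  simp [excessLoss, labelProb_neg]

theorem abs_mul_log_le {p : ℝ} (h0 : 0 ≤ p) (h1 : p ≤ 1) : |p * Real.log p| ≤ 1 := by
  rcases h0.eq_or_lt with rfl | h0
  · simp
  · rw [mul_comm]; exact (Real.abs_log_mul_self_lt p h0 h1).le

theorem integral_excessLoss {F : ℝ} (hf : Measurable f) (hF : ∀ x, |f x| ≤ F) :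
    Integrable (excessLoss P f) P ∧ ∫ z, excessLoss P f z ∂P = meanKL P f := by
  have aux : ∀ p t : ℝ, 0 ≤ p → p ≤ 1 → |t| ≤ F →
      |p * (logisticLoss t + Real.log p)| ≤ F + 2 := by
    intro p t h0 h1 ht
    have h2 := logisticLoss_le_of_abs_le ht
    have h3 := logisticLoss_nonneg t
    have h4 := abs_le.mp (abs_mul_log_le h0 h1)
    have h5 : p * logisticLoss t ≤ 1 * (F + 1) := mul_le_mul h1 h2 h3 zero_le_one
    have h6 : 0 ≤ p * logisticLoss t := mul_nonneg h0 h3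
    rw [mul_add, abs_le]
    constructor <;> linarith
  have h := integral_label P (measurable_excessLoss P hf) (C := F + 2)
    (fun x => by
      rw [excessLoss_pos]; exact aux _ _ (condProb_nonneg P x) (condProb_le_one P x) (hF x))
    (fun x => by
      rw [excessLoss_neg]
      exact aux _ _ (sub_nonneg.mpr (condProb_le_one P x))
        (by linarith [condProb_nonneg P x]) (by rw [abs_neg]; exact hF x))
  refine ⟨h.1, h.2.trans (integral_congr_ae (Eventually.of_forall fun x => ?_))⟩
  simp only [excessLoss_pos, excessLoss_neg, bernKL]
  ring

theorem measurable_bernKL (hf : Measurable f) : Measurable fun x => bernKL (condProb P x) (f x) := by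
  have h := measurable_condProb P
  have hl := continuous_logisticLoss.measurable
  unfold bernKL
  exact ((h.mul (hl.comp hf)).add ((measurable_const.sub h).mul (hl.comp hf.neg))).add
    ((h.mul (Real.measurable_log.comp h)).add ((measurable_const.sub h).mul
      (Real.measurable_log.comp (measurable_const.sub h))))

theorem condProb_bernKL_nonneg (x : Cube d) (t : ℝ) : 0 ≤ bernKL (condProb P x) t :=
  bernKL_nonneg (condProb_nonneg P x) (condProb_le_one P x) t

theorem integrable_bernKL {F : ℝ} (hf : Measurable f) (hF : ∀ x, |f x| ≤ F) :
    Integrable (fun x => bernKL (condProb P x) (f x)) P.fst := by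
  refine Integrable.of_bound (measurable_bernKL P hf).aestronglyMeasurable (2 * (F + 1) + 2)
    (Eventually.of_forall fun x => ?_)
  rw [Real.norm_eq_abs, abs_of_nonneg (condProb_bernKL_nonneg P x _)]
  have h0 := condProb_nonneg P x
  have h1 := condProb_le_one P x
  have h2 := logisticLoss_le_of_abs_le (hF x)
  have h3 : logisticLoss (-f x) ≤ F + 1 :=
    logisticLoss_le_of_abs_le (by rw [abs_neg]; exact hF x)
  have h4 := (abs_le.mp (abs_mul_log_le h0 h1)).2
  have h5 := (abs_le.mp (abs_mul_log_le (sub_nonneg.mpr h1) (by linarith))).2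
  have h6 := logisticLoss_nonneg (f x)
  have h7 := logisticLoss_nonneg (-f x)
  unfold bernKL
  nlinarith

theorem meanKL_nonneg : 0 ≤ meanKL P f :=
  integral_nonneg fun x => condProb_bernKL_nonneg P x _

theorem meanKL_le_add {g : Cube d → ℝ} {F e : ℝ} (hf : Measurable f) (hF : ∀ x, |f x| ≤ F)
    (hg : Measurable g) (hG : ∀ x, |g x| ≤ F) (h : ∀ x, |f x - g x| ≤ e) :
    meanKL P f ≤ meanKL P g + e := by
  have : meanKL P f ≤ ∫ x, (bernKL (condProb P x) (g x) + e) ∂P.fst :=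
    integral_mono (integrable_bernKL P hf hF) ((integrable_bernKL P hg hG).add (integrable_const _))
      fun x => bernKL_le_add (condProb_nonneg P x) (condProb_le_one P x) (h x)
  rwa [integral_add (integrable_bernKL P hg hG) (integrable_const _), integral_const,
    probReal_univ, one_smul] at this

theorem integral_exp_excessLoss {F l : ℝ} (hf : Measurable f) (hF : ∀ x, |f x| ≤ F)
    (hl : 0 ≤ l) (hl1 : l * (4 * (F + 2)) ≤ 1) :
    Integrable (fun z => Real.exp (-l * excessLoss P f z)) P ∧
      ∫ z, Real.exp (-l * excessLoss P f z) ∂P ≤ Real.exp (-(l / 2 * meanKL P f)) := by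
  have key := fun x : Cube d =>
    exp_moment_le (condProb_nonneg P x) (condProb_le_one P x) (hF x) hl hl1
  have n1 := fun x : Cube d => mul_nonneg (condProb_nonneg P x)
    (Real.exp_pos (-l * (logisticLoss (f x) + Real.log (condProb P x)))).le
  have n2 := fun x : Cube d => mul_nonneg (sub_nonneg.mpr (condProb_le_one P x))
    (Real.exp_pos (-l * (logisticLoss (-f x) + Real.log (1 - condProb P x)))).le
  have n3 := fun x : Cube d =>
    mul_nonneg (by positivity : 0 ≤ l / 2) (condProb_bernKL_nonneg P x (f x))
  have h := integral_label P (f := fun z => Real.exp (-l * excessLoss P f z))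
    ((measurable_excessLoss P hf).const_mul _).exp (C := 1)
    (fun x => by
      simp only [excessLoss_pos]
      rw [abs_of_nonneg (n1 x)]
      linarith [key x, n2 x, n3 x])
    (fun x => by
      simp only [excessLoss_neg]
      rw [abs_of_nonneg (n2 x)]
      linarith [key x, n1 x, n3 x])
  refine ⟨h.1, ?_⟩
  rw [h.2]
  have hi := (integrable_bernKL P hf hF).const_mul (l / 2)
  calc _ ≤ ∫ x, (1 - l / 2 * bernKL (condProb P x) (f x)) ∂P.fst := by
        refine integral_mono_of_nonneg (Eventually.of_forall fun x => ?_)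
          ((integrable_const _).sub hi) (Eventually.of_forall fun x => ?_)
        · simp only [excessLoss_pos, excessLoss_neg]
          exact add_nonneg (n1 x) (n2 x)
        · simp only [excessLoss_pos, excessLoss_neg]
          exact key x
    _ = 1 - l / 2 * meanKL P f := by
        rw [integral_sub (integrable_const _) hi, integral_const, probReal_univ, one_smul,
          integral_const_mul, meanKL]
    _ ≤ _ := by
        have := Real.add_one_le_exp (-(l / 2 * meanKL P f))
        linarith

theorem logisticRisk_eq (hf : Measurable f) :
    logisticRisk P f = ∫⁻ x, ENNReal.ofReal (condProb P x * logisticLoss (f x) +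
      (1 - condProb P x) * logisticLoss (-f x)) ∂P.fst := by
  unfold logisticRisk
  rw [lintegral_label P]
  · refine lintegral_congr fun x => ?_
    have h1 := sub_nonneg.mpr (condProb_le_one P x)
    simp only [coe_posLabel, coe_negLabel, one_mul, neg_one_mul]
    rw [← ENNReal.ofReal_mul (condProb_nonneg P x), ← ENNReal.ofReal_mul h1,
      ← ENNReal.ofReal_add (mul_nonneg (condProb_nonneg P x) (logisticLoss_nonneg _))
        (mul_nonneg h1 (logisticLoss_nonneg _))]
  · exact (continuous_logisticLoss.measurable.comp
      ((measurable_subtype_coe.comp measurable_snd).mul (hf.comp measurable_fst))).ennreal_ofReal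

/-- The infimum of the logistic risk is at least the conditional entropy of the label, so the
excess risk is at most the mean divergence. -/
theorem excessLogisticRisk_le {F : ℝ} (hf : Measurable f) (hF : ∀ x, |f x| ≤ F) :
    excessLogisticRisk P f ≤ ENNReal.ofReal (meanKL P f) := by
  have hη := measurable_condProb P
  set H : Cube d → ℝ := fun x => -(condProb P x * Real.log (condProb P x) +
    (1 - condProb P x) * Real.log (1 - condProb P x)) with hH
  have hHm : Measurable H :=
    ((hη.mul (Real.measurable_log.comp hη)).add ((measurable_const.sub hη).mul
      (Real.measurable_log.comp (measurable_const.sub hη)))).neg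
  have hH0 : ∀ x, 0 ≤ H x := by
    intro x
    have h0 := condProb_nonneg P x
    have h1 := condProb_le_one P x
    have h2 := mul_nonneg h0 (neg_nonneg.mpr (Real.log_nonpos h0 h1))
    have h3 := mul_nonneg (sub_nonneg.mpr h1)
      (neg_nonneg.mpr (Real.log_nonpos (sub_nonneg.mpr h1) (by linarith)))
    simp only [hH]
    linarith
  have hinf : ∫⁻ x, ENNReal.ofReal (H x) ∂P.fst ≤
      ⨅ (g : Cube d → ℝ) (_ : Measurable g), logisticRisk P g := by
    refine le_iInf₂ fun g hg => ?_
    rw [logisticRisk_eq P hg]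
    refine lintegral_mono fun x => ENNReal.ofReal_le_ofReal ?_
    have := condProb_bernKL_nonneg P x (g x)
    simp only [bernKL] at this
    simp only [hH]
    linarith
  have hrisk : logisticRisk P f =
      ∫⁻ x, ENNReal.ofReal (H x) ∂P.fst + ENNReal.ofReal (meanKL P f) := by
    rw [meanKL, ofReal_integral_eq_lintegral_ofReal (integrable_bernKL P hf hF)
      (Eventually.of_forall fun x => condProb_bernKL_nonneg P x _),
      ← lintegral_add_left hHm.ennreal_ofReal, logisticRisk_eq P hf]
    refine lintegral_congr fun x => ?_
    rw [← ENNReal.ofReal_add (hH0 x) (condProb_bernKL_nonneg P x _)]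
    congr 1
    simp only [hH, bernKL]
    ring
  rw [excessLogisticRisk, tsub_le_iff_left, hrisk]
  gcongr

theorem misclassError_eq (hf : Measurable f) :
    misclassError P f = ∫⁻ x, ENNReal.ofReal
      (if 0 ≤ f x then 1 - condProb P x else condProb P x) ∂P.fst := by
  have hs : Measurable fun x : Cube d => sgn (f x) :=
    Measurable.ite (measurableSet_le measurable_const hf) measurable_const measurable_const
  have hS : MeasurableSet {p : Cube d × Label | (p.2 : ℝ) ≠ sgn (f p.1)} :=
    (measurableSet_eq_fun (measurable_subtype_coe.comp measurable_snd)
      (hs.comp measurable_fst)).compl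
  rw [misclassError, ← lintegral_indicator_one hS,
    lintegral_label P (measurable_one.indicator hS)]
  refine lintegral_congr fun x => ?_
  by_cases h : 0 ≤ f x
  · have : (-1 : ℝ) ≠ 1 := by norm_num
    simp [Set.indicator, sgn, h, this]
  · have : (1 : ℝ) ≠ -1 := by norm_num
    simp [Set.indicator, sgn, h, this]

/-- Comparison of the excess misclassification error with the mean divergence; the choice
`a = √(meanKL P f)` recovers the usual square root. -/
theorem excessMisclassError_le {F a : ℝ} (hf : Measurable f) (hF : ∀ x, |f x| ≤ F) (ha : 0 < a) :
    excessMisclassError P f ≤ ENNReal.ofReal (2 * a + meanKL P f / a) := by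
  have hi : Integrable (fun x => 2 * a + bernKL (condProb P x) (f x) / a) P.fst :=
    (integrable_const _).add ((integrable_bernKL P hf hF).div_const a)
  have h0 : ∀ x, 0 ≤ 2 * a + bernKL (condProb P x) (f x) / a := fun x =>
    add_nonneg (by positivity) (div_nonneg (condProb_bernKL_nonneg P x _) ha.le)
  have hI : ENNReal.ofReal (2 * a + meanKL P f / a) =
      ∫⁻ x, ENNReal.ofReal (2 * a + bernKL (condProb P x) (f x) / a) ∂P.fst := by
    rw [← ofReal_integral_eq_lintegral_ofReal hi (Eventually.of_forall h0),
      integral_add (integrable_const _) ((integrable_bernKL P hf hF).div_const a), integral_const,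
      probReal_univ, one_smul, integral_div, meanKL]
  rw [excessMisclassError, tsub_le_iff_right, ← tsub_le_iff_left]
  refine le_iInf₂ fun g hg => ?_
  rw [tsub_le_iff_left, hI, misclassError_eq P hf, misclassError_eq P hg,
    ← lintegral_add_left]
  · refine lintegral_mono fun x => ?_
    have c0 := condProb_nonneg P x
    have c1 := condProb_le_one P x
    rw [← ENNReal.ofReal_add (h0 x) (by split_ifs <;> linarith)]
    refine ENNReal.ofReal_le_ofReal ?_
    have hw := abs_le_of_wrong_sign (t := f x) c0 c1 ha
    have := h0 x
    by_cases h1 : 0 ≤ f x <;> by_cases h2 : 0 ≤ g x <;> simp only [h1, h2, if_true, if_false]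
    · linarith
    · rcases le_total (condProb P x) (1 / 2) with h3 | h3
      · linarith [hw (Or.inl ⟨h1, h3⟩), le_abs_self (1 - 2 * condProb P x)]
      · linarith
    · rcases le_total (condProb P x) (1 / 2) with h3 | h3
      · linarith
      · linarith [hw (Or.inr ⟨not_le.mp h1, h3⟩), neg_abs_le (1 - 2 * condProb P x)]
    · linarith
  · exact (measurable_const.add ((measurable_bernKL P hf).div_const a)).ennreal_ofReal

end

/-! ### The oracle inequality for empirical risk minimisers -/

theorem Net.continuous_eval : ∀ {m : ℕ} (T : Net m), Continuous T.eval
  | _, .out W => by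
      show Continuous fun x => W.mulVec x 0
      exact (continuous_apply 0).comp (Continuous.matrix_mulVec continuous_const continuous_id)
  | _, .hidden W v T => by
      show Continuous fun x => T.eval fun i => max (W.mulVec x i - v i) 0
      refine T.continuous_eval.comp (continuous_pi fun i => ?_)
      exact (((continuous_apply i).comp
        (Continuous.matrix_mulVec continuous_const continuous_id)).sub continuous_const).max
        continuous_const

theorem measurable_of_mem_FNN {d : ℕ} {G N S B F : ℝ} {f : (Fin d → ℝ) → ℝ}
    (hf : f ∈ FNN d G N S B F) : Measurable fun x : Cube d => f (toVec x) := by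
  obtain ⟨⟨T, rfl, -⟩, -⟩ := hf
  refine T.continuous_eval.measurable.comp ?_
  exact measurable_pi_lambda _ fun i => measurable_subtype_coe.comp (measurable_pi_apply i)

/-- The mean divergence of an empirical risk minimiser is at most twice that of any competitor,
plus the logarithm of a covering number over `n`. For each member `g` of the covering the
weight `exp (n l KL(g) / 2) ∏ exp (-l ℓ_g(Z_k))` has expectation at most one; the minimiser is
near one of the `g`, so its divergence is bounded by the logarithm of the sum of the weights. -/
theorem erm_oracle {d n : ℕ} (hn : 1 ≤ n) (P : Measure (Cube d × Label)) [IsProbabilityMeasure P]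
    {𝓕 : Set ((Fin d → ℝ) → ℝ)} {F δ : ℝ} (hF0 : 0 ≤ F)
    (hmeas : ∀ f ∈ 𝓕, Measurable fun x : Cube d => f (toVec x))
    (hF : ∀ f ∈ 𝓕, ∀ x : Cube d, |f (toVec x)| ≤ F)
    {ι : Type} [Fintype ι] (g : ι → (Fin d → ℝ) → ℝ) (hg : ∀ i, g i ∈ 𝓕)
    (hcov : ∀ f ∈ 𝓕, ∃ i, ∀ x : Cube d, |f (toVec x) - g i (toVec x)| ≤ δ)
    {fhat : (Fin n → Cube d × Label) → (Fin d → ℝ) → ℝ} (herm : IsERM 𝓕 fhat)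
    {f₀ : (Fin d → ℝ) → ℝ} (hf₀ : f₀ ∈ 𝓕) :
    ∫⁻ z, ENNReal.ofReal (meanKL P fun x => fhat z (toVec x)) ∂(Measure.pi fun _ : Fin n => P) ≤
      ENNReal.ofReal (3 * δ + 2 * meanKL P (fun x => f₀ (toVec x)) +
        8 * (F + 2) / n * Real.log (Fintype.card ι)) := by
  have hn0 : (0 : ℝ) < n := by exact_mod_cast hn
  set l : ℝ := 1 / (4 * (F + 2)) with hl
  have hl0 : 0 < l := by positivity
  have hl1 : l * (4 * (F + 2)) ≤ 1 := le_of_eq (by rw [hl]; field_simp)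
  obtain ⟨i₀, -⟩ := hcov f₀ hf₀
  have : Nonempty ι := ⟨i₀⟩
  set M : ℝ := (Fintype.card ι : ℝ) with hM
  have hM0 : 0 < M := by rw [hM]; exact_mod_cast Fintype.card_pos
  set ell : ((Fin d → ℝ) → ℝ) → Cube d × Label → ℝ := fun f => excessLoss P fun x => f (toVec x)
    with hell
  set KL : ((Fin d → ℝ) → ℝ) → ℝ := fun f => meanKL P fun x => f (toVec x) with hKL
  have hexp : ∀ i, Integrable (fun z => Real.exp (-l * ell (g i) z)) P ∧
      ∫ z, Real.exp (-l * ell (g i) z) ∂P ≤ Real.exp (-(l / 2 * KL (g i))) := fun i =>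
    integral_exp_excessLoss P (hmeas _ (hg i)) (hF _ (hg i)) hl0.le hl1
  have hell0 := integral_excessLoss P (hmeas _ hf₀) (hF _ hf₀)
  set w : ι → (Fin n → Cube d × Label) → ℝ := fun i z =>
    Real.exp (n * (l / 2 * KL (g i))) * ∏ k, Real.exp (-l * ell (g i) (z k)) with hw
  have hwint : ∀ i, Integrable (w i) (Measure.pi fun _ : Fin n => P) := fun i =>
    (Integrable.fintype_prod (f := fun _ : Fin n => fun z => Real.exp (-l * ell (g i) z))
      fun _ => (hexp i).1).const_mul _
  have hwle : ∀ i, ∫ z, w i z ∂(Measure.pi fun _ : Fin n => P) ≤ 1 := by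
    intro i
    have e1 := integral_fintype_prod_eq_pow (ι := Fin n) (μ := P)
      (fun z => Real.exp (-l * ell (g i) z))
    rw [Fintype.card_fin] at e1
    simp only [hw]
    rw [integral_const_mul, e1]
    have h1 : (∫ z, Real.exp (-l * ell (g i) z) ∂P) ^ n ≤ Real.exp (-(l / 2 * KL (g i))) ^ n :=
      pow_le_pow_left₀ (integral_nonneg fun z => (Real.exp_pos _).le) (hexp i).2 n
    calc _ ≤ Real.exp (n * (l / 2 * KL (g i))) * Real.exp (-(l / 2 * KL (g i))) ^ n := by gcongr
      _ = 1 := by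
          rw [← Real.exp_nat_mul, ← Real.exp_add]
          simp
  set Y : (Fin n → Cube d × Label) → ℝ := fun z => ∑ i, w i z with hY
  have hYint : Integrable Y (Measure.pi fun _ : Fin n => P) := integrable_finsetSum _ fun i _ => hwint i
  have hYle : ∫ z, Y z ∂(Measure.pi fun _ : Fin n => P) ≤ M := by
    simp only [hY]
    rw [integral_finsetSum _ fun i _ => hwint i]
    calc _ ≤ ∑ _i : ι, (1 : ℝ) := Finset.sum_le_sum fun i _ => hwle i
      _ = M := by simp [hM]
  set A : (Fin n → Cube d × Label) → ℝ := fun z => ∑ k, ell f₀ (z k) with hA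
  have hAk : ∀ k : Fin n, Integrable (fun z : Fin n → Cube d × Label => ell f₀ (z k))
      (Measure.pi fun _ : Fin n => P) := fun k =>
    integrable_comp_eval (μ := fun _ : Fin n => P) (i := k) hell0.1
  have hAint : Integrable A (Measure.pi fun _ : Fin n => P) :=
    integrable_finsetSum _ fun k _ => hAk k
  have hAeq : ∫ z, A z ∂(Measure.pi fun _ : Fin n => P) = n * KL f₀ := by
    simp only [hA]
    rw [integral_finsetSum _ fun k _ => hAk k]
    have : ∀ k : Fin n, ∫ z : Fin n → Cube d × Label, ell f₀ (z k) ∂(Measure.pi fun _ : Fin n => P)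
        = KL f₀ := fun k =>
      (integral_comp_eval (μ := fun _ : Fin n => P) (i := k) (f := ell f₀)
        hell0.1.aestronglyMeasurable).trans hell0.2
    simp [this]
  set H : (Fin n → Cube d × Label) → ℝ := fun z =>
    3 * δ + 2 / n * A z + 2 / (n * l) * (Y z / M - 1 + Real.log M) with hH
  -- the majorant `H` is measurable, so that no measurability of `fhat` in the sample is needed
  have hpt : ∀ z, KL (fhat z) ≤ H z := by
    intro z
    have hmem := herm.mem z
    obtain ⟨i, hi⟩ := hcov _ hmem
    have h1 : KL (fhat z) ≤ KL (g i) + δ :=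
      meanKL_le_add P (hmeas _ hmem) (hF _ hmem) (hmeas _ (hg i)) (hF _ (hg i)) hi
    have h2 : ∑ k, ell (g i) (z k) ≤ ∑ k, ell (fhat z) (z k) + n * δ := by
      have : ∀ k : Fin n, ell (g i) (z k) ≤ ell (fhat z) (z k) + δ := by
        intro k
        simp only [hell, excessLoss]
        have hb : |((z k).2 : ℝ) * g i (toVec (z k).1) - ((z k).2 : ℝ) * fhat z (toVec (z k).1)|
            ≤ δ := by
          rw [← mul_sub, abs_mul, abs_sub_comm]
          have hy : |((z k).2 : ℝ)| = 1 := by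
            rcases (z k).2.2 with h | h
            · rw [h]; simp
            · rw [Set.mem_singleton_iff.mp h]; simp
          rw [hy, one_mul]
          exact hi _
        linarith [logisticLoss_le_add hb]
      calc _ ≤ ∑ k, (ell (fhat z) (z k) + δ) := Finset.sum_le_sum fun k _ => this k
        _ = _ := by rw [Finset.sum_add_distrib]; simp
    have h3 : ∑ k, ell (fhat z) (z k) ≤ A z := by
      have := herm.minimal z f₀ hf₀
      unfold empRisk at this
      have h4 := le_of_mul_le_mul_left this (by positivity)
      simp only [hA, hell, excessLoss, Finset.sum_add_distrib]
      linarith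
    have hwpos : ∀ j, 0 < w j z := fun j =>
      mul_pos (Real.exp_pos _) (Finset.prod_pos fun k _ => Real.exp_pos _)
    have h5 : w i z ≤ Y z :=
      Finset.single_le_sum (f := fun j => w j z) (fun j _ => (hwpos j).le) (Finset.mem_univ i)
    have hY0 : 0 < Y z := (hwpos i).trans_le h5
    have h6 : n * (l / 2 * KL (g i)) - l * ∑ k, ell (g i) (z k) = Real.log (w i z) := by
      simp only [hw]
      rw [← Real.exp_sum, ← Real.exp_add, Real.log_exp, Finset.mul_sum, sub_eq_add_neg,
        ← Finset.sum_neg_distrib]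
      simp
    -- the tangent of `log` at `M` replaces Jensen's inequality
    have h7 : Real.log (w i z) ≤ Y z / M - 1 + Real.log M := by
      have := Real.log_le_sub_one_of_pos (div_pos hY0 hM0)
      rw [Real.log_div hY0.ne' hM0.ne'] at this
      linarith [Real.log_le_log (hwpos i) h5]
    have h8 : n * (l / 2) * KL (g i) ≤ l * (A z + n * δ) + (Y z / M - 1 + Real.log M) := by
      have := mul_le_mul_of_nonneg_left (h2.trans (add_le_add_left h3 _)) hl0.le
      linarith
    have h9 : KL (g i) ≤ 2 / n * A z + 2 * δ + 2 / (n * l) * (Y z / M - 1 + Real.log M) := by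
      have h10 := mul_le_mul_of_nonneg_left h8 (by positivity : 0 ≤ 2 / (n * l))
      have e1 : 2 / (n * l) * (n * (l / 2) * KL (g i)) = KL (g i) := by field_simp
      have e2 : 2 / (n * l) * (l * (A z + n * δ)) = 2 / n * A z + 2 * δ := by field_simp
      rw [mul_add, e1, e2] at h10
      exact h10
    simp only [hH]
    linarith
  have hi1 : Integrable (fun z => 3 * δ + 2 / n * A z) (Measure.pi fun _ : Fin n => P) :=
    (integrable_const _).add (hAint.const_mul _)
  have hi2 : Integrable (fun z => Y z / M - 1 + Real.log M) (Measure.pi fun _ : Fin n => P) :=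
    ((hYint.div_const M).sub (integrable_const _)).add (integrable_const _)
  have hHint : Integrable H (Measure.pi fun _ : Fin n => P) := hi1.add (hi2.const_mul _)
  calc _ ≤ ∫⁻ z, ENNReal.ofReal (H z) ∂(Measure.pi fun _ : Fin n => P) :=
        lintegral_mono fun z => ENNReal.ofReal_le_ofReal (hpt z)
    _ = ENNReal.ofReal (∫ z, H z ∂(Measure.pi fun _ : Fin n => P)) :=
        (ofReal_integral_eq_lintegral_ofReal hHint
          (Eventually.of_forall fun z => (meanKL_nonneg P).trans (hpt z))).symm
    _ ≤ _ := by
        refine ENNReal.ofReal_le_ofReal ?_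
        have e1 : ∫ z, H z ∂(Measure.pi fun _ : Fin n => P) = 3 * δ + 2 / n * (n * KL f₀) +
            2 / (n * l) * ((∫ z, Y z ∂(Measure.pi fun _ : Fin n => P)) / M - 1 + Real.log M) := by
          simp only [hH]
          have e0 : Integrable (fun z => Y z / M - 1) (Measure.pi fun _ : Fin n => P) :=
            (hYint.div_const M).sub (integrable_const _)
          rw [integral_add hi1 (hi2.const_mul _), integral_const_mul (2 / (n * l)),
            integral_add e0 (integrable_const _), integral_sub (hYint.div_const M)
              (integrable_const _), integral_div, integral_add (integrable_const _)
              (hAint.const_mul _), integral_const_mul (2 / (n : ℝ)), hAeq]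
          simp
        have h2 : (∫ z, Y z ∂(Measure.pi fun _ : Fin n => P)) / M ≤ 1 :=
          (div_le_one hM0).mpr hYle
        have e2 : 2 / (n * l) = 8 * (F + 2) / n := by rw [hl]; field_simp; norm_num
        have e3 : 2 / n * (n * KL f₀) = 2 * KL f₀ := by field_simp
        rw [e1, e3, e2]
        have : 8 * (F + 2) / n * ((∫ z, Y z ∂(Measure.pi fun _ : Fin n => P)) / M - 1 + Real.log M)
            ≤ 8 * (F + 2) / n * Real.log M :=
          mul_le_mul_of_nonneg_left (by linarith) (by positivity)
        linarith

/-! ### The balance of approximation error and network size -/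

theorem tendsto_logRate_inv : Tendsto (fun n : ℕ => (logRate n)⁻¹) atTop atTop := by
  have h1 : Tendsto (fun x : ℝ => Real.log x ^ 5 / x) atTop (nhds 0) :=
    (Real.isLittleO_pow_log_id_atTop (n := 5)).tendsto_div_nhds_zero
  have h2 : Tendsto (fun n : ℕ => logRate n) atTop (nhds 0) :=
    h1.comp tendsto_natCast_atTop_atTop
  refine Tendsto.inv_tendsto_nhdsGT_zero (tendsto_nhdsWithin_iff.mpr ⟨h2, ?_⟩)
  filter_upwards [eventually_ge_atTop 3] with n hn
  have h3 : (1 : ℝ) < n := by exact_mod_cast (by omega : 1 < n)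
  have := Real.log_pos h3
  show 0 < logRate n
  unfold logRate
  positivity

theorem tendsto_logRate_rpow {σ b : ℝ} (hσ : 0 < σ) (hb : 0 < b) :
    Tendsto (fun n : ℕ => logRate n ^ (-σ / (σ + b))) atTop atTop := by
  have h := (tendsto_rpow_atTop (div_pos hσ (add_pos hσ hb))).comp tendsto_logRate_inv
  refine h.congr' ?_
  filter_upwards with n
  have h0 : 0 ≤ logRate n := by
    unfold logRate
    exact div_nonneg (pow_nonneg (Real.log_natCast_nonneg n) 5) (Nat.cast_nonneg n)
  simp only [Function.comp]
  rw [Real.inv_rpow h0, neg_div, Real.rpow_neg h0]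

theorem one_le_log_of_three_le {n : ℕ} (hn : 3 ≤ n) : 1 ≤ Real.log n := by
  have h3 : (3 : ℝ) ≤ n := by exact_mod_cast hn
  rw [Real.le_log_iff_exp_le (by linarith)]
  linarith [Real.exp_one_lt_d9]

section

variable {n : ℕ} {σ b : ℝ}

theorem logRate_pos (hn : 3 ≤ n) : 0 < logRate n := by
  have := one_le_log_of_three_le hn
  have h3 : (0 : ℝ) < n := by exact_mod_cast (by omega : 0 < n)
  unfold logRate
  positivity

theorem log_logRate_rpow (hn : 3 ≤ n) :
    Real.log (logRate n ^ (-σ / (σ + b))) =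
      σ / (σ + b) * (Real.log n - 5 * Real.log (Real.log n)) := by
  have := one_le_log_of_three_le hn
  have h3 : (0 : ℝ) < n := by exact_mod_cast (by omega : 0 < n)
  rw [Real.log_rpow (logRate_pos hn), logRate, Real.log_div (by positivity) (by positivity),
    Real.log_pow]
  push_cast
  ring

theorem logRate_rpow_mul (hσ : 0 < σ) (hb : 0 < b) (hn : 3 ≤ n) :
    logRate n ^ (-σ / (σ + b)) * logRate n = logRate n ^ (b / (σ + b)) := by
  rw [← Real.rpow_add_one (logRate_pos hn).ne']
  congr 1
  field_simp
  ring

theorem logRate_rpow_rpow (hσ : 0 < σ) (hn : 3 ≤ n) :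
    (logRate n ^ (-σ / (σ + b))) ^ (-b / σ) = logRate n ^ (b / (σ + b)) := by
  rw [← Real.rpow_mul (logRate_pos hn).le]
  congr 1
  field_simp

theorem logRate_rpow_le (hσ : 0 < σ) (hb : 0 < b) (hn : 3 ≤ n) :
    logRate n ^ (-σ / (σ + b)) ≤ n := by
  have h1 := one_le_log_of_three_le hn
  have h3 : (0 : ℝ) < n := by exact_mod_cast (by omega : 0 < n)
  have hR : 0 < logRate n ^ (-σ / (σ + b)) := Real.rpow_pos_of_pos (logRate_pos hn) _
  rw [← Real.log_le_log_iff hR h3, log_logRate_rpow hn]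
  have h4 : σ / (σ + b) ≤ 1 := (div_le_one (by positivity)).mpr (by linarith)
  have h5 : 0 ≤ σ / (σ + b) := by positivity
  have h6 := Real.log_nonneg h1
  nlinarith

end

theorem abs_truncLogit_le (J : ℕ) {u : ℝ} (h0 : 0 ≤ u) (h1 : u ≤ 1) :
    |truncLogit J u| ≤ J * Real.log 2 := by
  have hτ : (0 : ℝ) < (1 / 2) ^ J := by positivity
  have hτ1 : (1 / 2 : ℝ) ^ J ≤ 1 := pow_le_one₀ (by norm_num) (by norm_num)
  have key : ∀ v : ℝ, v ≤ 1 → -(J * Real.log 2) ≤ Real.log (max v ((1 / 2) ^ J)) ∧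
      Real.log (max v ((1 / 2) ^ J)) ≤ 0 := by
    intro v hv
    have e : -(J * Real.log 2) = Real.log ((1 / 2) ^ J) := by
      rw [Real.log_pow, one_div, Real.log_inv]; ring
    rw [e]
    exact ⟨Real.log_le_log hτ (le_max_right _ _),
      Real.log_nonpos (hτ.le.trans (le_max_right _ _)) (max_le hv hτ1)⟩
  have k1 := key u h1
  have k2 := key (1 - u) (by linarith)
  unfold truncLogit
  rw [abs_le]
  constructor <;> linarith

theorem Net.WidthLE.mono {N N' : ℝ} (h : N ≤ N') : ∀ {m : ℕ} {T : Net m}, T.WidthLE N → T.WidthLE N'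
  | _, .out _, _ => trivial
  | _, .hidden _ _ _, hT => ⟨hT.1, hT.2.1.trans h, Net.WidthLE.mono h hT.2.2⟩

theorem Net.ParamsLE.mono {B B' : ℝ} (h : B ≤ B') :
    ∀ {m : ℕ} {T : Net m}, T.ParamsLE B → T.ParamsLE B'
  | _, .out _, hT => fun i j => (hT i j).trans h
  | _, .hidden _ _ _, hT =>
      ⟨fun i j => (hT.1 i j).trans h, fun i => (hT.2.1 i).trans h, Net.ParamsLE.mono h hT.2.2⟩

set_option maxHeartbeats 1000000 in
/-- The network class contains an approximation of the truncated logit of the conditional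
probability whose mean divergence is of the order of the rate. -/
theorem exists_mem_FNN_meanKL_le (dmax s : ℕ) (hs : 1 ≤ s) (β r : ℝ) (hβ : 0 < β) (hr : 0 < r)
    (q : ℕ) : ∃ D : ℕ, ∀ d K : ℕ, 1 ≤ K → ∀ cN cS : ℝ, 0 < cN → 0 < cS → ∃ c : ℝ, 0 < c ∧
      ∀ᶠ n : ℕ in atTop, ∀ G N S B F : ℝ, 3 * D * Real.log n ≤ G →
        logRate n ^ (-(s : ℝ) / (s + effSmooth β q)) ≤ cN * N →
        logRate n ^ (-(s : ℝ) / (s + effSmooth β q)) * Real.log n ≤ cS * S →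
        1 ≤ B → effSmooth β q / (s + effSmooth β q) * Real.log n ≤ F →
        ∀ (P : Measure (Cube d × Label)) [IsProbabilityMeasure P], ∀ f ∈ CHOM K dmax s β r q d,
          (∀ᵐ x ∂P.fst, condProb P x = f x) →
          ∃ f₀ ∈ FNN d G N S B F, meanKL P (fun x => f₀ (toVec x)) ≤
            c * logRate n ^ (effSmooth β q / (s + effSmooth β q)) := by
  obtain ⟨D, hD⟩ := chom_logit_approx dmax s hs β r hβ hr q
  refine ⟨D, fun d K hK cN cS hcN hcS => ?_⟩
  obtain ⟨C, C₀, hC₀, happ⟩ := hD d K hK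
  set b := effSmooth β q with hb
  have hb0 : 0 < b := effSmooth_pos hβ q
  have hs0 : (0 : ℝ) < s := by exact_mod_cast hs
  -- the networks for the grid `2⁻ᵖ` fit into the class if `2 ^ (p * s) ≤ κ * R`
  obtain ⟨κ, hκ0, hκ1, hκN, hκS⟩ : ∃ κ : ℝ, 0 < κ ∧ κ ≤ 1 ∧ C * κ * cN ≤ 1 ∧ 3 * C * κ * cS ≤ 1 := by
    refine ⟨1 / (1 + C * cN + 3 * C * cS), by positivity, ?_, ?_, ?_⟩
    · rw [div_le_one (by positivity)]
      have : 0 ≤ C * cN + 3 * C * cS := by positivity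
      linarith
    · rw [mul_one_div, div_mul_eq_mul_div, div_le_one (by positivity)]
      have : 0 ≤ 1 + 3 * C * cS := by positivity
      linarith
    · rw [mul_one_div, div_mul_eq_mul_div, div_le_one (by positivity)]
      have : 0 ≤ 1 + C * cN := by positivity
      linarith
  set c₁ : ℝ := (κ / 2 ^ s) ^ (-b / s) with hc₁
  have hc₁0 : 0 < c₁ := by positivity
  refine ⟨c₁ * (1 + 3 * C₀ + 4 * C₀ ^ 2), by positivity, ?_⟩
  have hloglog : Tendsto (fun n : ℕ => b / (s + b) * (5 * Real.log (Real.log n))) atTop atTop :=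
    Tendsto.const_mul_atTop (by positivity) (Tendsto.const_mul_atTop (by norm_num)
      (Real.tendsto_log_atTop.comp (Real.tendsto_log_atTop.comp tendsto_natCast_atTop_atTop)))
  filter_upwards [eventually_ge_atTop 3, hloglog.eventually_ge_atTop (1 + C₀),
    (tendsto_logRate_rpow hs0 hb0).eventually_ge_atTop ((2 ^ s) ^ 2 / κ)] with n hn hll hR
    G N S B F hG hN hS hB hF P _ f hf hP
  set R := logRate n ^ (-(s : ℝ) / (s + b)) with hRdef
  have hl1 := one_le_log_of_three_le hn
  have hn0 : (0 : ℝ) < n := by exact_mod_cast (by omega : 0 < n)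
  have hR0 : 0 < R := Real.rpow_pos_of_pos (logRate_pos hn) _
  rw [div_le_iff₀ hκ0] at hR
  have h2s : (1 : ℝ) < 2 ^ s := one_lt_pow₀ (by norm_num) (by omega)
  obtain ⟨p, hp1, hp2⟩ := exists_nat_pow_near (x := R * κ) (y := 2 ^ s)
    ((one_le_pow₀ h2s.le).trans hR) h2s
  have hp : 2 ≤ p := by
    have : (2 : ℕ) < p + 1 := (pow_lt_pow_iff_right₀ h2s).mp (hR.trans_lt hp2)
    omega
  have hpow : ((2 : ℝ) ^ s) ^ p = 2 ^ (p * s) := by rw [← pow_mul, mul_comm]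
  have hpR : (2 : ℝ) ^ (p * s) ≤ R := by
    rw [← hpow]; exact hp1.trans (mul_le_of_le_one_right hR0.le hκ1)
  have hlogR : (p * s : ℝ) * Real.log 2 ≤ s / (s + b) * (Real.log n - 5 * Real.log (Real.log n)) := by
    rw [← log_logRate_rpow hn, ← hRdef]
    have := Real.log_le_log (by positivity) hpR
    rw [Real.log_pow] at this
    push_cast at this
    exact this
  have hplog : (p : ℝ) + 1 ≤ 3 * Real.log n := by
    have h1 : (2 : ℝ) ^ (p * s) ≤ n := hpR.trans (logRate_rpow_le hs0 hb0 hn)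
    have h2 := Real.log_le_log (by positivity) h1
    rw [Real.log_pow] at h2
    push_cast at h2
    have h3 : (p : ℝ) * Real.log 2 ≤ p * s * Real.log 2 := by
      have : (1 : ℝ) ≤ s := by exact_mod_cast hs
      have := Real.log_pos (one_lt_two)
      gcongr
      exact le_mul_of_one_le_right (Nat.cast_nonneg p) ‹1 ≤ (s : ℝ)›
    have h4 : (1 / 2 : ℝ) ≤ Real.log 2 := by linarith [Real.log_two_gt_d9]
    have h5 := mul_le_mul_of_nonneg_left h4 (Nat.cast_nonneg p : (0 : ℝ) ≤ p)
    linarith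
  set e : ℝ := ((1 / 2 : ℝ) ^ p) ^ b with he
  have he0 : 0 < e := by positivity
  have he1 : e ≤ 1 := Real.rpow_le_one (by positivity) (pow_le_one₀ (by norm_num) (by norm_num)) hb0.le
  have hee : e ≤ c₁ * logRate n ^ (b / (s + b)) := by
    rw [← logRate_rpow_rpow hs0 hn, ← hRdef, hc₁, ← Real.mul_rpow (by positivity) hR0.le]
    have h1 : e = ((2 : ℝ) ^ (p * s)) ^ (-b / s) := by
      rw [he, one_div, inv_pow, Real.inv_rpow (by positivity), ← Real.rpow_neg (by positivity),
        pow_mul, ← Real.rpow_natCast ((2 : ℝ) ^ p) s, ← Real.rpow_mul (by positivity)]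
      congr 1
      field_simp
    rw [h1]
    refine Real.rpow_le_rpow_of_nonpos (by positivity) ?_ (div_nonpos_of_nonpos_of_nonneg
      (by linarith) hs0.le)
    rw [div_mul_eq_mul_div, div_le_iff₀ (by positivity), mul_comm κ, ← hpow, ← pow_succ]
    exact hp2.le
  obtain ⟨T, u, hTd, hTw, hTn, hTp, hTu⟩ := happ p hp f hf
  set J := ⌊p * b⌋₊ + 1 with hJ
  have hpb : 0 ≤ (p : ℝ) * b := by positivity
  have he' : e = (1 / 2 : ℝ) ^ (p * b) := by
    rw [he, ← Real.rpow_natCast, ← Real.rpow_mul (by norm_num)]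
  have hJ1 : (1 / 2 : ℝ) ^ J ≤ e := by
    rw [he', ← Real.rpow_natCast]
    refine Real.rpow_le_rpow_of_exponent_ge (by norm_num) (by norm_num) ?_
    rw [hJ]
    push_cast
    exact (Nat.lt_floor_add_one _).le
  have hJ2 : e / 2 ≤ (1 / 2 : ℝ) ^ J := by
    have h1 : (1 / 2 : ℝ) ^ J = (1 / 2) ^ (⌊p * b⌋₊ : ℝ) * (1 / 2) := by
      rw [hJ, pow_succ, Real.rpow_natCast]
    have h2 : e ≤ (1 / 2) ^ (⌊p * b⌋₊ : ℝ) := by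
      rw [he']
      exact Real.rpow_le_rpow_of_exponent_ge (by norm_num) (by norm_num) (Nat.floor_le hpb)
    rw [h1]
    linarith
  have hbound : ∀ x : Cube d, |T.eval (toVec x)| ≤ F := by
    intro x
    obtain ⟨hu0, hu1, -, hT⟩ := hTu x
    have h1 := abs_truncLogit_le J hu0 hu1
    have h2 : |T.eval (toVec x)| ≤ |truncLogit J (u x)| + C₀ * e := by
      have := abs_sub_abs_le_abs_sub (T.eval (toVec x)) (truncLogit J (u x))
      linarith
    have h3 : (J : ℝ) ≤ p * b + 1 := by
      rw [hJ]; push_cast; linarith [Nat.floor_le hpb]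
    have h4 : (J : ℝ) * Real.log 2 ≤ p * b * Real.log 2 + 1 := by
      have h5 := Real.log_two_lt_d9
      have h6 := mul_le_mul_of_nonneg_right h3 (Real.log_pos one_lt_two).le
      linarith
    have h5 : (p : ℝ) * b * Real.log 2 ≤
        b / (s + b) * (Real.log n - 5 * Real.log (Real.log n)) := by
      have h6 := mul_le_mul_of_nonneg_left hlogR (by positivity : 0 ≤ b / s)
      have e1 : b / s * ((p * s : ℝ) * Real.log 2) = p * b * Real.log 2 := by field_simp
      have e2 : b / s * (s / (s + b) * (Real.log n - 5 * Real.log (Real.log n))) =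
          b / (s + b) * (Real.log n - 5 * Real.log (Real.log n)) := by field_simp
      rwa [e1, e2] at h6
    have h6 : C₀ * e ≤ C₀ := mul_le_of_le_one_right hC₀.le he1
    rw [mul_sub] at h5
    linarith
  have hmem : T.eval ∈ FNN d G N S B F := by
    refine ⟨⟨T, rfl, ?_, hTw.mono ?_, ?_, hTp.mono hB⟩, hbound⟩
    · refine le_trans ?_ hG
      calc (T.depth : ℝ) ≤ D * (p + 1) := by exact_mod_cast hTd
        _ ≤ D * (3 * Real.log n) := by gcongr
        _ = _ := by ring
    · push_cast
      have h1 : C * (2 : ℝ) ^ (p * s) * cN ≤ R := by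
        calc C * (2 : ℝ) ^ (p * s) * cN ≤ C * (R * κ) * cN := by rw [← hpow]; gcongr
          _ = R * (C * κ * cN) := by ring
          _ ≤ R * 1 := by gcongr
          _ = R := mul_one R
      have h2 := h1.trans hN
      rw [mul_comm cN] at h2
      exact le_of_mul_le_mul_right h2 hcN
    · have h1 : C * ((p : ℝ) + 1) * 2 ^ (p * s) * cS ≤ R * Real.log n := by
        calc C * ((p : ℝ) + 1) * 2 ^ (p * s) * cS ≤ C * (3 * Real.log n) * (R * κ) * cS := by
              rw [← hpow]; gcongr
          _ = R * Real.log n * (3 * C * κ * cS) := by ring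
          _ ≤ R * Real.log n * 1 := by gcongr
          _ = _ := mul_one _
      have h2 := h1.trans hS
      rw [mul_comm cS] at h2
      refine le_trans ?_ (le_of_mul_le_mul_right h2 hcS)
      exact_mod_cast hTn
  refine ⟨T.eval, hmem, ?_⟩
  have hmeas := measurable_of_mem_FNN hmem
  have hKL : ∀ᵐ x ∂P.fst, bernKL (condProb P x) (T.eval (toVec x)) ≤ e * (1 + 3 * C₀ + 4 * C₀ ^ 2) := by
    filter_upwards [hP] with x hx
    obtain ⟨hu0, hu1, hu, hT⟩ := hTu x
    have c0 := condProb_nonneg P x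
    have c1 := condProb_le_one P x
    rw [clip01_of_mem (hx ▸ c0) (hx ▸ c1), ← hx] at hu
    have h1 := bernKL_le_add c0 c1 hT
    have h2 := bernKL_truncLogit_le (J := J) c0 c1 hu0 hu1 hu
    have h3 : (C₀ * e) ^ 2 / (1 / 2) ^ J ≤ 2 * C₀ ^ 2 * e := by
      rw [div_le_iff₀ (by positivity)]
      linarith [mul_le_mul_of_nonneg_left hJ2 (by positivity : 0 ≤ 2 * C₀ ^ 2 * e)]
    linarith
  calc meanKL P (fun x => T.eval (toVec x)) ≤ ∫ _, e * (1 + 3 * C₀ + 4 * C₀ ^ 2) ∂P.fst :=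
        integral_mono_ae (integrable_bernKL P hmeas hbound) (integrable_const _) hKL
    _ = e * (1 + 3 * C₀ + 4 * C₀ ^ 2) := by simp
    _ ≤ c₁ * logRate n ^ (b / (s + b)) * (1 + 3 * C₀ + 4 * C₀ ^ 2) := by gcongr
    _ = _ := by ring

set_option maxHeartbeats 1000000 in
/-- The `1 / n`-covering of the network class contributes a stochastic
error of the order of the rate: the logarithm of the covering number is of order `R (log n) ^ 4`. -/
theorem exists_cover_le (d : ℕ) (hd : 1 ≤ d) {σ b ν cG cN cS cB cF : ℝ} (hσ : 0 < σ) (hb : 0 < b)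
    (hν : 0 ≤ ν) (hcG : 0 < cG) (hcN : 0 < cN) (hcS : 0 < cS) (hcB : 0 < cB) (hcF : 0 < cF) :
    ∃ c : ℝ, 0 < c ∧ ∀ᶠ n : ℕ in atTop, ∀ G N S B F : ℝ, G ≤ cG * Real.log n →
      N ≤ cN * logRate n ^ (-σ / (σ + b)) → S ≤ cS * (logRate n ^ (-σ / (σ + b)) * Real.log n) →
      1 ≤ B → B ≤ cB * (n : ℝ) ^ ν → F ≤ cF * Real.log n →
      ∃ (ι : Type) (_ : Fintype ι) (g : ι → (Fin d → ℝ) → ℝ), (∀ i, g i ∈ FNN d G N S B F) ∧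
        (∀ f ∈ FNN d G N S B F, ∃ i, ∀ x : Cube d, |f (toVec x) - g i (toVec x)| ≤ 1 / n) ∧
        3 * (1 / (n : ℝ)) + 8 * (F + 2) / n * Real.log (Fintype.card ι) ≤
          c * logRate n ^ (b / (σ + b)) := by
  set a : ℝ := cN + d + 3 with ha
  set b₁ : ℝ := cB + ν with hb₁
  set c₁ : ℝ := 14 + 2 * a + b₁ + cG + (cG + 1) * (1 + a + b₁) with hc₁
  set c₂ : ℝ := (cG + 1) * (a + 2 * cS * c₁) with hc₂
  have ha0 : 0 < a := by positivity
  have hb₁0 : 0 < b₁ := by positivity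
  have hc₁0 : 0 < c₁ := by positivity
  have hc₂0 : 0 < c₂ := by positivity
  refine ⟨3 + 8 * (cF + 2) * c₂, by positivity, ?_⟩
  filter_upwards [eventually_ge_atTop 3, (tendsto_logRate_rpow hσ hb).eventually_ge_atTop 1]
    with n hn hR1 G N S B F hG hN hS hB1 hB hF
  set R := logRate n ^ (-σ / (σ + b)) with hR
  have hRn : R ≤ n := logRate_rpow_le hσ hb hn
  have hl1 := one_le_log_of_three_le hn
  have hn3 : (3 : ℝ) ≤ n := by exact_mod_cast hn
  have hn0 : (0 : ℝ) < n := by linarith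
  rw [← logRate_rpow_mul hσ hb hn, ← hR]
  have hρ : logRate n = Real.log n ^ 5 / n := rfl
  set l := Real.log n with hl
  have hll : l ≤ l ^ 2 := le_self_pow₀ hl1 two_ne_zero
  set D := ⌈cN * R⌉₊ + d with hD
  set s := ⌊cS * (R * l)⌋₊ with hs
  set L := ⌊cG * l⌋₊ with hL
  have hDle : (D : ℝ) + 1 ≤ (cN + d + 2) * n := by
    have h1 := (Nat.ceil_lt_add_one (by positivity : 0 ≤ cN * R)).le
    have h2 : cN * R ≤ cN * n := by gcongr
    have h3 : (d : ℝ) ≤ d * n := le_mul_of_one_le_right (Nat.cast_nonneg d) (by linarith)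
    rw [hD]
    push_cast
    linarith
  have hD1 : (1 : ℝ) ≤ D := by
    rw [hD]; exact_mod_cast (by omega : 1 ≤ ⌈cN * R⌉₊ + d)
  have hlogD1 : Real.log (D + 1) ≤ a * l := by
    calc Real.log (D + 1) ≤ Real.log ((cN + d + 2) * n) := Real.log_le_log (by positivity) hDle
      _ = Real.log (cN + d + 2) + l := by rw [Real.log_mul (by positivity) hn0.ne']
      _ ≤ (cN + d + 2) * l + l := by
          have h1 := Real.log_le_sub_one_of_pos (by positivity : 0 < cN + d + 2)
          have h2 : cN + d + 2 ≤ (cN + d + 2) * l := le_mul_of_one_le_right (by positivity) hl1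
          linarith
      _ = a * l := by rw [ha]; ring
  have hlogD : Real.log D ≤ a * l := (Real.log_le_log (by linarith) (by linarith)).trans hlogD1
  have hlogB : Real.log B ≤ b₁ * l := by
    calc Real.log B ≤ Real.log (cB * (n : ℝ) ^ ν) := Real.log_le_log (by linarith) hB
      _ = Real.log cB + ν * l := by
          rw [Real.log_mul (by positivity) (by positivity), Real.log_rpow hn0]
      _ ≤ cB * l + ν * l := by
          have h1 := Real.log_le_sub_one_of_pos hcB
          have h2 : cB ≤ cB * l := le_mul_of_one_le_right hcB.le hl1
          linarith
      _ = b₁ * l := by rw [hb₁]; ring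
  have hLle : (L : ℝ) ≤ cG * l := Nat.floor_le (by positivity)
  have hL1 : (L : ℝ) + 1 ≤ (cG + 1) * l := by linarith
  have hsle : (s : ℝ) ≤ cS * (R * l) := Nat.floor_le (by positivity)
  obtain ⟨ι, hι, g, hg, hcov, hcard⟩ := FNN_cover d D s L hd (by omega) (G := G) (N := N) (S := S)
    (B := B) (F := F) (δ := 1 / n) (hG.trans_lt (Nat.lt_floor_add_one _))
    (hN.trans ((Nat.le_ceil _).trans (by rw [hD]; push_cast; linarith [(Nat.cast_nonneg d : (0 : ℝ) ≤ d)])))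
    (hS.trans_lt (Nat.lt_floor_add_one _)) hB1 (by positivity)
    (by rw [div_le_one hn0]; linarith)
  refine ⟨ι, hι, g, hg, hcov, ?_⟩
  have hQ : Real.log (14 * D * D * B * (L + 1) * (2 * D * B) ^ (L + 1) / (1 / n)) ≤ c₁ * l ^ 2 := by
    have hB0 : 0 < B := by linarith
    have hD0 : (0 : ℝ) < D := by linarith
    rw [div_div_eq_mul_div, div_one, Real.log_mul (by positivity) hn0.ne',
      Real.log_mul (by positivity) (by positivity), Real.log_mul (by positivity) (by positivity),
      Real.log_mul (by positivity) hB0.ne', Real.log_mul (by positivity) hD0.ne',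
      Real.log_mul (by positivity) hD0.ne', Real.log_pow, Real.log_mul (by positivity) hB0.ne',
      Real.log_mul (by positivity) hD0.ne']
    have h14 := Real.log_le_sub_one_of_pos (by norm_num : (0 : ℝ) < 14)
    have h2 := Real.log_le_sub_one_of_pos (by norm_num : (0 : ℝ) < 2)
    have hLl := Real.log_le_sub_one_of_pos (by positivity : (0 : ℝ) < L + 1)
    have h3 : Real.log 2 + Real.log D + Real.log B ≤ (1 + a + b₁) * l := by linarith
    have h4 : ((L + 1 : ℕ) : ℝ) * (Real.log 2 + Real.log D + Real.log B) ≤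
        (cG + 1) * l * ((1 + a + b₁) * l) := by
      push_cast
      calc _ ≤ ((L : ℝ) + 1) * ((1 + a + b₁) * l) := by gcongr
        _ ≤ _ := by gcongr
    have h5 : (14 + 2 * a + b₁ + cG) * l ≤ (14 + 2 * a + b₁ + cG) * l ^ 2 := by gcongr
    have h6 : Real.log 14 ≤ 13 * l := by linarith
    rw [hc₁]
    linarith
  have hM : Real.log (Fintype.card ι) ≤ c₂ * (R * l ^ 4) := by
    refine hcard.trans ?_
    calc _ ≤ ((L : ℝ) + 1) * (a * l + 2 * s * (c₁ * l ^ 2)) := by gcongr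
      _ ≤ (cG + 1) * l * (a * l + 2 * (cS * (R * l)) * (c₁ * l ^ 2)) := by gcongr
      _ ≤ (cG + 1) * l * (a * (R * l ^ 3) + 2 * (cS * (R * l)) * (c₁ * l ^ 2)) := by
          gcongr
          have h1 : l ≤ l ^ 3 := le_self_pow₀ hl1 (by norm_num)
          calc l ≤ l ^ 3 := h1
            _ ≤ R * l ^ 3 := le_mul_of_one_le_left (by positivity) hR1
      _ = _ := by rw [hc₂]; ring
  have hF2 : F + 2 ≤ (cF + 2) * l := by linarith
  have h0 : 0 ≤ Real.log (Fintype.card ι) := Real.log_natCast_nonneg _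
  have h1 : 8 * (F + 2) / n * Real.log (Fintype.card ι) ≤
      8 * ((cF + 2) * l) / n * (c₂ * (R * l ^ 4)) := by
    calc _ ≤ 8 * ((cF + 2) * l) / n * Real.log (Fintype.card ι) := by gcongr
      _ ≤ _ := by gcongr
  have h2 : 1 / (n : ℝ) ≤ R * (l ^ 5 / n) := by
    have : 1 ≤ R * l ^ 5 := one_le_mul_of_one_le_of_one_le hR1 (one_le_pow₀ hl1)
    rw [← mul_div_assoc]
    gcongr
  have h3 : 8 * ((cF + 2) * l) / n * (c₂ * (R * l ^ 4)) = 8 * (cF + 2) * c₂ * (R * (l ^ 5 / n)) := by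
    ring
  rw [hρ]
  linarith

theorem Lesssim.eventually_le {u v : ℕ → ℝ} (h : Lesssim u v) :
    ∃ c : ℝ, 0 < c ∧ ∀ᶠ n in atTop, u n ≤ c * v n := by
  obtain ⟨n₀, c, hc, h⟩ := h
  refine ⟨c, hc, ?_⟩
  filter_upwards [eventually_ge_atTop n₀] with n hn
  exact h n hn

theorem Lesssim.of_eventually_le {u : ℕ → ℝ≥0∞} {v : ℕ → ℝ} {c : ℝ} (hc : 0 < c)
    (h : ∀ᶠ n in atTop, u n ≤ ENNReal.ofReal (c * v n)) :
    Lesssim u fun n => ENNReal.ofReal (v n) := by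
  obtain ⟨n₀, h⟩ := eventually_atTop.mp h
  refine ⟨n₀, c.toNNReal, Real.toNNReal_pos.mpr hc, fun n hn => (h n hn).trans (le_of_eq ?_)⟩
  rw [ENNReal.ofReal_mul hc.le]
  rfl

end LogisticDNN

end

theorem theorem2p3 (q dmax dhol : ℕ) (hdmax : 1 ≤ dmax) (hdhol : 1 ≤ dhol)
    (β r : ℝ) (hβ : 0 < β) (hr : 0 < r) :
    ∃ c : ℝ, 0 < c ∧
      ∀ d K : ℕ, 1 ≤ d → 1 ≤ K → dhol ≤ min d (if q = 0 then d else K) →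
      ∀ ν : ℝ, 0 ≤ ν →
      ∀ G N S B F : ℕ → ℝ,
        (∀ᶠ n : ℕ in Filter.atTop, c * Real.log n ≤ G n) →
        LogisticDNN.Lesssim G (fun n => Real.log n) →
        LogisticDNN.Asymp N (fun n => LogisticDNN.logRate n ^
          (-(dhol : ℝ) / (dhol + LogisticDNN.effSmooth β q))) →
        LogisticDNN.Asymp S (fun n => LogisticDNN.logRate n ^
          (-(dhol : ℝ) / (dhol + LogisticDNN.effSmooth β q)) * Real.log n) →
        (∀ᶠ n : ℕ in Filter.atTop, 1 ≤ B n) →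
        LogisticDNN.Lesssim B (fun n => (n : ℝ) ^ ν) →
        (∀ᶠ n : ℕ in Filter.atTop, LogisticDNN.effSmooth β q /
          (dhol + LogisticDNN.effSmooth β q) * Real.log n ≤ F n) →
        LogisticDNN.Lesssim F (fun n => Real.log n) →
      ∀ fhat : (n : ℕ) → (Fin n → LogisticDNN.Cube d × LogisticDNN.Label) →
          (Fin d → ℝ) → ℝ,
        (∀ᶠ n : ℕ in Filter.atTop, LogisticDNN.IsERM
          (LogisticDNN.FNN d (G n) (N n) (S n) (B n) (F n)) (fhat n)) →
        LogisticDNN.Lesssim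
          (fun n => ⨆ P ∈ LogisticDNN.DataClass q K dmax dhol β r d,
            LogisticDNN.sampleExpectation n P fun z =>
              LogisticDNN.excessLogisticRisk P fun x => fhat n z (LogisticDNN.toVec x))
          (fun n => ENNReal.ofReal (LogisticDNN.logRate n ^
            (LogisticDNN.effSmooth β q / (dhol + LogisticDNN.effSmooth β q)))) ∧
        LogisticDNN.Lesssim
          (fun n => ⨆ P ∈ LogisticDNN.DataClass q K dmax dhol β r d,
            LogisticDNN.sampleExpectation n P fun z =>
              LogisticDNN.excessMisclassError P fun x => fhat n z (LogisticDNN.toVec x))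
          (fun n => ENNReal.ofReal (LogisticDNN.logRate n ^
            (LogisticDNN.effSmooth β q / (2 * dhol + 2 * LogisticDNN.effSmooth β q)))) := by
  open LogisticDNN in
  obtain ⟨D, hD⟩ := exists_mem_FNN_meanKL_le dmax dhol hdhol β r hβ hr q
  refine ⟨3 * D + 1, by positivity, ?_⟩
  intro d K hd hK _ ν hν G N S B F hG hGu hN hS hB hBu hF hFu fhat hfhat
  have hs0 : (0 : ℝ) < dhol := by exact_mod_cast hdhol
  have hb0 : 0 < effSmooth β q := effSmooth_pos hβ q
  obtain ⟨cG, hcG, hGu⟩ := hGu.eventually_le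
  obtain ⟨cN, hcN, hNu⟩ := hN.1.eventually_le
  obtain ⟨cN', hcN', hNl⟩ := hN.2.eventually_le
  obtain ⟨cS, hcS, hSu⟩ := hS.1.eventually_le
  obtain ⟨cS', hcS', hSl⟩ := hS.2.eventually_le
  obtain ⟨cB, hcB, hBu⟩ := hBu.eventually_le
  obtain ⟨cF, hcF, hFu⟩ := hFu.eventually_le
  obtain ⟨c₁, hc₁, happ⟩ := hD d K hK cN' cS' hcN' hcS'
  obtain ⟨c₂, hc₂, hcov⟩ := exists_cover_le d hd hs0 hb0 hν hcG hcN hcS hcB hcF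
  have hc : 0 < 2 * c₁ + c₂ := by positivity
  have key : ∀ᶠ n : ℕ in Filter.atTop, 3 ≤ n ∧ ∀ P ∈ DataClass q K dmax dhol β r d,
      ∫⁻ z, ENNReal.ofReal (meanKL P fun x => fhat n z (toVec x))
        ∂(MeasureTheory.Measure.pi fun _ : Fin n =>
          (P : MeasureTheory.Measure (Cube d × Label))) ≤
        ENNReal.ofReal ((2 * c₁ + c₂) *
          logRate n ^ (effSmooth β q / (dhol + effSmooth β q))) := by
    filter_upwards [Filter.eventually_ge_atTop 3, hG, hGu, hNu, hNl, hSu, hSl, hB, hBu, hF, hFu,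
      hfhat, happ, hcov] with n hn hG hGu hNu hNl hSu hSl hB hBu hF hFu hfhat happ hcov
    refine ⟨hn, fun P hP => ?_⟩
    obtain ⟨f, hf, hPf⟩ := hP
    have hl1 := one_le_log_of_three_le hn
    obtain ⟨f₀, hf₀, hKL⟩ := happ (G n) (N n) (S n) (B n) (F n) (by linarith) hNl hSl hB hF P f hf hPf
    obtain ⟨ι, _, g, hg, hgc, hle⟩ := hcov (G n) (N n) (S n) (B n) (F n) hGu hNu hSu hB hBu hFu
    have hF0 : 0 ≤ F n := le_trans (by positivity) hF
    refine (erm_oracle (by omega) (P : MeasureTheory.Measure (Cube d × Label)) hF0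
      (fun f hf => measurable_of_mem_FNN hf) (fun f hf => hf.2) g hg hgc hfhat hf₀).trans
      (ENNReal.ofReal_le_ofReal ?_)
    linarith
  constructor
  · refine Lesssim.of_eventually_le hc ?_
    filter_upwards [key, hfhat] with n hn hfhat
    refine iSup₂_le fun P hP => le_trans ?_ (hn.2 P hP)
    exact MeasureTheory.lintegral_mono fun z =>
      excessLogisticRisk_le _ (measurable_of_mem_FNN (hfhat.mem z)) (hfhat.mem z).2
  · refine Lesssim.of_eventually_le (c := 2 + (2 * c₁ + c₂)) (by positivity) ?_
    filter_upwards [key, hfhat] with n hn hfhat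
    refine iSup₂_le fun P hP => ?_
    have hρ := logRate_pos hn.1
    -- the square root of the rate balances the two terms of the comparison inequality
    set a : ℝ := logRate n ^ (effSmooth β q / (2 * dhol + 2 * effSmooth β q)) with ha
    have ha0 : 0 < a := Real.rpow_pos_of_pos hρ _
    have haa : logRate n ^ (effSmooth β q / (dhol + effSmooth β q)) = a * a := by
      rw [ha, ← Real.rpow_add hρ]
      congr 1
      field_simp
      ring
    have h1 := hn.2 P hP
    rw [haa] at h1
    calc _ ≤ ∫⁻ z, (ENNReal.ofReal (2 * a) + ENNReal.ofReal (1 / a) *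
          ENNReal.ofReal (meanKL P fun x => fhat n z (toVec x)))
          ∂(MeasureTheory.Measure.pi fun _ : Fin n =>
            (P : MeasureTheory.Measure (Cube d × Label))) := by
          refine MeasureTheory.lintegral_mono fun z => ?_
          refine (excessMisclassError_le _ (measurable_of_mem_FNN (hfhat.mem z))
            (hfhat.mem z).2 ha0).trans (le_of_eq ?_)
          rw [← ENNReal.ofReal_mul (by positivity), ← ENNReal.ofReal_add (by positivity)
            (mul_nonneg (by positivity) (meanKL_nonneg _)), one_div_mul_eq_div]
      _ ≤ ENNReal.ofReal (2 * a) +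
          ENNReal.ofReal (1 / a) * ENNReal.ofReal ((2 * c₁ + c₂) * (a * a)) := by
          rw [MeasureTheory.lintegral_add_left measurable_const, MeasureTheory.lintegral_const,
            MeasureTheory.measure_univ, mul_one,
            MeasureTheory.lintegral_const_mul' _ _ ENNReal.ofReal_ne_top]
          gcongr
      _ = ENNReal.ofReal ((2 + (2 * c₁ + c₂)) * a) := by
          rw [← ENNReal.ofReal_mul (by positivity), ← ENNReal.ofReal_add (by positivity)
            (by positivity)]
          congr 1
          field_simp
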